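/- Let $X$ be a closed (compact, without boundary) smooth manifold of dimension $n$ with a smooth positive density $dx$, let $X^\wedge=(0,\infty)\times X$ with coordinates $(t,x)$, and write $\langle t\rangle=(1+t^2)^{1/2}$. All functions are complex-valued. For $\gamma\in\mathbb R$ let $\mathcal K^{0,\gamma}_2(X^\wedge)=L^2\big(X^\wedge,\min(t,1)^{-2\gamma}\,t^n\,dt\,dx\big)$. For $\gamma\in\mathbb R$ and $\varepsilon>0$ let $\mathscr S^\gamma_\varepsilon(X^\wedge)$ be the Fréchet space of all smooth functions $u$ on $X^\wedge$ such that $$t^{\frac{n+1}2-\gamma-\delta}\langle t\rangle^k(t\partial_t)^pD_xu\in L^2\Big(X^\wedge,\frac{dt}{t}dx\Big)$$ for all $k\in\mathbb Z$, $p\in\mathbb N_0$, all differential operators $D$ with smooth coefficients on $X$, and all $0\le\delta<\varepsilon$, with the topology defined by the corresponding $L^2$-norms. Let $$\mathscr S^{\gamma',\gamma}_\varepsilon(X^\wedge\times X^\wedge)=\mathscr S^{\gamma'}_\varepsilon(X^\wedge)\,\widehat\otimes_\pi\,\mathscr S^{\gamma}_\varepsilon(X^\wedge)$$ be the completed projective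 tensor product, whose elements are regarded as functions on $X^\wedge\times X^\wedge$ through the continuous extension of $u\otimes v\mapsto u(t,x)v(s,y)$. Let $\gamma,\gamma'\in\mathbb R$ and $\varepsilon>0$, and let $\mathcal R_G(\gamma,\gamma')_\varepsilon$ be the space of all bounded operators $A:\mathcal K^{0,\gamma}_2(X^\wedge)\to\mathcal K^{0,\gamma'}_2(X^\wedge)$ such that the range of $A$ is contained in $\mathscr S^{\gamma'}_\varepsilon(X^\wedge)$ and the range of the adjoint $A^*:\mathcal K^{0,-\gamma'}_2(X^\wedge)\to\mathcal K^{0,-\gamma}_2(X^\wedge)$ is contained in $\mathscr S^{-\gamma}_\varepsilon(X^\wedge)$; here the adjoint refers to the pairings induced by the inner product of $\mathcal K^{0,0}_2(X^\wedge)=L^2(X^\wedge,t^n\,dt\,dx)$. Give $\mathcal R_G(\gamma,\gamma')_\varepsilon$ the initial topology with respect to $A\mapsto A$ and $A\mapsto A^*$ into the operators $\mathcal K^{0,\gamma}_2(X^\wedge)\to\mathscr S^{\gamma'}_\varepsilon(X^\wedge)$ and $\mathcal K^{0,-\gamma'}_2(X^\wedge)\to\mathscr S^{-\gamma}_\varepsilon(X^\wedge)$,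 each with the topology of uniform convergence on bounded sets. Then every $A\in\mathcal R_G(\gamma,\gamma')_\varepsilon$ is an integral operator $$(Au)(t,x)=\int_0^\infty\!\!\int_X k_A(t,x,s,y)\,u(s,y)\,s^n\,dy\,ds$$ with a unique kernel $k_A\in\mathscr S^{\gamma',-\gamma}_{\varepsilon/2}(X^\wedge\times X^\wedge)$, and the linear map $$A\mapsto k_A:\ \mathcal R_G(\gamma,\gamma')_\varepsilon\longrightarrow\mathscr S^{\gamma',-\gamma}_{\varepsilon/2}(X^\wedge\times X^\wedge)$$ is continuous. -/

import Mathlib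

open Set MeasureTheory Filter Topology
open scoped Manifold ContDiff ENNReal TensorProduct ComplexConjugate

set_option linter.unusedSectionVars false

noncomputable section

namespace ConeGreen

section Smooth

variable {n : ℕ} {X : Type*} [TopologicalSpace X] [ChartedSpace (EuclideanSpace ℝ (Fin n)) X]

/-- The open cone `X^∧ = (0, ∞) × X`, realised as a subset of `ℝ × X`. -/
def cone (X : Type*) : Set (ℝ × X) := Ioi (0 : ℝ) ×ˢ univ

theorem isOpen_cone : IsOpen (cone X) := isOpen_Ioi.prod isOpen_univ

/-- The differential operators with smooth complex coefficients on `X`: the operators obtained from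
multiplications by smooth functions and from smooth vector fields by sums and compositions. -/
inductive IsDiffOp (n : ℕ) {X : Type*} [TopologicalSpace X]
    [ChartedSpace (EuclideanSpace ℝ (Fin n)) X] [IsManifold (𝓡 n) ∞ X] :
    ((X → ℂ) → (X → ℂ)) → Prop
  | mul (a : X → ℂ) (ha : ContMDiff (𝓡 n) 𝓘(ℝ, ℂ) ∞ a) :
      IsDiffOp n (fun f x => a x * f x)
  | vectorField (V : ∀ x : X, TangentSpace (𝓡 n) x)
      (hV : ContMDiff (𝓡 n) (𝓡 n).tangent ∞ (fun x => (⟨x, V x⟩ : TangentBundle (𝓡 n) X))) :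
      IsDiffOp n (fun f x => mfderiv (𝓡 n) 𝓘(ℝ, ℂ) f x (V x))
  | add {D D' : (X → ℂ) → (X → ℂ)} (hD : IsDiffOp n D) (hD' : IsDiffOp n D') :
      IsDiffOp n (fun f => D f + D' f)
  | comp {D D' : (X → ℂ) → (X → ℂ)} (hD : IsDiffOp n D) (hD' : IsDiffOp n D') :
      IsDiffOp n (fun f => D (D' f))

/-- A differential operator on `X`, acting on functions of `(t, x)` in the variable `x`. -/
def sliceOp (D : (X → ℂ) → (X → ℂ)) (u : ℝ × X → ℂ) : ℝ × X → ℂ :=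
  fun z => D (fun y => u (z.1, y)) z.2

/-- The operator `t ∂_t`. -/
def radialDeriv (u : ℝ × X → ℂ) : ℝ × X → ℂ :=
  fun z => (z.1 : ℂ) * deriv (fun t : ℝ => u (t, z.2)) z.1

/-- Smoothness on the open cone. -/
def SmoothOnCone (n : ℕ) {X : Type*} [TopologicalSpace X]
    [ChartedSpace (EuclideanSpace ℝ (Fin n)) X] (u : ℝ × X → ℂ) : Prop :=
  ContMDiffOn (𝓘(ℝ, ℝ).prod (𝓡 n)) 𝓘(ℝ, ℂ) ∞ u (cone X)

theorem SmoothOnCone.mdifferentiableAt {u : ℝ × X → ℂ} (hu : SmoothOnCone n u) {z : ℝ × X}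
    (hz : z ∈ cone X) : MDifferentiableAt (𝓘(ℝ, ℝ).prod (𝓡 n)) 𝓘(ℝ, ℂ) u z :=
  (hu.contMDiffAt (isOpen_cone.mem_nhds hz)).mdifferentiableAt (by simp)

theorem SmoothOnCone.congr {u v : ℝ × X → ℂ} (hu : SmoothOnCone n u) (h : EqOn v u (cone X)) :
    SmoothOnCone n v := ContMDiffOn.congr hu h

theorem SmoothOnCone.add {u v : ℝ × X → ℂ} (hu : SmoothOnCone n u) (hv : SmoothOnCone n v) :
    SmoothOnCone n (u + v) := ContMDiffOn.add hu hv

theorem SmoothOnCone.smul {u : ℝ × X → ℂ} (c : ℂ) (hu : SmoothOnCone n u) :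
    SmoothOnCone n (c • u) := by
  have h : ContMDiff 𝓘(ℝ, ℂ) 𝓘(ℝ, ℂ) ∞ (fun w : ℂ => c * w) :=
    (contDiff_const.mul contDiff_id).contMDiff
  exact h.comp_contMDiffOn hu

variable [IsManifold (𝓡 n) ∞ X]

theorem SmoothOnCone.mfderiv_apply {u : ℝ × X → ℂ} (hu : SmoothOnCone n u)
    (W : ∀ z : ℝ × X, TangentSpace (𝓘(ℝ, ℝ).prod (𝓡 n)) z)
    (hW : ContMDiff (𝓘(ℝ, ℝ).prod (𝓡 n)) (𝓘(ℝ, ℝ).prod (𝓡 n)).tangent ∞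
      (fun z => (⟨z, W z⟩ : TangentBundle (𝓘(ℝ, ℝ).prod (𝓡 n)) (ℝ × X)))) :
    SmoothOnCone n (fun z => mfderiv (𝓘(ℝ, ℝ).prod (𝓡 n)) 𝓘(ℝ, ℂ) u z (W z)) := by
  have h1 := ContMDiffOn.contMDiffOn_tangentMapWithin (m := ∞) hu (by simp)
    (isOpen_cone (X := X)).uniqueMDiffOn
  have h2 := (contMDiff_snd_tangentBundle_modelSpace (n := ∞) ℂ 𝓘(ℝ, ℂ)).comp_contMDiffOn
    (h1.comp hW.contMDiffOn (s := cone X) (fun z hz => hz))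
  refine h2.congr (fun z hz => ?_)
  simp only [Function.comp, tangentMapWithin]
  rw [mfderivWithin_of_mem_nhds (isOpen_cone.mem_nhds hz)]

theorem SmoothOnCone.slice_deriv {u : ℝ × X → ℂ} (hu : SmoothOnCone n u) {z : ℝ × X}
    (hz : z ∈ cone X) (v : TangentSpace (𝓡 n) z.2) :
    mfderiv (𝓡 n) 𝓘(ℝ, ℂ) (fun y => u (z.1, y)) z.2 v =
      mfderiv (𝓘(ℝ, ℝ).prod (𝓡 n)) 𝓘(ℝ, ℂ) u z ((0, v) : ℝ × EuclideanSpace ℝ (Fin n)) := by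
  have h := mfderiv_comp (I := 𝓡 n) (I' := 𝓘(ℝ, ℝ).prod (𝓡 n)) (I'' := 𝓘(ℝ, ℂ)) z.2
    (f := fun y : X => (z.1, y)) (g := u)
    (hu.mdifferentiableAt hz)
    ((contMDiff_const.prodMk contMDiff_id).contMDiffAt.mdifferentiableAt (n := ∞) (by simp))
  have h' := congrArg (fun L => L v) h
  rw [mfderiv_prod_right] at h'
  exact h'

theorem SmoothOnCone.radial_deriv {u : ℝ × X → ℂ} (hu : SmoothOnCone n u) {z : ℝ × X}
    (hz : z ∈ cone X) (c : ℝ) :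
    c * deriv (fun t : ℝ => u (t, z.2)) z.1 =
      mfderiv (𝓘(ℝ, ℝ).prod (𝓡 n)) 𝓘(ℝ, ℂ) u z ((c, 0) : ℝ × EuclideanSpace ℝ (Fin n)) := by
  have h := mfderiv_comp (I := 𝓘(ℝ, ℝ)) (I' := 𝓘(ℝ, ℝ).prod (𝓡 n)) (I'' := 𝓘(ℝ, ℂ)) z.1
    (f := fun t : ℝ => (t, z.2)) (g := u)
    (hu.mdifferentiableAt hz)
    ((contMDiff_id.prodMk contMDiff_const).contMDiffAt.mdifferentiableAt (n := ∞) (by simp))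
  have h' := congrArg (fun L => L c) h
  rw [mfderiv_prod_left, mfderiv_eq_fderiv] at h'
  refine Eq.trans ?_ h'
  have := (fderiv ℝ (u ∘ fun t : ℝ => (t, z.2)) z.1).map_smul c 1
  simp only [smul_eq_mul, mul_one, fderiv_apply_one_eq_deriv] at this
  refine Eq.trans ?_ this.symm
  simp [Function.comp_def]

theorem SmoothOnCone.radialDeriv {u : ℝ × X → ℂ} (hu : SmoothOnCone n u) :
    SmoothOnCone n (radialDeriv u) := by
  refine (hu.mfderiv_apply (fun z => ((z.1, 0) : ℝ × EuclideanSpace ℝ (Fin n))) ?_).congr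
    (fun z hz => hu.radial_deriv hz z.1)
  have h1 : ContMDiff 𝓘(ℝ, ℝ) 𝓘(ℝ, ℝ).tangent ∞
      (fun t : ℝ => (⟨t, t⟩ : TangentBundle 𝓘(ℝ, ℝ) ℝ)) :=
    contMDiff_vectorSpace_iff_contDiff.2 contDiff_id
  have h2 : ContMDiff (𝓡 n) (𝓡 n).tangent ∞ (fun x : X => (⟨x, 0⟩ : TangentBundle (𝓡 n) X)) :=
    Bundle.contMDiff_zeroSection ℝ _
  have : IsManifold (𝓡 n) 1 X := IsManifold.of_le (n := ∞) (by simp)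
  exact contMDiff_equivTangentBundleProd_symm.comp
    ((h1.comp contMDiff_fst).prodMk (h2.comp contMDiff_snd))

theorem IsDiffOp.smoothOnCone {D : (X → ℂ) → (X → ℂ)} (hD : IsDiffOp n D) :
    ∀ {u : ℝ × X → ℂ}, SmoothOnCone n u → SmoothOnCone n (sliceOp D u) := by
  induction hD with
  | mul a ha =>
    intro u hu
    have h : ContMDiff 𝓘(ℝ, ℂ × ℂ) 𝓘(ℝ, ℂ) ∞ (fun w : ℂ × ℂ => w.1 * w.2) :=
      (contDiff_fst.mul contDiff_snd).contMDiff
    exact h.comp_contMDiffOn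
      (ContMDiffOn.prodMk_space (ha.comp contMDiff_snd).contMDiffOn hu)
  | vectorField V hV =>
    intro u hu
    refine (hu.mfderiv_apply (fun z => ((0, V z.2) : ℝ × EuclideanSpace ℝ (Fin n))) ?_).congr
      (fun z hz => hu.slice_deriv hz (V z.2))
    have h1 : ContMDiff 𝓘(ℝ, ℝ) 𝓘(ℝ, ℝ).tangent ∞
        (fun t : ℝ => (⟨t, 0⟩ : TangentBundle 𝓘(ℝ, ℝ) ℝ)) :=
      Bundle.contMDiff_zeroSection ℝ _
    have : IsManifold (𝓡 n) 1 X := IsManifold.of_le (n := ∞) (by simp)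
    exact contMDiff_equivTangentBundleProd_symm.comp
      ((h1.comp contMDiff_fst).prodMk (hV.comp contMDiff_snd))
  | add _ _ h1 h2 => intro u hu; exact (h1 hu).add (h2 hu)
  | comp _ _ h1 h2 => intro u hu; exact h1 (h2 hu)

theorem IsDiffOp.congr_cone {D : (X → ℂ) → (X → ℂ)} (_hD : IsDiffOp n D) {u v : ℝ × X → ℂ}
    (h : EqOn u v (cone X)) : EqOn (sliceOp D u) (sliceOp D v) (cone X) := by
  intro z hz
  have : (fun y => u (z.1, y)) = fun y => v (z.1, y) :=
    funext fun y => h (show (z.1, y) ∈ cone X from ⟨hz.1, trivial⟩)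
  simp only [sliceOp, this]

theorem radialDeriv_congr {u v : ℝ × X → ℂ}
    (h : EqOn u v (cone X)) : EqOn (radialDeriv u) (radialDeriv v) (cone X) := by
  intro z hz
  have : (fun t : ℝ => u (t, z.2)) =ᶠ[𝓝 z.1] fun t => v (t, z.2) := by
    filter_upwards [isOpen_Ioi.mem_nhds hz.1] with t ht
    exact h (show (t, z.2) ∈ cone X from ⟨ht, trivial⟩)
  simp only [radialDeriv, this.deriv_eq]

theorem IsDiffOp.map_add {D : (X → ℂ) → (X → ℂ)} (hD : IsDiffOp n D) :
    ∀ {u v : ℝ × X → ℂ}, SmoothOnCone n u → SmoothOnCone n v →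
      EqOn (sliceOp D (u + v)) (sliceOp D u + sliceOp D v) (cone X) := by
  induction hD with
  | mul a ha => intro u v hu hv z hz; simp [sliceOp, mul_add]
  | vectorField V hV =>
    intro u v hu hv z hz
    have h1 := (hu.add hv).slice_deriv hz (V z.2)
    rw [mfderiv_add (hu.mdifferentiableAt hz) (hv.mdifferentiableAt hz)] at h1
    refine h1.trans ?_
    exact congrArg₂ (fun a b : ℂ => a + b) (hu.slice_deriv hz (V z.2)).symm (hv.slice_deriv hz (V z.2)).symm
  | @add D D' _ _ h1 h2 =>
    intro u v hu hv z hz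
    have e1 := h1 hu hv hz
    have e2 := h2 hu hv hz
    simp only [sliceOp, Pi.add_apply] at e1 e2 ⊢
    rw [e1, e2]; ring
  | @comp D D' hD hD' h1 h2 =>
    intro u v hu hv z hz
    have e1 := hD.congr_cone (h2 hu hv) hz
    exact e1.trans (h1 (hD'.smoothOnCone hu) (hD'.smoothOnCone hv) hz)

theorem IsDiffOp.map_smul {D : (X → ℂ) → (X → ℂ)} (hD : IsDiffOp n D) (c : ℂ) :
    ∀ {u : ℝ × X → ℂ}, SmoothOnCone n u →
      EqOn (sliceOp D (c • u)) (c • sliceOp D u) (cone X) := by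
  induction hD with
  | mul a ha => intro u hu z hz; simp [sliceOp]; ring
  | vectorField V hV =>
    intro u hu z hz
    have h1 := (hu.smul c).slice_deriv hz (V z.2)
    have h2 : HasMFDerivAt (𝓘(ℝ, ℝ).prod (𝓡 n)) 𝓘(ℝ, ℂ) (c • u) z
        ((c • ContinuousLinearMap.id ℝ ℂ).comp
          (mfderiv (𝓘(ℝ, ℝ).prod (𝓡 n)) 𝓘(ℝ, ℂ) u z)) := by
      have h3 : HasMFDerivAt 𝓘(ℝ, ℂ) 𝓘(ℝ, ℂ) (fun w : ℂ => c * w) (u z)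
          (c • ContinuousLinearMap.id ℝ ℂ) :=
        ((hasFDerivAt_id (𝕜 := ℝ) (u z)).const_smul c).hasMFDerivAt
      exact h3.comp z (hu.mdifferentiableAt hz).hasMFDerivAt
    rw [h2.mfderiv] at h1
    refine h1.trans ?_
    exact congrArg (fun w : ℂ => c * w) (hu.slice_deriv hz (V z.2)).symm
  | @add D D' _ _ h1 h2 =>
    intro u hu z hz
    have e1 := h1 hu hz
    have e2 := h2 hu hz
    simp only [sliceOp, Pi.add_apply, Pi.smul_apply, smul_eq_mul] at e1 e2 ⊢
    rw [e1, e2]; ring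
  | @comp D D' hD hD' h1 h2 =>
    intro u hu z hz
    exact (hD.congr_cone (h2 hu) hz).trans (h1 (hD'.smoothOnCone hu) hz)

theorem SmoothOnCone.differentiableAt_radial {u : ℝ × X → ℂ} (hu : SmoothOnCone n u) {z : ℝ × X}
    (hz : z ∈ cone X) : DifferentiableAt ℝ (fun t : ℝ => u (t, z.2)) z.1 := by
  have h := MDifferentiableAt.comp (I := 𝓘(ℝ, ℝ)) (I' := 𝓘(ℝ, ℝ).prod (𝓡 n)) (I'' := 𝓘(ℝ, ℂ))
    (f := fun t : ℝ => (t, z.2)) (g := u) z.1 (hu.mdifferentiableAt hz)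
    ((contMDiff_id.prodMk contMDiff_const).contMDiffAt.mdifferentiableAt (n := ∞) (by simp))
  exact h.differentiableAt

/-- The operator `(t ∂_t)^p D_x`. -/
def coneOp (p : ℕ) (D : (X → ℂ) → (X → ℂ)) (u : ℝ × X → ℂ) : ℝ × X → ℂ :=
  radialDeriv^[p] (sliceOp D u)

theorem coneOp_smooth {D : (X → ℂ) → (X → ℂ)} (hD : IsDiffOp n D) (p : ℕ) {u : ℝ × X → ℂ}
    (hu : SmoothOnCone n u) : SmoothOnCone n (coneOp p D u) := by
  induction p with
  | zero => exact hD.smoothOnCone hu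
  | succ p ih =>
    simp only [coneOp, Function.iterate_succ_apply'] at ih ⊢
    exact ih.radialDeriv

theorem coneOp_add {D : (X → ℂ) → (X → ℂ)} (hD : IsDiffOp n D) (p : ℕ) {u v : ℝ × X → ℂ}
    (hu : SmoothOnCone n u) (hv : SmoothOnCone n v) :
    EqOn (coneOp p D (u + v)) (coneOp p D u + coneOp p D v) (cone X) := by
  induction p with
  | zero => exact hD.map_add hu hv
  | succ p ih =>
    intro z hz
    have h1 := coneOp_smooth hD p hu
    have h2 := coneOp_smooth hD p hv
    simp only [coneOp, Function.iterate_succ_apply', Pi.add_apply] at ih h1 h2 ⊢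
    rw [radialDeriv_congr ih hz]
    have e := deriv_add (h1.differentiableAt_radial hz) (h2.differentiableAt_radial hz)
    simp only [radialDeriv, Pi.add_apply, ← mul_add]
    exact congrArg _ e

theorem coneOp_smul {D : (X → ℂ) → (X → ℂ)} (hD : IsDiffOp n D) (p : ℕ) (c : ℂ)
    {u : ℝ × X → ℂ} (hu : SmoothOnCone n u) :
    EqOn (coneOp p D (c • u)) (c • coneOp p D u) (cone X) := by
  induction p with
  | zero => exact hD.map_smul c hu
  | succ p ih =>
    intro z hz
    have h1 := coneOp_smooth hD p hu
    simp only [coneOp, Function.iterate_succ_apply', Pi.smul_apply, smul_eq_mul] at ih h1 ⊢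
    rw [radialDeriv_congr ih hz]
    have e := deriv_const_mul c (h1.differentiableAt_radial hz)
    simp only [radialDeriv, Pi.smul_apply, smul_eq_mul]
    rw [e]; ring

end Smooth

section Measures

variable {X : Type*} [TopologicalSpace X] [MeasurableSpace X] [BorelSpace X]

/-- The product measure `dt dx` on the cone. -/
def coneVol (μ : Measure X) : Measure (ℝ × X) := (volume.prod μ).restrict (cone X)

/-- The measure `dt/t dx` on the cone. -/
def mellinMeasure (μ : Measure X) : Measure (ℝ × X) :=
  (coneVol μ).withDensity (fun z => ENNReal.ofReal z.1⁻¹)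

/-- The measure `min(t,1)^(-2γ) t^n dt dx` on the cone. For `γ = 0` it is `t^n dt dx`. -/
def coneMeasure (n : ℕ) (μ : Measure X) (γ : ℝ) : Measure (ℝ × X) :=
  (coneVol μ).withDensity (fun z => ENNReal.ofReal (min z.1 1 ^ (-2 * γ) * z.1 ^ n))

/-- The space `K^{0,γ}_2(X^∧)`. Near `t = 0` it is `L²(t^((n+1)-2γ) dt/t dx) = L²(t^(n-2γ) dt dx)`,
and near `t = ∞` it is `L²(t^n dt dx)`, because the conical coordinates `(t, ⟨t⟩ κ(x))` have a
Jacobian comparable to `t^n`. The weight `min(t,1)^(-2γ) t^n` gives both at once; its norm is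
equivalent to the one formed with a cut-off function. -/
abbrev ConeL2 (n : ℕ) (μ : Measure X) (γ : ℝ) : Type _ := Lp ℂ 2 (coneMeasure n μ γ)

theorem measurableSet_cone : MeasurableSet (cone X) := measurableSet_Ioi.prod MeasurableSet.univ

theorem ae_mem_cone (μ : Measure X) : ∀ᵐ z ∂coneVol μ, z ∈ cone X :=
  ae_restrict_mem measurableSet_cone

theorem mellinMeasure_ac (μ : Measure X) : mellinMeasure μ ≪ coneVol μ :=
  withDensity_absolutelyContinuous _ _

theorem coneMeasure_ac (n : ℕ) (μ : Measure X) (γ : ℝ) : coneMeasure n μ γ ≪ coneVol μ :=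
  withDensity_absolutelyContinuous _ _

theorem measurable_coneDensity (n : ℕ) (γ : ℝ) :
    Measurable (fun z : ℝ × X => ENNReal.ofReal (min z.1 1 ^ (-2 * γ) * z.1 ^ n)) := by
  fun_prop

theorem coneVol_ac (n : ℕ) (μ : Measure X) (γ : ℝ) : coneVol μ ≪ coneMeasure n μ γ := by
  refine withDensity_absolutelyContinuous' (measurable_coneDensity n γ).aemeasurable ?_
  filter_upwards [ae_mem_cone μ] with z hz
  have hz' : (0 : ℝ) < z.1 := hz.1
  have : 0 < min z.1 1 := lt_min hz' one_pos
  exact (ENNReal.ofReal_pos.2 (by positivity)).ne'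

theorem lintegral_coneMeasure (n : ℕ) (μ : Measure X) (γ : ℝ) (f : ℝ × X → ℝ≥0∞) :
    ∫⁻ z, f z ∂coneMeasure n μ γ =
      ∫⁻ z, ENNReal.ofReal (min z.1 1 ^ (-2 * γ) * z.1 ^ n) * f z ∂coneVol μ :=
  lintegral_withDensity_eq_lintegral_mul_non_measurable _ (measurable_coneDensity n γ)
    (by simp) f

/-- The sesquilinear pairing between `K^{0,γ}` and `K^{0,-γ}` given by the inner product of
`K^{0,0} = L²(X^∧, t^n dt dx)`. -/
def conePairing {n : ℕ} {μ : Measure X} {γ : ℝ} (u : ConeL2 n μ γ) (v : ConeL2 n μ (-γ)) : ℂ :=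
  ∫ z, u z * conj (v z) ∂coneMeasure n μ 0

theorem integrable_conePairing {n : ℕ} {μ : Measure X} {γ : ℝ} (u : ConeL2 n μ γ)
    (v : ConeL2 n μ (-γ)) :
    Integrable (fun z => u z * conj (v z)) (coneMeasure n μ 0) := by
  have hu : AEStronglyMeasurable u (coneMeasure n μ 0) :=
    (Lp.aestronglyMeasurable u).mono_ac ((coneMeasure_ac n μ 0).trans (coneVol_ac n μ γ))
  have hv : AEStronglyMeasurable v (coneMeasure n μ 0) :=
    (Lp.aestronglyMeasurable v).mono_ac ((coneMeasure_ac n μ 0).trans (coneVol_ac n μ (-γ)))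
  refine ⟨hu.mul (Complex.continuous_conj.comp_aestronglyMeasurable hv), ?_⟩
  have h1 := (Lp.memLp u).eLpNorm_lt_top
  have h2 := (Lp.memLp v).eLpNorm_lt_top
  rw [eLpNorm_lt_top_iff_lintegral_rpow_enorm_lt_top (by simp) (by simp),
    lintegral_coneMeasure] at h1 h2
  rw [hasFiniteIntegral_iff_enorm, lintegral_coneMeasure]
  have hm : AEMeasurable (fun z : ℝ × X => ENNReal.ofReal (min z.1 1 ^ (-2 * γ) * z.1 ^ n) *
      ‖u z‖ₑ ^ (2 : ℝ≥0∞).toReal) (coneVol μ) :=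
    (measurable_coneDensity n γ).aemeasurable.mul
      (((Lp.aestronglyMeasurable u).mono_ac (coneVol_ac n μ γ)).enorm.pow_const _)
  refine lt_of_le_of_lt (lintegral_mono_ae ?_)
    ((lintegral_add_left' hm _).trans_lt (ENNReal.add_lt_top.2 ⟨h1, h2⟩))
  filter_upwards [ae_mem_cone μ] with z hz
  have hz' : (0 : ℝ) < z.1 := hz.1
  have hm : 0 < min z.1 1 := lt_min hz' one_pos
  have hw : 0 < min z.1 1 ^ (-2 * γ) := by positivity
  have hw' : min z.1 1 ^ (-2 * -γ) = (min z.1 1 ^ (-2 * γ))⁻¹ := by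
    rw [← Real.rpow_neg hm.le]; congr 1; ring
  rw [hw']
  generalize min z.1 1 ^ (-2 * γ) = w at hw
  have hn : 0 < z.1 ^ n := by positivity
  generalize z.1 ^ n = T at hn
  rw [← ofReal_norm, ← ofReal_norm, ← ofReal_norm, ENNReal.toReal_ofNat,
    ENNReal.ofReal_rpow_of_nonneg (norm_nonneg _) (by norm_num),
    ENNReal.ofReal_rpow_of_nonneg (norm_nonneg _) (by norm_num),
    ← ENNReal.ofReal_mul (by positivity), ← ENNReal.ofReal_mul (by positivity),
    ← ENNReal.ofReal_mul (by positivity), ← ENNReal.ofReal_add (by positivity) (by positivity)]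
  refine ENNReal.ofReal_le_ofReal ?_
  simp only [mul_zero, Real.rpow_zero, one_mul, norm_mul, RCLike.norm_conj, Real.rpow_ofNat]
  generalize ‖u z‖ = a
  generalize ‖v z‖ = b
  have key : a * b ≤ w * a ^ 2 + w⁻¹ * b ^ 2 := by
    have h0 : 0 ≤ w⁻¹ * ((w * a - b) ^ 2 + w ^ 2 * a ^ 2 + b ^ 2) := by positivity
    have h3 : w⁻¹ * ((w * a - b) ^ 2 + w ^ 2 * a ^ 2 + b ^ 2) =
        2 * (w * a ^ 2 + w⁻¹ * b ^ 2 - a * b) := by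
      field_simp; ring
    linarith
  nlinarith [mul_le_mul_of_nonneg_left key hn.le]

end Measures

section Schwartz

variable {n : ℕ} {X : Type*} [TopologicalSpace X] [ChartedSpace (EuclideanSpace ℝ (Fin n)) X]
  [IsManifold (𝓡 n) ∞ X] [MeasurableSpace X] [BorelSpace X]

/-- The function `t^((n+1)/2-γ-δ) ⟨t⟩^k (t ∂_t)^p D_x u`. -/
def weightedDeriv (n : ℕ) (γ δ : ℝ) (k : ℤ) (p : ℕ) (D : (X → ℂ) → (X → ℂ))
    (u : ℝ × X → ℂ) : ℝ × X → ℂ :=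
  fun z => ((z.1 ^ (((n : ℝ) + 1) / 2 - γ - δ) * √(1 + z.1 ^ 2) ^ k : ℝ) : ℂ) * coneOp p D u z

theorem weightedDeriv_add_ae {D : (X → ℂ) → (X → ℂ)} (hD : IsDiffOp n D) (γ δ : ℝ) (k : ℤ) (p : ℕ)
    {u v : ℝ × X → ℂ} (hu : SmoothOnCone n u) (hv : SmoothOnCone n v) (μ : Measure X) :
    weightedDeriv n γ δ k p D (u + v) =ᵐ[mellinMeasure μ]
      weightedDeriv n γ δ k p D u + weightedDeriv n γ δ k p D v := by
  filter_upwards [(mellinMeasure_ac μ).ae_le (ae_mem_cone μ)] with z hz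
  simp only [weightedDeriv, coneOp_add hD p hu hv hz, Pi.add_apply, mul_add]

theorem weightedDeriv_smul_ae {D : (X → ℂ) → (X → ℂ)} (hD : IsDiffOp n D) (γ δ : ℝ) (k : ℤ) (p : ℕ)
    (c : ℂ) {u : ℝ × X → ℂ} (hu : SmoothOnCone n u) (μ : Measure X) :
    weightedDeriv n γ δ k p D (c • u) =ᵐ[mellinMeasure μ] c • weightedDeriv n γ δ k p D u := by
  filter_upwards [(mellinMeasure_ac μ).ae_le (ae_mem_cone μ)] with z hz
  simp only [weightedDeriv, coneOp_smul hD p c hu hz, Pi.smul_apply, smul_eq_mul]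
  ring

theorem IsDiffOp.map_zero {D : (X → ℂ) → (X → ℂ)} (hD : IsDiffOp n D) : D 0 = 0 := by
  induction hD with
  | mul a ha => ext; simp
  | vectorField V hV =>
    ext x
    have : mfderiv (𝓡 n) 𝓘(ℝ, ℂ) (0 : X → ℂ) x = 0 := mfderiv_const
    exact congrArg (fun L => L (V x)) this
  | add _ _ h1 h2 => simp [h1, h2]
  | comp _ _ h1 h2 => simp [h1, h2]

theorem radialDeriv_zero : radialDeriv (0 : ℝ × X → ℂ) = 0 := by
  ext z; simp [radialDeriv]

theorem weightedDeriv_zero {D : (X → ℂ) → (X → ℂ)} (hD : IsDiffOp n D) (γ δ : ℝ) (k : ℤ) (p : ℕ) :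
    weightedDeriv n γ δ k p D (0 : ℝ × X → ℂ) = 0 := by
  have h0 : sliceOp D (0 : ℝ × X → ℂ) = 0 := by
    ext z; exact congrFun hD.map_zero z.2
  have h1 : coneOp p D (0 : ℝ × X → ℂ) = 0 := by
    rw [coneOp, h0]; exact Function.iterate_fixed radialDeriv_zero p
  ext z; simp [weightedDeriv, h1]

/-- The functions in `S^γ_ε(X^∧)`: smooth functions `u` on the cone with
`t^((n+1)/2-γ-δ) ⟨t⟩^k (t ∂_t)^p D_x u ∈ L²(dt/t dx)` for all integers `k`, all `p`, all
differential operators `D` on `X` and all `0 ≤ δ < ε`. A function on the cone is encoded by its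
extension by zero to `ℝ × X`. -/
def coneSchwartzSubmodule (n : ℕ) {X : Type*} [TopologicalSpace X]
    [ChartedSpace (EuclideanSpace ℝ (Fin n)) X] [IsManifold (𝓡 n) ∞ X] [MeasurableSpace X]
    [BorelSpace X] (μ : Measure X) (γ ε : ℝ) : Submodule ℂ (ℝ × X → ℂ) where
  carrier := {u | (∀ z ∉ cone X, u z = 0) ∧ SmoothOnCone n u ∧
    ∀ (k : ℤ) (p : ℕ) (D : (X → ℂ) → (X → ℂ)), IsDiffOp n D → ∀ δ : ℝ, 0 ≤ δ → δ < ε →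
      MemLp (weightedDeriv n γ δ k p D u) 2 (mellinMeasure μ)}
  add_mem' := by
    rintro u v ⟨hu0, hu, hu'⟩ ⟨hv0, hv, hv'⟩
    refine ⟨fun z hz => by simp [hu0 z hz, hv0 z hz], hu.add hv, fun k p D hD δ h0 h1 => ?_⟩
    exact ((hu' k p D hD δ h0 h1).add (hv' k p D hD δ h0 h1)).ae_eq
      (weightedDeriv_add_ae hD γ δ k p hu hv μ).symm
  zero_mem' := by
    refine ⟨fun z hz => rfl, contMDiffOn_const, fun k p D hD δ h0 h1 => ?_⟩
    rw [weightedDeriv_zero hD]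
    exact MemLp.zero
  smul_mem' := by
    rintro c u ⟨hu0, hu, hu'⟩
    refine ⟨fun z hz => by simp [hu0 z hz], hu.smul c, fun k p D hD δ h0 h1 => ?_⟩
    exact ((hu' k p D hD δ h0 h1).const_smul c).ae_eq
      (weightedDeriv_smul_ae hD γ δ k p c hu μ).symm

/-- The Fréchet space `S^γ_ε(X^∧)`. -/
def ConeSchwartz (n : ℕ) {X : Type*} [TopologicalSpace X]
    [ChartedSpace (EuclideanSpace ℝ (Fin n)) X] [IsManifold (𝓡 n) ∞ X] [MeasurableSpace X]
    [BorelSpace X] (μ : Measure X) (γ ε : ℝ) : Type _ :=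
  coneSchwartzSubmodule n μ γ ε

variable {μ : Measure X} {γ ε : ℝ}

instance : AddCommGroup (ConeSchwartz n μ γ ε) :=
  inferInstanceAs (AddCommGroup (coneSchwartzSubmodule n μ γ ε))

instance : Module ℂ (ConeSchwartz n μ γ ε) :=
  inferInstanceAs (Module ℂ (coneSchwartzSubmodule n μ γ ε))

/-- The function `X^∧ → ℂ` (extended by zero to `ℝ × X`) underlying an element. -/
def ConeSchwartz.toFun (u : ConeSchwartz n μ γ ε) : ℝ × X → ℂ := u.1

/-- The parameters `(k, p, D, δ)` of the defining seminorms. -/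
abbrev SchwartzIndex (n : ℕ) (X : Type*) [TopologicalSpace X]
    [ChartedSpace (EuclideanSpace ℝ (Fin n)) X] [IsManifold (𝓡 n) ∞ X] (ε : ℝ) : Type _ :=
  ℤ × ℕ × {D : (X → ℂ) → (X → ℂ) // IsDiffOp n D} × {δ : ℝ // 0 ≤ δ ∧ δ < ε}

/-- The linear map `u ↦ t^((n+1)/2-γ-δ) ⟨t⟩^k (t ∂_t)^p D_x u` into `L²(dt/t dx)`. -/
def weightedDerivLp (i : SchwartzIndex n X ε) :
    ConeSchwartz n μ γ ε →ₗ[ℂ] Lp ℂ 2 (mellinMeasure μ) where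
  toFun u := (u.2.2.2 i.1 i.2.1 i.2.2.1.1 i.2.2.1.2 i.2.2.2.1 i.2.2.2.2.1 i.2.2.2.2.2).toLp _
  map_add' u v := by
    rw [← MemLp.toLp_add]
    exact MemLp.toLp_congr _ _ (weightedDeriv_add_ae i.2.2.1.2 _ _ _ _ u.2.2.1 v.2.2.1 μ)
  map_smul' c u := by
    rw [RingHom.id_apply, ← MemLp.toLp_const_smul]
    exact MemLp.toLp_congr _ _ (weightedDeriv_smul_ae i.2.2.1.2 _ _ _ _ c u.2.2.1 μ)

/-- The seminorms defining the Fréchet topology. -/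
def coneSeminorms (n : ℕ) {X : Type*} [TopologicalSpace X]
    [ChartedSpace (EuclideanSpace ℝ (Fin n)) X] [IsManifold (𝓡 n) ∞ X] [MeasurableSpace X]
    [BorelSpace X] (μ : Measure X) (γ ε : ℝ) :
    SeminormFamily ℂ (ConeSchwartz n μ γ ε) (SchwartzIndex n X ε) :=
  fun i => (normSeminorm ℂ (Lp ℂ 2 (mellinMeasure μ))).comp (weightedDerivLp i)

instance : TopologicalSpace (ConeSchwartz n μ γ ε) :=
  (coneSeminorms n μ γ ε).moduleFilterBasis.topology

theorem coneSeminorms_withSeminorms : WithSeminorms (coneSeminorms n μ γ ε) := ⟨rfl⟩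

instance : IsTopologicalAddGroup (ConeSchwartz n μ γ ε) :=
  coneSeminorms_withSeminorms.topologicalAddGroup

instance : UniformSpace (ConeSchwartz n μ γ ε) :=
  IsTopologicalAddGroup.rightUniformSpace _

theorem ConeSchwartz.aestronglyMeasurable (u : ConeSchwartz n μ γ ε) :
    AEStronglyMeasurable u.toFun (coneVol μ) :=
  (ContMDiffOn.continuousOn u.2.2.1).aestronglyMeasurable measurableSet_cone

theorem isDiffOp_one {n : ℕ} {X : Type*} [TopologicalSpace X]
    [ChartedSpace (EuclideanSpace ℝ (Fin n)) X] [IsManifold (𝓡 n) ∞ X] :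
    IsDiffOp n (fun (f : X → ℂ) x => (1 : ℂ) * f x) :=
  IsDiffOp.mul (fun _ => 1) contMDiff_const

/-- The index of a seminorm that dominates the norm of `K^{0,γ}`. -/
def normIndex (n : ℕ) (X : Type*) [TopologicalSpace X]
    [ChartedSpace (EuclideanSpace ℝ (Fin n)) X] [IsManifold (𝓡 n) ∞ X] (γ : ℝ) {ε : ℝ}
    (hε : 0 < ε) : SchwartzIndex n X ε :=
  ⟨(⌈|γ|⌉₊ : ℤ), 0, ⟨_, isDiffOp_one⟩, ⟨0, le_rfl, hε⟩⟩

theorem ConeSchwartz.eLpNorm_le (hε : 0 < ε) (u : ConeSchwartz n μ γ ε) :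
    eLpNorm u.toFun 2 (coneMeasure n μ γ) ≤
      ENNReal.ofReal (coneSeminorms n μ γ ε (normIndex n X γ hε) u) := by
  have e1 : ENNReal.ofReal (coneSeminorms n μ γ ε (normIndex n X γ hε) u) =
      eLpNorm (weightedDeriv n γ 0 (⌈|γ|⌉₊ : ℤ) 0 (fun (f : X → ℂ) x => (1 : ℂ) * f x) u.toFun) 2
        (mellinMeasure μ) := by
    change ENNReal.ofReal ‖weightedDerivLp (normIndex n X γ hε) u‖ = _
    rw [ofReal_norm]
    exact Lp.enorm_toLp (u.2.2.2 (⌈|γ|⌉₊ : ℤ) 0 _ isDiffOp_one 0 le_rfl hε)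
  rw [e1, eLpNorm_eq_lintegral_rpow_enorm_toReal (by simp) (by simp),
    eLpNorm_eq_lintegral_rpow_enorm_toReal (by simp) (by simp)]
  refine ENNReal.rpow_le_rpow ?_ (by simp)
  have hmeas : Measurable (fun z : ℝ × X => ENNReal.ofReal z.1⁻¹) := by fun_prop
  rw [lintegral_coneMeasure, mellinMeasure,
    lintegral_withDensity_eq_lintegral_mul_non_measurable _ hmeas (by simp)]
  refine lintegral_mono_ae ?_
  filter_upwards [ae_mem_cone μ] with z hz
  have ht : (0 : ℝ) < z.1 := hz.1
  simp only [Pi.mul_apply, weightedDeriv, coneOp, sliceOp, Function.iterate_zero, id, one_mul,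
    ENNReal.toReal_ofNat]
  rw [← ofReal_norm, ← ofReal_norm, ENNReal.ofReal_rpow_of_nonneg (norm_nonneg _) (by norm_num),
    ENNReal.ofReal_rpow_of_nonneg (norm_nonneg _) (by norm_num),
    ← ENNReal.ofReal_mul (by positivity), ← ENNReal.ofReal_mul (by positivity)]
  refine ENNReal.ofReal_le_ofReal ?_
  simp only [Real.rpow_ofNat, norm_mul, mul_pow, Complex.norm_real, Real.norm_eq_abs, sq_abs,
    sub_zero, zpow_natCast]
  rw [← mul_assoc]
  refine mul_le_mul_of_nonneg_right ?_ (by positivity)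
  have e2 : z.1⁻¹ * ((z.1 ^ (((n : ℝ) + 1) / 2 - γ)) ^ 2 * (√(1 + z.1 ^ 2) ^ ⌈|γ|⌉₊) ^ 2) =
      (z.1 ^ (-2 * γ) * (√(1 + z.1 ^ 2) ^ ⌈|γ|⌉₊) ^ 2) * z.1 ^ n := by
    rw [← Real.rpow_natCast (z.1 ^ (((n : ℝ) + 1) / 2 - γ)) 2, ← Real.rpow_mul ht.le,
      show (((n : ℝ) + 1) / 2 - γ) * ((2 : ℕ) : ℝ) = (-2 * γ) + (n : ℝ) + 1 by push_cast; ring,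
      Real.rpow_add ht, Real.rpow_add ht, Real.rpow_one, Real.rpow_natCast]
    field_simp
  rw [e2]
  refine mul_le_mul_of_nonneg_right ?_ (by positivity)
  have hs : 1 ≤ √(1 + z.1 ^ 2) := Real.one_le_sqrt.2 (by nlinarith)
  rcases le_total z.1 1 with h | h
  · rw [min_eq_left h]
    exact le_mul_of_one_le_right (by positivity) (one_le_pow₀ (one_le_pow₀ hs))
  · rw [min_eq_right h, Real.one_rpow, ← pow_mul]
    have h3 : z.1 ≤ √(1 + z.1 ^ 2) := Real.le_sqrt_of_sq_le (by linarith)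
    have h4 : z.1 ^ (2 * γ) ≤ √(1 + z.1 ^ 2) ^ (⌈|γ|⌉₊ * 2) := by
      refine le_trans ?_ (pow_le_pow_left₀ ht.le h3 _)
      rw [← Real.rpow_natCast z.1]
      refine Real.rpow_le_rpow_of_exponent_le h ?_
      have := Nat.le_ceil |γ|
      have := le_abs_self γ
      push_cast; linarith
    calc (1 : ℝ) = z.1 ^ (-2 * γ) * z.1 ^ (2 * γ) := by
          rw [← Real.rpow_add ht]; simp
      _ ≤ _ := mul_le_mul_of_nonneg_left h4 (by positivity)

theorem ConeSchwartz.memLp (hε : 0 < ε) (u : ConeSchwartz n μ γ ε) :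
    MemLp u.toFun 2 (coneMeasure n μ γ) :=
  ⟨u.aestronglyMeasurable.mono_ac (coneMeasure_ac n μ γ),
    (u.eLpNorm_le hε).trans_lt ENNReal.ofReal_lt_top⟩

end Schwartz

section Tensor

variable (E F : Type*) [AddCommGroup E] [Module ℂ E] [TopologicalSpace E]
  [AddCommGroup F] [Module ℂ F] [TopologicalSpace F]

/-- The algebraic tensor product, to be equipped with the projective topology. -/
def ProjTensor : Type _ := E ⊗[ℂ] F

instance : AddCommGroup (ProjTensor E F) := inferInstanceAs (AddCommGroup (E ⊗[ℂ] F))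

instance : Module ℂ (ProjTensor E F) := inferInstanceAs (Module ℂ (E ⊗[ℂ] F))

variable {E F} in
/-- The elementary tensor `u ⊗ v`. -/
def ProjTensor.tmul (u : E) (v : F) : ProjTensor E F := u ⊗ₜ[ℂ] v

/-- The projective topology is the finest locally convex topology for which `(u, v) ↦ u ⊗ v` is
continuous; it is generated by all the seminorms `s` for which `(u, v) ↦ s (u ⊗ v)` is
continuous. -/
def projSeminorms : SeminormFamily ℂ (ProjTensor E F)
    {s : Seminorm ℂ (ProjTensor E F) // Continuous fun x : E × F => s (ProjTensor.tmul x.1 x.2)} :=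
  fun s => s.1

instance : TopologicalSpace (ProjTensor E F) :=
  (projSeminorms E F).moduleFilterBasis.topology

theorem projSeminorms_withSeminorms : WithSeminorms (projSeminorms E F) := ⟨rfl⟩

instance : IsTopologicalAddGroup (ProjTensor E F) :=
  (projSeminorms_withSeminorms E F).topologicalAddGroup

instance : ContinuousSMul ℂ (ProjTensor E F) :=
  (projSeminorms_withSeminorms E F).continuousSMul

instance : UniformSpace (ProjTensor E F) := IsTopologicalAddGroup.rightUniformSpace _

instance : IsUniformAddGroup (ProjTensor E F) := isUniformAddGroup_of_addCommGroup

instance : UniformContinuousConstSMul ℂ (ProjTensor E F) :=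
  uniformContinuousConstSMul_of_continuousConstSMul ℂ _

/-- The completed projective tensor product. -/
abbrev CompletedProjTensor : Type _ := UniformSpace.Completion (ProjTensor E F)

end Tensor

section Kernel

variable {n : ℕ} {X : Type*} [TopologicalSpace X] [ChartedSpace (EuclideanSpace ℝ (Fin n)) X]
  [IsManifold (𝓡 n) ∞ X] [MeasurableSpace X] [BorelSpace X] {μ : Measure X} [IsFiniteMeasure μ]
  {γ₁ γ₂ ε : ℝ}

instance (n : ℕ) (γ : ℝ) : SFinite (coneMeasure n μ γ) := by
  unfold coneMeasure coneVol; infer_instance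

theorem eLpNorm_tensor {n : ℕ} {γ₁ γ₂ : ℝ} {f g : ℝ × X → ℂ}
    (hf : AEStronglyMeasurable f (coneMeasure n μ γ₁))
    (hg : AEStronglyMeasurable g (coneMeasure n μ γ₂)) :
    eLpNorm (fun q : (ℝ × X) × (ℝ × X) => f q.1 * g q.2) 2
      ((coneMeasure n μ γ₁).prod (coneMeasure n μ γ₂)) =
      eLpNorm f 2 (coneMeasure n μ γ₁) * eLpNorm g 2 (coneMeasure n μ γ₂) := by
  simp only [eLpNorm_eq_lintegral_rpow_enorm_toReal (p := 2) (by simp) (by simp), enorm_mul,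
    ENNReal.mul_rpow_of_nonneg _ _ (ENNReal.toReal_nonneg (a := 2))]
  rw [lintegral_prod_mul (hf.enorm.pow_const _) (hg.enorm.pow_const _),
    ENNReal.mul_rpow_of_nonneg _ _ (by simp)]

theorem memLp_tensor {n : ℕ} {γ₁ γ₂ : ℝ} {f g : ℝ × X → ℂ} (hf : MemLp f 2 (coneMeasure n μ γ₁))
    (hg : MemLp g 2 (coneMeasure n μ γ₂)) :
    MemLp (fun q : (ℝ × X) × (ℝ × X) => f q.1 * g q.2) 2
      ((coneMeasure n μ γ₁).prod (coneMeasure n μ γ₂)) := by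
  refine ⟨hf.1.comp_fst.mul hg.1.comp_snd, ?_⟩
  rw [eLpNorm_tensor hf.1 hg.1]
  exact ENNReal.mul_lt_top hf.2 hg.2

/-- The space `S^{γ₁,γ₂}_ε(X^∧ × X^∧)`, the completed projective tensor product of `S^{γ₁}_ε(X^∧)` and
`S^{γ₂}_ε(X^∧)`. -/
abbrev ConeKernelSpace (n : ℕ) {X : Type*} [TopologicalSpace X]
    [ChartedSpace (EuclideanSpace ℝ (Fin n)) X] [IsManifold (𝓡 n) ∞ X] [MeasurableSpace X]
    [BorelSpace X] (μ : Measure X) (γ₁ γ₂ ε : ℝ) : Type _ :=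
  CompletedProjTensor (ConeSchwartz n μ γ₁ ε) (ConeSchwartz n μ γ₂ ε)

/-- The linear map that sends `u ⊗ v` to the function `(z, w) ↦ u(z) v(w)` on `X^∧ × X^∧`. -/
def tensorFun (hε : 0 < ε) :
    ProjTensor (ConeSchwartz n μ γ₁ ε) (ConeSchwartz n μ γ₂ ε) →ₗ[ℂ]
      Lp ℂ 2 ((coneMeasure n μ γ₁).prod (coneMeasure n μ γ₂)) :=
  TensorProduct.lift <| LinearMap.mk₂ ℂ
    (fun u v => (memLp_tensor (u.memLp hε) (v.memLp hε)).toLp _)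
    (fun u u' v => by
      rw [← MemLp.toLp_add]
      exact MemLp.toLp_congr _ _ (ae_of_all _ fun q => add_mul _ _ _))
    (fun c u v => by
      rw [← MemLp.toLp_const_smul]
      exact MemLp.toLp_congr _ _ (ae_of_all _ fun q => mul_assoc _ _ _))
    (fun u v v' => by
      rw [← MemLp.toLp_add]
      exact MemLp.toLp_congr _ _ (ae_of_all _ fun q => mul_add _ _ _))
    (fun c u v => by
      rw [← MemLp.toLp_const_smul]
      exact MemLp.toLp_congr _ _ (ae_of_all _ fun q => mul_left_comm _ _ _))

theorem tensorFun_tmul (hε : 0 < ε) (u : ConeSchwartz n μ γ₁ ε) (v : ConeSchwartz n μ γ₂ ε) :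
    tensorFun hε (ProjTensor.tmul u v) = (memLp_tensor (u.memLp hε) (v.memLp hε)).toLp _ :=
  TensorProduct.lift.tmul _ _

theorem ConeSchwartz.continuous_norm (hε : 0 < ε) :
    Continuous fun u : ConeSchwartz n μ γ₁ ε => (eLpNorm u.toFun 2 (coneMeasure n μ γ₁)).toReal := by
  let L : ConeSchwartz n μ γ₁ ε →ₗ[ℂ] Lp ℂ 2 (coneMeasure n μ γ₁) :=
    { toFun := fun u => (u.memLp hε).toLp _
      map_add' := fun u v => rfl
      map_smul' := fun c u => rfl }
  have h : Continuous ((normSeminorm ℂ (Lp ℂ 2 (coneMeasure n μ γ₁))).comp L) := by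
    refine Seminorm.continuous_of_le
      (coneSeminorms_withSeminorms.continuous_seminorm (normIndex n X γ₁ hε)) fun u => ?_
    change ‖(u.memLp hε).toLp _‖ ≤ _
    rw [Lp.norm_toLp]
    exact ENNReal.toReal_le_of_le_ofReal (apply_nonneg _ _) (u.eLpNorm_le hε)
  refine h.congr fun u => ?_
  exact Lp.norm_toLp _ (u.memLp hε)

theorem continuous_tensorFun (hε : 0 < ε) :
    Continuous (tensorFun (n := n) (μ := μ) (γ₁ := γ₁) (γ₂ := γ₂) hε) := by
  let s : Seminorm ℂ (ProjTensor (ConeSchwartz n μ γ₁ ε) (ConeSchwartz n μ γ₂ ε)) :=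
    (normSeminorm ℂ (Lp ℂ 2 ((coneMeasure n μ γ₁).prod (coneMeasure n μ γ₂)))).comp (tensorFun hε)
  have hs : Continuous fun x : ConeSchwartz n μ γ₁ ε × ConeSchwartz n μ γ₂ ε =>
      s (ProjTensor.tmul x.1 x.2) := by
    refine (((ConeSchwartz.continuous_norm hε).comp continuous_fst).mul
      ((ConeSchwartz.continuous_norm hε).comp continuous_snd)).congr fun x => ?_
    change _ = ‖tensorFun hε (ProjTensor.tmul x.1 x.2)‖
    rw [tensorFun_tmul, Lp.norm_toLp, eLpNorm_tensor (x.1.memLp hε).1 (x.2.memLp hε).1,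
      ENNReal.toReal_mul]
    rfl
  have hc := (projSeminorms_withSeminorms (ConeSchwartz n μ γ₁ ε)
    (ConeSchwartz n μ γ₂ ε)).continuous_seminorm ⟨s, hs⟩
  refine continuous_of_continuousAt_zero (tensorFun hε) ?_
  have h0 := hc.tendsto 0
  rw [map_zero] at h0
  rw [ContinuousAt, map_zero]
  exact tendsto_zero_iff_norm_tendsto_zero.2 h0

/-- The function on `X^∧ × X^∧` (up to null sets) given by an element of the completed
tensor product: the continuous extension of `u ⊗ v ↦ u(z) v(w)`. -/
def kernelFun (hε : 0 < ε) :
    ConeKernelSpace n μ γ₁ γ₂ ε → Lp ℂ 2 ((coneMeasure n μ γ₁).prod (coneMeasure n μ γ₂)) :=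
  UniformSpace.Completion.extension (tensorFun hε)

theorem continuous_kernelFun (hε : 0 < ε) :
    Continuous (kernelFun (n := n) (μ := μ) (γ₁ := γ₁) (γ₂ := γ₂) hε) :=
  UniformSpace.Completion.continuous_extension

theorem kernelFun_coe (hε : 0 < ε)
    (k : ProjTensor (ConeSchwartz n μ γ₁ ε) (ConeSchwartz n μ γ₂ ε)) :
    kernelFun hε (k : ConeKernelSpace n μ γ₁ γ₂ ε) = tensorFun hε k :=
  UniformSpace.Completion.extension_coe
    (uniformContinuous_addMonoidHom_of_continuous (continuous_tensorFun hε)) k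

/-- The operator `A` is the integral operator with kernel `κ` with respect to the measure `t^n dt dx`. -/
def IsIntegralOperator {γ γ' : ℝ} (A : ConeL2 n μ γ →L[ℂ] ConeL2 n μ γ')
    (κ : (ℝ × X) × (ℝ × X) → ℂ) : Prop :=
  ∀ u : ConeL2 n μ γ, ∀ᵐ z ∂coneMeasure n μ 0,
    Integrable (fun w => κ (z, w) * u w) (coneMeasure n μ 0) ∧
      A u z = ∫ w, κ (z, w) * u w ∂coneMeasure n μ 0

end Kernel

section Green

variable {n : ℕ} {X : Type*} [TopologicalSpace X] [ChartedSpace (EuclideanSpace ℝ (Fin n)) X]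
  [IsManifold (𝓡 n) ∞ X] [MeasurableSpace X] [BorelSpace X] {μ : Measure X} {γ γ' ε : ℝ}

/-- The element `u` of `K^{0,γ}` belongs to `S^γ_ε`. -/
def InConeSchwartz (ε : ℝ) (u : ConeL2 n μ γ) : Prop :=
  ∃ f : ConeSchwartz n μ γ ε, u =ᵐ[coneMeasure n μ γ] f.toFun

/-- The operator `B` is the adjoint of `A` with respect to the pairings induced by `K^{0,0}`. -/
def IsConeAdjoint (A : ConeL2 n μ γ →L[ℂ] ConeL2 n μ γ')
    (B : ConeL2 n μ (-γ') →L[ℂ] ConeL2 n μ (-γ)) : Prop :=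
  ∀ u v, conePairing (A u) v = conePairing u (B v)

theorem conePairing_add_left (u u' : ConeL2 n μ γ) (v : ConeL2 n μ (-γ)) :
    conePairing (u + u') v = conePairing u v + conePairing u' v := by
  rw [conePairing, conePairing, conePairing,
    ← integral_add (integrable_conePairing u v) (integrable_conePairing u' v)]
  refine integral_congr_ae ?_
  filter_upwards [((coneMeasure_ac n μ 0).trans (coneVol_ac n μ γ)).ae_le (Lp.coeFn_add u u')]
    with z hz
  simp only [hz, Pi.add_apply, add_mul]

theorem conePairing_add_right (u : ConeL2 n μ γ) (v v' : ConeL2 n μ (-γ)) :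
    conePairing u (v + v') = conePairing u v + conePairing u v' := by
  rw [conePairing, conePairing, conePairing,
    ← integral_add (integrable_conePairing u v) (integrable_conePairing u v')]
  refine integral_congr_ae ?_
  filter_upwards [((coneMeasure_ac n μ 0).trans (coneVol_ac n μ (-γ))).ae_le (Lp.coeFn_add v v')]
    with z hz
  simp only [hz, Pi.add_apply, map_add, mul_add]

theorem conePairing_smul_left (c : ℂ) (u : ConeL2 n μ γ) (v : ConeL2 n μ (-γ)) :
    conePairing (c • u) v = c * conePairing u v := by
  rw [conePairing, conePairing, ← integral_const_mul]
  refine integral_congr_ae ?_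
  filter_upwards [((coneMeasure_ac n μ 0).trans (coneVol_ac n μ γ)).ae_le (Lp.coeFn_smul c u)]
    with z hz
  simp only [hz, Pi.smul_apply, smul_eq_mul, mul_assoc]

theorem conePairing_smul_right (c : ℂ) (u : ConeL2 n μ γ) (v : ConeL2 n μ (-γ)) :
    conePairing u (c • v) = conj c * conePairing u v := by
  rw [conePairing, conePairing, ← integral_const_mul]
  refine integral_congr_ae ?_
  filter_upwards [((coneMeasure_ac n μ 0).trans (coneVol_ac n μ (-γ))).ae_le (Lp.coeFn_smul c v)]
    with z hz
  simp only [hz, Pi.smul_apply, smul_eq_mul, map_mul]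
  ring

theorem InConeSchwartz.add {u v : ConeL2 n μ γ} (hu : InConeSchwartz ε u)
    (hv : InConeSchwartz ε v) : InConeSchwartz ε (u + v) := by
  obtain ⟨f, hf⟩ := hu
  obtain ⟨g, hg⟩ := hv
  exact ⟨f + g, (Lp.coeFn_add u v).trans (hf.add hg)⟩

theorem InConeSchwartz.smul (c : ℂ) {u : ConeL2 n μ γ} (hu : InConeSchwartz ε u) :
    InConeSchwartz ε (c • u) := by
  obtain ⟨f, hf⟩ := hu
  exact ⟨c • f, (Lp.coeFn_smul c u).trans (hf.const_smul c)⟩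

theorem InConeSchwartz.zero : InConeSchwartz ε (0 : ConeL2 n μ γ) :=
  ⟨0, Lp.coeFn_zero _ _ _⟩

variable (n μ γ γ' ε) in
/-- The bounded operators `A : K^{0,γ} → K^{0,γ'}` such that `A` has its range in `S^{γ'}_ε` and
its adjoint has its range in `S^{-γ}_ε`. -/
def greenSubmodule : Submodule ℂ (ConeL2 n μ γ →L[ℂ] ConeL2 n μ γ') where
  carrier := {A | (∀ u, InConeSchwartz ε (A u)) ∧
    ∃ B : ConeL2 n μ (-γ') →L[ℂ] ConeL2 n μ (-γ), IsConeAdjoint A B ∧ ∀ v, InConeSchwartz ε (B v)}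
  add_mem' := by
    rintro A A' ⟨h, B, hB, hB'⟩ ⟨h', C, hC, hC'⟩
    refine ⟨fun u => (h u).add (h' u), B + C, fun u v => ?_, fun v => (hB' v).add (hC' v)⟩
    simp only [_root_.add_apply, conePairing_add_left, conePairing_add_right, hB u v,
      hC u v]
  zero_mem' := by
    refine ⟨fun u => InConeSchwartz.zero, 0, fun u v => ?_, fun v => InConeSchwartz.zero⟩
    have h1 := conePairing_smul_left 0 (0 : ConeL2 n μ γ') v
    have h2 := conePairing_smul_right 0 u (0 : ConeL2 n μ (-γ))
    simp only [smul_zero, map_zero, zero_mul] at h1 h2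
    simp only [_root_.zero_apply, h1, h2]
  smul_mem' := by
    rintro c A ⟨h, B, hB, hB'⟩
    refine ⟨fun u => (h u).smul c, (conj c) • B, fun u v => ?_, fun v => (hB' v).smul _⟩
    simp only [_root_.smul_apply, conePairing_smul_left, conePairing_smul_right,
      hB u v, Complex.conj_conj]

variable (n μ γ γ' ε) in
/-- The space `R_G(γ, γ')_ε`. -/
def GreenOp : Type _ := greenSubmodule n μ γ γ' ε

instance : AddCommGroup (GreenOp n μ γ γ' ε) :=
  inferInstanceAs (AddCommGroup (greenSubmodule n μ γ γ' ε))

instance : Module ℂ (GreenOp n μ γ γ' ε) :=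
  inferInstanceAs (Module ℂ (greenSubmodule n μ γ γ' ε))

/-- The underlying bounded operator `K^{0,γ} → K^{0,γ'}`. -/
def GreenOp.op (A : GreenOp n μ γ γ' ε) : ConeL2 n μ γ →L[ℂ] ConeL2 n μ γ' := A.1

/-- The adjoint `K^{0,-γ'} → K^{0,-γ}`. -/
def GreenOp.adj (A : GreenOp n μ γ γ' ε) : ConeL2 n μ (-γ') →L[ℂ] ConeL2 n μ (-γ) :=
  A.2.2.choose

/-- The map `K^{0,γ} → S^{γ'}_ε` given by `A`; the smooth representative of `A u` is unique. -/
def GreenOp.toSchwartz (A : GreenOp n μ γ γ' ε) (u : ConeL2 n μ γ) : ConeSchwartz n μ γ' ε :=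
  (A.2.1 u).choose

/-- The map `K^{0,-γ'} → S^{-γ}_ε` given by the adjoint of `A`. -/
def GreenOp.adjToSchwartz (A : GreenOp n μ γ γ' ε) (v : ConeL2 n μ (-γ')) :
    ConeSchwartz n μ (-γ) ε :=
  (A.2.2.choose_spec.2 v).choose

theorem GreenOp.toSchwartz_spec (A : GreenOp n μ γ γ' ε) (u : ConeL2 n μ γ) :
    A.op u =ᵐ[coneMeasure n μ γ'] (A.toSchwartz u).toFun :=
  (A.2.1 u).choose_spec

theorem GreenOp.adj_spec (A : GreenOp n μ γ γ' ε) : IsConeAdjoint A.op A.adj :=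
  A.2.2.choose_spec.1

theorem GreenOp.adjToSchwartz_spec (A : GreenOp n μ γ γ' ε) (v : ConeL2 n μ (-γ')) :
    A.adj v =ᵐ[coneMeasure n μ (-γ)] (A.adjToSchwartz v).toFun :=
  (A.2.2.choose_spec.2 v).choose_spec

/-- The topology of `R_G(γ, γ')_ε`: the initial topology with respect to `A ↦ A` and `A ↦ A*` into
the operators `K^{0,γ} → S^{γ'}_ε` and `K^{0,-γ'} → S^{-γ}_ε` with the topology of uniform
convergence on bounded sets. -/
instance : TopologicalSpace (GreenOp n μ γ γ' ε) :=
  TopologicalSpace.induced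
      (fun A => UniformOnFun.ofFun {S : Set (ConeL2 n μ γ) | Bornology.IsBounded S} A.toSchwartz)
      inferInstance ⊓
    TopologicalSpace.induced
      (fun A => UniformOnFun.ofFun {S : Set (ConeL2 n μ (-γ')) | Bornology.IsBounded S}
        A.adjToSchwartz)
      inferInstance

/-- The measure `μ` is a smooth positive density on `X`: in each chart it is a smooth positive
function times Lebesgue measure. -/
def IsSmoothDensity (n : ℕ) {X : Type*} [TopologicalSpace X]
    [ChartedSpace (EuclideanSpace ℝ (Fin n)) X] [MeasurableSpace X] (μ : Measure X) : Prop :=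
  ∀ e ∈ atlas (EuclideanSpace ℝ (Fin n)) X, ∃ ρ : EuclideanSpace ℝ (Fin n) → ℝ,
    ContDiffOn ℝ ∞ ρ e.target ∧ (∀ y ∈ e.target, 0 < ρ y) ∧
      ∀ s ⊆ e.target, MeasurableSet s →
        μ (e.source ∩ e ⁻¹' s) = ∫⁻ y in s, ENNReal.ofReal (ρ y)

end Green

end ConeGreen

end

/-! In the coordinate r = log t the cone is a cylinder and t∂_t becomes ∂_r. A partition of unity,
in r with step 1/4 and on X over finitely many charts, cuts a function on the cone into pieces that
live in unit boxes, and each piece has a Fourier series. This produces functions e_j and dual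
functions d_j, the latter bounded in K^{0,-γ} uniformly in j, with u = ∑ ⟨u, d_j⟩ e_j (bilinear
pairing) for every u in S^γ_ε. The index j consists of a chart, a radial position M and a frequency
k, and its size is measured by rate(δ, N, j) = ⟨k⟩^N exp(δ max(-M, 0) + N max(M, 0)).

Three facts about the rate carry everything. A seminorm with parameter δ is O(rate(δ, N, j)) on e_j
for some N. The coefficients of u are O(1/rate(δ, N, j)) for every N and every 0 ≤ δ < ε. The sum of
1/rate(δ, N, j) over j is finite for every δ > 0 once N is large. Since the condition δ < ε is open,
a small part of δ can always be spent on summability, so the spaces behave like spaces of rapidly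
decreasing sequences and their projective tensor product like a space of matrices.

A Green operator A has the matrix a_{jl} = ⟨A d_l, d_j⟩. Because A maps into S^{γ'}_ε, the entry is
O(1/rate(2δ, 2N, j)) uniformly in l; because the adjoint maps into S^{-γ}_ε, it is O(1/rate(2δ, 2N,
l)) uniformly in j. Both need 2δ < ε, and the uniformity comes from Banach–Steinhaus and the
boundedness of the d_j. The geometric mean of the two bounds is 1/(rate(δ, N, j) rate(δ, N, l)), a
simultaneous decay in both variables; its price is that ε is halved (`exists_greenCoef_bound`).
Hence ∑ a_{jl} e_j ⊗ e_l converges in the tensor product for ε/2. It is a kernel of A: summing over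
l uses the expansion of an adjoint image, summing over j the expansion of A u
(`isIntegralOperator_kernelMap`). The same estimate for A - A₀ gives continuity, because the d_j
form a bounded set (`continuous_kernelMap`).

Uniqueness rests on `hasSum_kernel`: every element of the completed tensor product is the sum of its
frame expansion, with coefficients that are integrals of the associated function against d_j ⊗ d_l.
So an element is determined by its function, and testing the operator on the dual functions forces
the coefficients to be a_{jl}. -/

noncomputable section

namespace ConeGreen

/-! ### Extended seminorms and series in a completion -/

section Completion

open UniformSpace

variable {E : Type*} [AddCommGroup E] [Module ℂ E] [UniformSpace E] [IsUniformAddGroup E]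
  [UniformContinuousConstSMul ℂ E]

theorem seminorm_sum_le (s : Seminorm ℂ E) {α : Type*} (f : α → E) (t : Finset α) :
    s (∑ a ∈ t, f a) ≤ ∑ a ∈ t, s (f a) :=
  Finset.le_sum_of_subadditive s (map_zero s).le (map_add_le_add s) t f

/-- The continuous extension of a seminorm to the completion. -/
def completionSeminorm (s : Seminorm ℂ E) : Completion E → ℝ := Completion.extension s

theorem continuous_completionSeminorm (s : Seminorm ℂ E) : Continuous (completionSeminorm s) :=
  Completion.continuous_extension

theorem completionSeminorm_coe {s : Seminorm ℂ E} (hs : Continuous s) (x : E) :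
    completionSeminorm s (x : Completion E) = s x :=
  Completion.extension_coe
    (Seminorm.uniformContinuous_of_continuousAt_zero hs.continuousAt) x

theorem completionSeminorm_add_le {s : Seminorm ℂ E} (hs : Continuous s) (x y : Completion E) :
    completionSeminorm s (x + y) ≤ completionSeminorm s x + completionSeminorm s y := by
  have h := continuous_completionSeminorm s
  induction x, y using Completion.induction_on₂ with
  | hp => exact isClosed_le (by fun_prop) (by fun_prop)
  | ih x y =>
    rw [← Completion.coe_add, completionSeminorm_coe hs, completionSeminorm_coe hs,
      completionSeminorm_coe hs]
    exact map_add_le_add s x y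

theorem completionSeminorm_nonneg {s : Seminorm ℂ E} (hs : Continuous s) (x : Completion E) :
    0 ≤ completionSeminorm s x := by
  have h := continuous_completionSeminorm s
  induction x using Completion.induction_on with
  | hp => exact isClosed_le (by fun_prop) (by fun_prop)
  | ih x => rw [completionSeminorm_coe hs]; exact apply_nonneg s x

variable {ι : Type*} {p : SeminormFamily ℂ E ι}

theorem exists_seminorms_of_mem_nhds (hp : WithSeminorms p) {U : Set E} (hU : U ∈ 𝓝 (0 : E)) :
    ∃ (I : Finset ι) (r : ℝ), 0 < r ∧ ∀ x, (∀ i ∈ I, p i x < r) → x ∈ U := by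
  obtain ⟨⟨I, r⟩, hr, h⟩ := (hp.hasBasis_zero_ball).mem_iff.1 hU
  refine ⟨I, r, hr, fun x hx => h ?_⟩
  rw [Seminorm.mem_ball_zero]
  exact Seminorm.finset_sup_apply_lt hr hx

/-- Convergence in the completion is tested by the extended seminorms. -/
theorem tendsto_completion_of_seminorms (hp : WithSeminorms p) {α : Type*} {l : Filter α}
    {f : α → Completion E} {T : Completion E}
    (h : ∀ i, Tendsto (fun a => completionSeminorm (p i) (f a - T)) l (𝓝 0)) :
    Tendsto f l (𝓝 T) := by
  rw [← tendsto_sub_nhds_zero_iff, (closed_nhds_basis (0 : Completion E)).tendsto_right_iff]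
  rintro V ⟨hV, hVc⟩
  have h0 : ((↑) : E → Completion E) ⁻¹' V ∈ 𝓝 (0 : E) :=
    (Completion.continuous_coe E).continuousAt.preimage_mem_nhds
      (by rw [Completion.coe_zero]; exact hV)
  obtain ⟨I, r, hr, hI⟩ := exists_seminorms_of_mem_nhds hp h0
  have h1 : ∀ᶠ a in l, ∀ i ∈ I, completionSeminorm (p i) (f a - T) < r :=
    (Filter.eventually_all_finset I).2 fun i _ => (h i).eventually_lt_const hr
  filter_upwards [h1] with a ha
  -- The set where the extended seminorms are below `r` is open, so each of its points is a limit of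
  -- elements of `E` in the same set. Those lie in `V`, and `V` is closed.
  have ho : IsOpen {S : Completion E | ∀ i ∈ I, completionSeminorm (p i) S < r} := by
    have : {S : Completion E | ∀ i ∈ I, completionSeminorm (p i) S < r} =
        ⋂ i ∈ I, {S | completionSeminorm (p i) S < r} := by ext; simp
    rw [this]
    exact isOpen_biInter_finset fun i _ =>
      isOpen_lt (continuous_completionSeminorm _) continuous_const
  have h2 := (Completion.denseRange_coe (α := E)).open_subset_closure_inter ho ha
  refine closure_minimal ?_ hVc h2
  rintro _ ⟨hS, x, rfl⟩
  refine hI x fun i hi => ?_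
  have := hS i hi
  rwa [completionSeminorm_coe (hp.continuous_seminorm i)] at this

/-- Cauchy criterion: a finite partial sum lies in `E` itself, and there its seminorms are majorised
by partial sums of convergent numerical series. Only finitely many seminorms matter for a given
neighbourhood. -/
theorem summable_completion (hp : WithSeminorms p) {α : Type*} {f : α → E}
    (h : ∀ i, Summable fun a => p i (f a)) : Summable fun a => (f a : Completion E) := by
  rw [summable_iff_vanishing]
  intro V hV
  have h0 : ((↑) : E → Completion E) ⁻¹' V ∈ 𝓝 (0 : E) :=
    (Completion.continuous_coe E).continuousAt.preimage_mem_nhds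
      (by rw [Completion.coe_zero]; exact hV)
  obtain ⟨I, r, hr, hI⟩ := exists_seminorms_of_mem_nhds hp h0
  classical
  have h1 : ∀ i, ∃ s : Finset α, ∀ t, Disjoint t s → ∑ a ∈ t, p i (f a) < r := fun i => by
    obtain ⟨s, hs⟩ := summable_iff_vanishing.1 (h i) (Iio r) (Iio_mem_nhds hr)
    exact ⟨s, hs⟩
  choose s hs using h1
  refine ⟨I.biUnion s, fun t ht => ?_⟩
  have e : ∑ a ∈ t, (f a : Completion E) = ((∑ a ∈ t, f a : E) : Completion E) :=
    (map_sum (Completion.toCompl (α := E)) f t).symm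
  rw [e]
  refine hI _ fun i hi => ?_
  refine lt_of_le_of_lt ?_ (hs i t (ht.mono_right (Finset.subset_biUnion_of_mem s hi)))
  exact seminorm_sum_le (p i) f t

theorem hasSum_coe_completion {α : Type*} {f : α → E} {a : E} (h : HasSum f a) :
    HasSum (fun x => (f x : Completion E)) a :=
  h.map (Completion.toCompl (α := E)) (Completion.continuous_coe E)

/-- The triangle inequality for finite partial sums, passed to the limit. This is the quantitative
estimate behind the continuity of `kernelMap`. -/
theorem completionSeminorm_le_of_hasSum {s : Seminorm ℂ E} (hs : Continuous s) {α : Type*}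
    {f : α → E} {T : Completion E} (hT : HasSum (fun a => (f a : Completion E)) T)
    {b : α → ℝ} {B : ℝ} (hb : HasSum b B) (h : ∀ a, s (f a) ≤ b a) :
    completionSeminorm s T ≤ B := by
  refine le_of_tendsto_of_tendsto
    ((continuous_completionSeminorm s).continuousAt.tendsto.comp hT) hb
    (Eventually.of_forall fun t => ?_)
  have e : ∑ a ∈ t, (f a : Completion E) = ((∑ a ∈ t, f a : E) : Completion E) :=
    (map_sum (Completion.toCompl (α := E)) f t).symm
  simp only [Function.comp, e, completionSeminorm_coe hs]
  exact (seminorm_sum_le s f t).trans (Finset.sum_le_sum fun a _ => h a)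

end Completion

/-! ### The projective topology on elementary tensors -/

section ProjectiveTensor

variable {E F : Type*} [AddCommGroup E] [Module ℂ E] [TopologicalSpace E]
  [AddCommGroup F] [Module ℂ F] [TopologicalSpace F]
  {ι κ : Type*} {p : SeminormFamily ℂ E ι} {q : SeminormFamily ℂ F κ}

theorem ProjTensor.tmul_add_left (u u' : E) (v : F) :
    ProjTensor.tmul (u + u') v = ProjTensor.tmul u v + ProjTensor.tmul u' v :=
  TensorProduct.add_tmul u u' v

theorem ProjTensor.tmul_add_right (u : E) (v v' : F) :
    ProjTensor.tmul u (v + v') = ProjTensor.tmul u v + ProjTensor.tmul u v' :=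
  TensorProduct.tmul_add u v v'

theorem ProjTensor.tmul_smul_left (c : ℂ) (u : E) (v : F) :
    ProjTensor.tmul (c • u) v = c • ProjTensor.tmul u v :=
  (TensorProduct.smul_tmul' c u v).symm

theorem ProjTensor.tmul_smul_right (c : ℂ) (u : E) (v : F) :
    ProjTensor.tmul u (c • v) = c • ProjTensor.tmul u v :=
  TensorProduct.tmul_smul c u v

theorem ProjTensor.induction_on {motive : ProjTensor E F → Prop} (T : ProjTensor E F)
    (zero : motive 0) (tmul : ∀ u v, motive (ProjTensor.tmul u v))
    (add : ∀ T T', motive T → motive T' → motive (T + T')) : motive T :=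
  TensorProduct.induction_on (motive := motive) T zero tmul add

/-- The linear map `v ↦ u ⊗ v`. -/
def ProjTensor.tmulLeftLinear (u : E) : F →ₗ[ℂ] ProjTensor E F where
  toFun v := ProjTensor.tmul u v
  map_add' := ProjTensor.tmul_add_right u
  map_smul' c v := ProjTensor.tmul_smul_right c u v

/-- The linear map `u ↦ u ⊗ v`. -/
def ProjTensor.tmulRightLinear (v : F) : E →ₗ[ℂ] ProjTensor E F where
  toFun u := ProjTensor.tmul u v
  map_add' u u' := ProjTensor.tmul_add_left u u' v
  map_smul' c u := ProjTensor.tmul_smul_left c u v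

/-- The continuous linear map `v ↦ u ⊗ v`. -/
def ProjTensor.tmulLeft [IsTopologicalAddGroup F] (u : E) : F →L[ℂ] ProjTensor E F where
  toLinearMap := ProjTensor.tmulLeftLinear u
  cont := WithSeminorms.continuous_of_continuous_comp (projSeminorms_withSeminorms E F)
    (ProjTensor.tmulLeftLinear u) fun s => s.2.comp (Continuous.prodMk_right u)

/-- The continuous linear map `u ↦ u ⊗ v`. -/
def ProjTensor.tmulRight [IsTopologicalAddGroup E] (v : F) : E →L[ℂ] ProjTensor E F where
  toLinearMap := ProjTensor.tmulRightLinear v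
  cont := WithSeminorms.continuous_of_continuous_comp (projSeminorms_withSeminorms E F)
    (ProjTensor.tmulRightLinear v) fun s => s.2.comp (Continuous.prodMk_left v)

/-- A continuous seminorm on the projective tensor product is dominated on elementary tensors by
products of seminorms. -/
theorem exists_bound_projSeminorm (hp : WithSeminorms p) (hq : WithSeminorms q)
    {s : Seminorm ℂ (ProjTensor E F)}
    (hs : Continuous fun x : E × F => s (ProjTensor.tmul x.1 x.2)) :
    ∃ (I : Finset ι) (K : Finset κ) (C : ℝ), 0 < C ∧ ∀ (u : E) (v : F) (a b : ℝ), 0 < a → 0 < b →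
      (∀ i ∈ I, p i u ≤ a) → (∀ k ∈ K, q k v ≤ b) → s (ProjTensor.tmul u v) ≤ C * a * b := by
  have h0 : {x : E × F | s (ProjTensor.tmul x.1 x.2) < 1} ∈ 𝓝 ((0, 0) : E × F) := by
    refine (isOpen_lt hs continuous_const).mem_nhds ?_
    have : ProjTensor.tmul (0 : E) (0 : F) = 0 := TensorProduct.zero_tmul _ _
    simp [this]
  rw [nhds_prod_eq, Filter.mem_prod_iff] at h0
  obtain ⟨U, hU, V, hV, hUV⟩ := h0
  have hpg := hp.topologicalAddGroup
  obtain ⟨⟨I, r⟩, hr, hI⟩ := (hp.hasBasis_zero_ball).mem_iff.1 hU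
  obtain ⟨⟨K, r'⟩, hr', hK⟩ := (hq.hasBasis_zero_ball).mem_iff.1 hV
  -- Multiplying `u` by `r / (2 * a)` and `v` by `r' / (2 * b)` brings their seminorms to at most
  -- half of the radii, hence strictly inside the balls; undoing the scaling gives the constant.
  -- Positive majorants `a`, `b` are used because the seminorms themselves may vanish.
  refine ⟨I, K, (2 / r) * (2 / r'), by positivity, fun u v a b ha hb hu hv => ?_⟩
  have hra : 0 < r / (2 * a) := by positivity
  have hrb : 0 < r' / (2 * b) := by positivity
  have h1 : ((r / (2 * a) : ℝ) : ℂ) • u ∈ U := by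
    refine hI ?_
    rw [Seminorm.mem_ball_zero]
    refine Seminorm.finset_sup_apply_lt hr fun i hi => ?_
    rw [map_smul_eq_mul, Complex.norm_real, Real.norm_of_nonneg hra.le]
    calc r / (2 * a) * p i u ≤ r / (2 * a) * a := mul_le_mul_of_nonneg_left (hu i hi) hra.le
      _ = r / 2 := by field_simp
      _ < r := by linarith
  have h2 : ((r' / (2 * b) : ℝ) : ℂ) • v ∈ V := by
    refine hK ?_
    rw [Seminorm.mem_ball_zero]
    refine Seminorm.finset_sup_apply_lt hr' fun i hi => ?_
    rw [map_smul_eq_mul, Complex.norm_real, Real.norm_of_nonneg hrb.le]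
    calc r' / (2 * b) * q i v ≤ r' / (2 * b) * b := mul_le_mul_of_nonneg_left (hv i hi) hrb.le
      _ = r' / 2 := by field_simp
      _ < r' := by linarith
  have h3 : s (ProjTensor.tmul (((r / (2 * a) : ℝ) : ℂ) • u) (((r' / (2 * b) : ℝ) : ℂ) • v)) < 1 :=
    hUV (Set.mk_mem_prod h1 h2)
  rw [ProjTensor.tmul_smul_left, ProjTensor.tmul_smul_right, map_smul_eq_mul, map_smul_eq_mul,
    Complex.norm_real, Complex.norm_real, Real.norm_of_nonneg hra.le,
    Real.norm_of_nonneg hrb.le] at h3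
  have e : r / (2 * a) * (r' / (2 * b) * s (ProjTensor.tmul u v)) =
      s (ProjTensor.tmul u v) / (2 / r * (2 / r') * a * b) := by
    field_simp
  rw [e, div_lt_one (by positivity)] at h3
  exact h3.le

/-- A seminorm that is bounded by a product of continuous seminorms on elementary tensors is
continuous for the projective topology. -/
theorem continuous_tmul_of_bound [IsTopologicalAddGroup E] [IsTopologicalAddGroup F]
    {s : Seminorm ℂ (ProjTensor E F)} {p : Seminorm ℂ E} {q : Seminorm ℂ F}
    (hp : Continuous p) (hq : Continuous q)
    (h : ∀ u v, s (ProjTensor.tmul u v) ≤ p u * q v) :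
    Continuous fun x : E × F => s (ProjTensor.tmul x.1 x.2) := by
  rw [continuous_iff_continuousAt]
  rintro ⟨u₀, v₀⟩
  rw [ContinuousAt, tendsto_iff_norm_sub_tendsto_zero]
  have h1 : Continuous fun x : E × F => p (x.1 - u₀) * q x.2 + p u₀ * q (x.2 - v₀) := by fun_prop
  have h2 := h1.tendsto (u₀, v₀)
  simp only [sub_self, map_zero, zero_mul, mul_zero, add_zero] at h2
  refine squeeze_zero (fun _ => norm_nonneg _) (fun x => ?_) h2
  have e : ProjTensor.tmul x.1 x.2 - ProjTensor.tmul u₀ v₀ =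
      ProjTensor.tmul (x.1 - u₀) x.2 + ProjTensor.tmul u₀ (x.2 - v₀) := by
    change x.1 ⊗ₜ[ℂ] x.2 - u₀ ⊗ₜ[ℂ] v₀ = (x.1 - u₀) ⊗ₜ[ℂ] x.2 + u₀ ⊗ₜ[ℂ] (x.2 - v₀)
    rw [TensorProduct.sub_tmul, TensorProduct.tmul_sub]; abel
  calc ‖s (ProjTensor.tmul x.1 x.2) - s (ProjTensor.tmul u₀ v₀)‖
      ≤ s (ProjTensor.tmul x.1 x.2 - ProjTensor.tmul u₀ v₀) := abs_sub_map_le_sub s _ _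
    _ ≤ _ := by rw [e]; exact map_add_le_add s _ _
    _ ≤ _ := add_le_add (h _ _) (h _ _)

end ProjectiveTensor

/-! ### Duality of the weighted L² spaces -/

section Pairing

/-- The bounded functional `u ↦ ∫ u g` on `L²` given by a function `g ∈ L²`. -/
def mulFunctional {Y : Type*} [MeasurableSpace Y] {τ : Measure Y} {g : Y → ℂ} (hg : MemLp g 2 τ) :
    Lp ℂ 2 τ →L[ℂ] ℂ :=
  innerSL ℂ (hg.star.toLp _)

theorem mulFunctional_apply {Y : Type*} [MeasurableSpace Y] {τ : Measure Y} {g : Y → ℂ}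
    (hg : MemLp g 2 τ) (u : Lp ℂ 2 τ) : mulFunctional hg u = ∫ y, u y * g y ∂τ := by
  rw [mulFunctional, innerSL_apply_apply, L2.inner_def]
  refine integral_congr_ae ?_
  filter_upwards [hg.star.coeFn_toLp] with y hy
  rw [hy]
  simp

variable {X : Type*} [TopologicalSpace X] [MeasurableSpace X] [BorelSpace X] {n : ℕ}
  {μ : Measure X} {γ : ℝ}

/-- The density of `coneMeasure n μ γ` with respect to `coneMeasure n μ 0`. -/
def coneWeight (γ : ℝ) (z : ℝ × X) : ℝ := min z.1 1 ^ (-2 * γ)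

theorem measurable_coneWeight (γ : ℝ) : Measurable (coneWeight (X := X) γ) := by
  unfold coneWeight; fun_prop

theorem coneWeight_pos {z : ℝ × X} (hz : z ∈ cone X) : 0 < coneWeight γ z := by
  have hz' : (0 : ℝ) < z.1 := hz.1
  have : 0 < min z.1 1 := lt_min hz' one_pos
  unfold coneWeight; positivity

theorem coneWeight_neg {z : ℝ × X} (hz : z ∈ cone X) : coneWeight (-γ) z = (coneWeight γ z)⁻¹ := by
  have hz' : (0 : ℝ) < z.1 := hz.1
  have : 0 < min z.1 1 := lt_min hz' one_pos
  rw [coneWeight, coneWeight, ← Real.rpow_neg this.le]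
  congr 1; ring

theorem ae_cone (n : ℕ) (μ : Measure X) (γ : ℝ) : ∀ᵐ z ∂coneMeasure n μ γ, z ∈ cone X :=
  (coneMeasure_ac n μ γ).ae_le (ae_mem_cone μ)

theorem coneMeasure_ac_coneMeasure (n : ℕ) (μ : Measure X) (γ γ' : ℝ) :
    coneMeasure n μ γ ≪ coneMeasure n μ γ' :=
  (coneMeasure_ac n μ γ).trans (coneVol_ac n μ γ')

theorem coneMeasure_eq_withDensity (n : ℕ) (μ : Measure X) (γ : ℝ) :
    coneMeasure n μ γ =
      (coneMeasure n μ 0).withDensity fun z => ENNReal.ofReal (coneWeight γ z) := by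
  have hm : Measurable fun z : ℝ × X => ENNReal.ofReal (coneWeight γ z) :=
    (measurable_coneWeight γ).ennreal_ofReal
  have h := withDensity_mul (coneVol μ) (measurable_coneDensity (X := X) n 0) hm
  rw [coneMeasure, coneMeasure, ← h]
  refine withDensity_congr_ae ?_
  filter_upwards [ae_mem_cone μ] with z hz
  have hz' : (0 : ℝ) < z.1 := hz.1
  simp only [Pi.mul_apply, mul_zero, Real.rpow_zero, one_mul]
  rw [← ENNReal.ofReal_mul (by positivity), mul_comm, coneWeight]

/-- Division by the weight is an isometry from `K^{0,-γ}` to `K^{0,γ}`. -/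
theorem eLpNorm_div_coneWeight (v : ℝ × X → ℂ) :
    eLpNorm (fun z => v z / (coneWeight γ z : ℂ)) 2 (coneMeasure n μ γ) =
      eLpNorm v 2 (coneMeasure n μ (-γ)) := by
  have hm : ∀ γ : ℝ, Measurable fun z : ℝ × X => ENNReal.ofReal (coneWeight γ z) :=
    fun γ => (measurable_coneWeight γ).ennreal_ofReal
  rw [eLpNorm_eq_lintegral_rpow_enorm_toReal (by simp) (by simp),
    eLpNorm_eq_lintegral_rpow_enorm_toReal (by simp) (by simp), coneMeasure_eq_withDensity n μ γ,
    coneMeasure_eq_withDensity n μ (-γ),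
    lintegral_withDensity_eq_lintegral_mul_non_measurable _ (hm _) (by simp),
    lintegral_withDensity_eq_lintegral_mul_non_measurable _ (hm _) (by simp)]
  congr 1
  refine lintegral_congr_ae ?_
  filter_upwards [ae_cone n μ 0] with z hz
  have hw := coneWeight_pos (γ := γ) hz
  simp only [Pi.mul_apply]
  rw [coneWeight_neg hz, ← ofReal_norm, ← ofReal_norm, ENNReal.toReal_ofNat,
    ENNReal.ofReal_rpow_of_nonneg (norm_nonneg _) (by norm_num),
    ENNReal.ofReal_rpow_of_nonneg (norm_nonneg _) (by norm_num),
    ← ENNReal.ofReal_mul hw.le, ← ENNReal.ofReal_mul (by positivity)]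
  congr 1
  simp only [norm_div, Complex.norm_real, Real.norm_of_nonneg hw.le, Real.rpow_ofNat]
  field_simp

theorem memLp_div_coneWeight {v : ℝ × X → ℂ} (hv : MemLp v 2 (coneMeasure n μ (-γ))) :
    MemLp (fun z => v z / (coneWeight γ z : ℂ)) 2 (coneMeasure n μ γ) := by
  refine ⟨?_, by rw [eLpNorm_div_coneWeight]; exact hv.2⟩
  refine (hv.1.mono_ac (coneMeasure_ac_coneMeasure n μ γ (-γ))).mul ?_
  exact (Complex.measurable_ofReal.comp (measurable_coneWeight γ)).inv.aestronglyMeasurable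

/-- The duality of K^{0,γ} and K^{0,-γ} is formed with t^n dt dx, whereas Hilbert space theory for
K^{0,γ} uses its own measure. Dividing by the relative density passes from one to the other. -/
theorem integral_div_coneWeight (f : ℝ × X → ℂ) :
    ∫ z, f z / (coneWeight γ z : ℂ) ∂coneMeasure n μ γ = ∫ z, f z ∂coneMeasure n μ 0 := by
  have hm : Measurable fun z : ℝ × X => ENNReal.ofReal (coneWeight γ z) :=
    (measurable_coneWeight γ).ennreal_ofReal
  rw [coneMeasure_eq_withDensity n μ γ,
    integral_withDensity_eq_integral_toReal_smul hm (by simp)]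
  refine integral_congr_ae ?_
  filter_upwards [ae_cone n μ 0] with z hz
  have hw := coneWeight_pos (γ := γ) hz
  have hw' : (coneWeight γ z : ℂ) ≠ 0 := by exact_mod_cast hw.ne'
  rw [ENNReal.toReal_ofReal hw.le, Complex.real_smul]
  field_simp

theorem integrable_div_coneWeight_iff (f : ℝ × X → ℂ) :
    Integrable (fun z => f z / (coneWeight γ z : ℂ)) (coneMeasure n μ γ) ↔
      Integrable f (coneMeasure n μ 0) := by
  have hm : Measurable fun z : ℝ × X => ENNReal.ofReal (coneWeight γ z) :=
    (measurable_coneWeight γ).ennreal_ofReal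
  rw [coneMeasure_eq_withDensity n μ γ, integrable_withDensity_iff_integrable_smul' hm (by simp)]
  refine integrable_congr ?_
  filter_upwards [ae_cone n μ 0] with z hz
  have hw := coneWeight_pos (γ := γ) hz
  have hw' : (coneWeight γ z : ℂ) ≠ 0 := by exact_mod_cast hw.ne'
  rw [ENNReal.toReal_ofReal hw.le, Complex.real_smul]
  field_simp

/-- The bilinear pairing of `K^{0,γ}` with a fixed function in `K^{0,-γ}`. -/
def coneFunctional {v : ℝ × X → ℂ} (hv : MemLp v 2 (coneMeasure n μ (-γ))) :
    ConeL2 n μ γ →L[ℂ] ℂ :=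
  mulFunctional (memLp_div_coneWeight hv)

theorem coneFunctional_apply {v : ℝ × X → ℂ} (hv : MemLp v 2 (coneMeasure n μ (-γ)))
    (u : ConeL2 n μ γ) : coneFunctional hv u = ∫ z, u z * v z ∂coneMeasure n μ 0 := by
  rw [coneFunctional, mulFunctional_apply, ← integral_div_coneWeight (γ := γ)]
  simp only [mul_div_assoc]

variable [IsFiniteMeasure μ] {γ₁ γ₂ : ℝ}

theorem prod_coneMeasure_eq_withDensity :
    (coneMeasure n μ γ₁).prod (coneMeasure n μ γ₂) =
      ((coneMeasure n μ 0).prod (coneMeasure n μ 0)).withDensity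
        fun q => ENNReal.ofReal (coneWeight γ₁ q.1) * ENNReal.ofReal (coneWeight γ₂ q.2) := by
  rw [coneMeasure_eq_withDensity n μ γ₁, coneMeasure_eq_withDensity n μ γ₂,
    prod_withDensity (measurable_coneWeight γ₁).ennreal_ofReal
      (measurable_coneWeight γ₂).ennreal_ofReal]

theorem ae_prod_cone : ∀ᵐ q ∂(coneMeasure n μ γ₁).prod (coneMeasure n μ γ₂),
    q.1 ∈ cone X ∧ q.2 ∈ cone X :=
  (Measure.quasiMeasurePreserving_fst.ae (ae_cone n μ γ₁)).and
    (Measure.quasiMeasurePreserving_snd.ae (ae_cone n μ γ₂))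

theorem integrable_div_prod_coneWeight_iff (f : (ℝ × X) × (ℝ × X) → ℂ) :
    Integrable (fun q => f q / ((coneWeight γ₁ q.1 : ℂ) * (coneWeight γ₂ q.2 : ℂ)))
        ((coneMeasure n μ γ₁).prod (coneMeasure n μ γ₂)) ↔
      Integrable f ((coneMeasure n μ 0).prod (coneMeasure n μ 0)) := by
  have hm : Measurable fun q : (ℝ × X) × (ℝ × X) =>
      ENNReal.ofReal (coneWeight γ₁ q.1) * ENNReal.ofReal (coneWeight γ₂ q.2) :=
    ((measurable_coneWeight γ₁).ennreal_ofReal.comp measurable_fst).mul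
      ((measurable_coneWeight γ₂).ennreal_ofReal.comp measurable_snd)
  rw [prod_coneMeasure_eq_withDensity, integrable_withDensity_iff_integrable_smul' hm
    (by simp [ENNReal.mul_lt_top])]
  refine integrable_congr ?_
  filter_upwards [ae_prod_cone] with q hq
  have hw1 := coneWeight_pos (γ := γ₁) hq.1
  have hw2 := coneWeight_pos (γ := γ₂) hq.2
  have hw1' : (coneWeight γ₁ q.1 : ℂ) ≠ 0 := by exact_mod_cast hw1.ne'
  have hw2' : (coneWeight γ₂ q.2 : ℂ) ≠ 0 := by exact_mod_cast hw2.ne'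
  rw [ENNReal.toReal_mul, ENNReal.toReal_ofReal hw1.le, ENNReal.toReal_ofReal hw2.le,
    Complex.real_smul, Complex.ofReal_mul]
  field_simp

theorem integral_div_prod_coneWeight (f : (ℝ × X) × (ℝ × X) → ℂ) :
    ∫ q, f q / ((coneWeight γ₁ q.1 : ℂ) * (coneWeight γ₂ q.2 : ℂ))
        ∂(coneMeasure n μ γ₁).prod (coneMeasure n μ γ₂) =
      ∫ q, f q ∂(coneMeasure n μ 0).prod (coneMeasure n μ 0) := by
  have hm : Measurable fun q : (ℝ × X) × (ℝ × X) =>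
      ENNReal.ofReal (coneWeight γ₁ q.1) * ENNReal.ofReal (coneWeight γ₂ q.2) :=
    ((measurable_coneWeight γ₁).ennreal_ofReal.comp measurable_fst).mul
      ((measurable_coneWeight γ₂).ennreal_ofReal.comp measurable_snd)
  rw [prod_coneMeasure_eq_withDensity, integral_withDensity_eq_integral_toReal_smul hm
    (by simp [ENNReal.mul_lt_top])]
  refine integral_congr_ae ?_
  filter_upwards [ae_prod_cone] with q hq
  have hw1 := coneWeight_pos (γ := γ₁) hq.1
  have hw2 := coneWeight_pos (γ := γ₂) hq.2
  have hw1' : (coneWeight γ₁ q.1 : ℂ) ≠ 0 := by exact_mod_cast hw1.ne'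
  have hw2' : (coneWeight γ₂ q.2 : ℂ) ≠ 0 := by exact_mod_cast hw2.ne'
  rw [ENNReal.toReal_mul, ENNReal.toReal_ofReal hw1.le, ENNReal.toReal_ofReal hw2.le,
    Complex.real_smul, Complex.ofReal_mul]
  field_simp

/-- The functional `κ ↦ ∫∫ κ(z,w) a(z) b(w)` on square integrable kernels. -/
def kernelFunctional {a b : ℝ × X → ℂ} (ha : MemLp a 2 (coneMeasure n μ (-γ₁)))
    (hb : MemLp b 2 (coneMeasure n μ (-γ₂))) :
    Lp ℂ 2 ((coneMeasure n μ γ₁).prod (coneMeasure n μ γ₂)) →L[ℂ] ℂ :=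
  mulFunctional (memLp_tensor (memLp_div_coneWeight ha) (memLp_div_coneWeight hb))

/-- Cauchy–Schwarz on the product space, after the weights have been moved from the measure to the
functions. It is what makes Fubini available for the kernel. -/
theorem integrable_kernelFunctional {a b : ℝ × X → ℂ} (ha : MemLp a 2 (coneMeasure n μ (-γ₁)))
    (hb : MemLp b 2 (coneMeasure n μ (-γ₂)))
    (κ : Lp ℂ 2 ((coneMeasure n μ γ₁).prod (coneMeasure n μ γ₂))) :
    Integrable (fun q => κ q * (a q.1 * b q.2))
      ((coneMeasure n μ 0).prod (coneMeasure n μ 0)) := by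
  rw [← integrable_div_prod_coneWeight_iff (γ₁ := γ₁) (γ₂ := γ₂)]
  refine ((Lp.memLp κ).integrable_mul
    (memLp_tensor (memLp_div_coneWeight ha) (memLp_div_coneWeight hb))).congr
    (ae_of_all _ fun q => ?_)
  simp only [Pi.mul_apply]
  rw [div_mul_div_comm, ← mul_div_assoc]

theorem kernelFunctional_apply {a b : ℝ × X → ℂ} (ha : MemLp a 2 (coneMeasure n μ (-γ₁)))
    (hb : MemLp b 2 (coneMeasure n μ (-γ₂)))
    (κ : Lp ℂ 2 ((coneMeasure n μ γ₁).prod (coneMeasure n μ γ₂))) :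
    kernelFunctional ha hb κ =
      ∫ q, κ q * (a q.1 * b q.2) ∂(coneMeasure n μ 0).prod (coneMeasure n μ 0) := by
  rw [kernelFunctional, mulFunctional_apply,
    ← integral_div_prod_coneWeight (γ₁ := γ₁) (γ₂ := γ₂)]
  refine integral_congr_ae (ae_of_all _ fun q => ?_)
  simp only
  rw [div_mul_div_comm, ← mul_div_assoc]

/-- On elementary tensors the functional factorises. -/
theorem kernelFunctional_tensor {a b : ℝ × X → ℂ} (ha : MemLp a 2 (coneMeasure n μ (-γ₁)))
    (hb : MemLp b 2 (coneMeasure n μ (-γ₂))) {f g : ℝ × X → ℂ}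
    (hf : MemLp f 2 (coneMeasure n μ γ₁)) (hg : MemLp g 2 (coneMeasure n μ γ₂)) :
    kernelFunctional ha hb ((memLp_tensor hf hg).toLp _) =
      (∫ z, f z * a z ∂coneMeasure n μ 0) * ∫ w, g w * b w ∂coneMeasure n μ 0 := by
  rw [kernelFunctional_apply, ← integral_prod_mul]
  refine integral_congr_ae ?_
  have h := (memLp_tensor hf hg).coeFn_toLp
  have hac : (coneMeasure n μ 0).prod (coneMeasure n μ 0) ≪
      (coneMeasure n μ γ₁).prod (coneMeasure n μ γ₂) :=
    (coneMeasure_ac_coneMeasure n μ 0 γ₁).prod (coneMeasure_ac_coneMeasure n μ 0 γ₂)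
  filter_upwards [hac.ae_le h] with q hq
  rw [hq]; ring

end Pairing

/-! ### Integral operators in weak form -/

section IntegralOperator

variable {X : Type*} [TopologicalSpace X] [MeasurableSpace X] [BorelSpace X] {n : ℕ}
  {μ : Measure X} [IsFiniteMeasure μ] {γ γ' : ℝ}

instance sigmaFinite_coneMeasure (n : ℕ) (γ : ℝ) : SigmaFinite (coneMeasure n μ γ) := by
  unfold coneMeasure coneVol
  exact SigmaFinite.withDensity_ofReal _

/-- The second variable of a kernel carries the weight `-γ`, so `kernelFunctional` expects a
function of weight `- -γ`. -/
theorem memLp_neg_neg (u : ConeL2 n μ γ) : MemLp u 2 (coneMeasure n μ (- -γ)) := by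
  rw [neg_neg]; exact Lp.memLp u

/-- An operator is the integral operator with a square integrable kernel exactly when it is so
weakly. -/
theorem isIntegralOperator_iff (A : ConeL2 n μ γ →L[ℂ] ConeL2 n μ γ')
    (κ : Lp ℂ 2 ((coneMeasure n μ γ').prod (coneMeasure n μ (-γ)))) :
    IsIntegralOperator A κ ↔ ∀ (u : ConeL2 n μ γ) (a : ℝ × X → ℂ)
      (ha : MemLp a 2 (coneMeasure n μ (-γ'))),
      coneFunctional ha (A u) = kernelFunctional ha (memLp_neg_neg u) κ := by
  constructor
  · intro h u a ha
    rw [coneFunctional_apply, kernelFunctional_apply,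
      integral_prod _ (integrable_kernelFunctional ha (memLp_neg_neg u) κ)]
    refine integral_congr_ae ?_
    filter_upwards [h u] with z hz
    rw [hz.2, ← integral_mul_const]
    refine integral_congr_ae (ae_of_all _ fun w => ?_)
    simp only; ring
  · intro h u
    set τ := coneMeasure n μ (-γ') with hτ
    have hind : ∀ s : Set (ℝ × X), MeasurableSet s → τ s < (⊤ : ℝ≥0∞) →
        MemLp (s.indicator fun _ => (1 : ℂ)) 2 (coneMeasure n μ (-γ')) := fun s hs hs' =>
      memLp_indicator_const 2 hs 1 (Or.inr hs'.ne)
    -- Integrability of almost every slice is known only after multiplication by a test function of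
    -- `z`. Indicators of the spanning sets of the σ-finite measure `τ` are admissible tests and
    -- cover every `z`.
    have hint : ∀ᵐ z ∂coneMeasure n μ 0,
        Integrable (fun w => κ (z, w) * u w) (coneMeasure n μ 0) := by
      have h1 : ∀ k : ℕ, ∀ᵐ z ∂coneMeasure n μ 0, z ∈ spanningSets τ k →
          Integrable (fun w => κ (z, w) * u w) (coneMeasure n μ 0) := fun k => by
        have h2 := integrable_kernelFunctional
          (hind _ (measurableSet_spanningSets τ k) (measure_spanningSets_lt_top τ k))
          (memLp_neg_neg u) κ
        filter_upwards [h2.prod_right_ae] with z hz hzk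
        simpa [hzk] using hz
      filter_upwards [ae_all_iff.2 h1] with z hz
      exact hz _ (mem_spanningSetsIndex τ z)
    -- The weak identity with the indicator of `s` as test function, written as an equality of
    -- integrals over `s` by Fubini.
    have key : ∀ s : Set (ℝ × X), MeasurableSet s → τ s < (⊤ : ℝ≥0∞) →
        IntegrableOn (fun z => A u z) s (coneMeasure n μ 0) ∧
        IntegrableOn (fun z => ∫ w, κ (z, w) * u w ∂coneMeasure n μ 0) s (coneMeasure n μ 0) ∧
        ∫ z in s, A u z ∂coneMeasure n μ 0 =
          ∫ z in s, (∫ w, κ (z, w) * u w ∂coneMeasure n μ 0) ∂coneMeasure n μ 0 := by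
      intro s hs hs'
      have ha := hind s hs hs'
      have e1 : (fun z => A u z * s.indicator (fun _ => (1 : ℂ)) z) =
          s.indicator fun z => A u z := by
        ext z; by_cases hz : z ∈ s <;> simp [hz]
      have e2 : (fun z => ∫ w, κ (z, w) * (s.indicator (fun _ => (1 : ℂ)) z * u w)
          ∂coneMeasure n μ 0) =
          s.indicator fun z => ∫ w, κ (z, w) * u w ∂coneMeasure n μ 0 := by
        ext z; by_cases hz : z ∈ s <;> simp [hz]
      have i1 : Integrable (fun z => A u z * s.indicator (fun _ => (1 : ℂ)) z)
          (coneMeasure n μ 0) := by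
        rw [← integrable_div_coneWeight_iff (γ := γ')]
        refine ((Lp.memLp (A u)).integrable_mul (memLp_div_coneWeight ha)).congr
          (ae_of_all _ fun z => ?_)
        simp only [Pi.mul_apply, mul_div_assoc]
      have i2 := (integrable_kernelFunctional ha (memLp_neg_neg u) κ).integral_prod_left
      have i3 := h u _ ha
      rw [coneFunctional_apply, kernelFunctional_apply,
        integral_prod _ (integrable_kernelFunctional ha (memLp_neg_neg u) κ)] at i3
      simp only at i2 i3
      rw [e1] at i1 i3
      rw [e2] at i2 i3
      rw [integral_indicator hs, integral_indicator hs] at i3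
      exact ⟨(integrable_indicator_iff hs).1 i1, (integrable_indicator_iff hs).1 i2, i3⟩
    have hdiv : ∀ (f : ℝ × X → ℂ) (s : Set (ℝ × X)), (s.indicator fun z =>
        f z / (coneWeight (-γ') z : ℂ)) = fun z => s.indicator f z / (coneWeight (-γ') z : ℂ) := by
      intro f s; ext z; by_cases hz : z ∈ s <;> simp [hz]
    have hon : ∀ (f : ℝ × X → ℂ) (s : Set (ℝ × X)), MeasurableSet s →
        IntegrableOn f s (coneMeasure n μ 0) →
        IntegrableOn (fun z => f z / (coneWeight (-γ') z : ℂ)) s τ := by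
      intro f s hs hf
      rw [← integrable_indicator_iff hs, hdiv, integrable_div_coneWeight_iff,
        integrable_indicator_iff hs]
      exact hf
    have hset : ∀ (f : ℝ × X → ℂ) (s : Set (ℝ × X)), MeasurableSet s →
        ∫ z in s, f z / (coneWeight (-γ') z : ℂ) ∂τ = ∫ z in s, f z ∂coneMeasure n μ 0 := by
      intro f s hs
      rw [← integral_indicator hs, hdiv, integral_div_coneWeight, integral_indicator hs]
    -- The sets allowed as tests have finite `τ`-measure, so the comparison must be made with
    -- respect to `τ`; dividing both functions by the density turns integrals for t^n dt dx into
    -- integrals for `τ`.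
    have hae := ae_eq_of_forall_setIntegral_eq_of_sigmaFinite (μ := τ)
      (f := fun z => A u z / (coneWeight (-γ') z : ℂ))
      (g := fun z => (∫ w, κ (z, w) * u w ∂coneMeasure n μ 0) / (coneWeight (-γ') z : ℂ))
      (fun s hs hs' => hon _ s hs (key s hs hs').1)
      (fun s hs hs' => hon _ s hs (key s hs hs').2.1)
      (fun s hs hs' => by rw [hset _ s hs, hset _ s hs]; exact (key s hs hs').2.2)
    filter_upwards [hint, ae_cone n μ 0,
      (coneMeasure_ac_coneMeasure n μ 0 (-γ')).ae_le hae] with z h1 hz h2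
    have hw := coneWeight_pos (γ := -γ') hz
    have hw' : (coneWeight (-γ') z : ℂ) ≠ 0 := by exact_mod_cast hw.ne'
    exact ⟨h1, (div_left_inj' hw').1 h2⟩

end IntegralOperator

/-! ### Frames for the spaces S^γ_ε -/

section Frame

variable (n : ℕ) {X : Type*} [TopologicalSpace X] [ChartedSpace (EuclideanSpace ℝ (Fin n)) X]
  [IsManifold (𝓡 n) ∞ X] [MeasurableSpace X] [BorelSpace X] (μ : Measure X)

/-- The element of `S^γ_ε` given by a function. -/
def ConeSchwartz.mk {n : ℕ} {X : Type*} [TopologicalSpace X]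
    [ChartedSpace (EuclideanSpace ℝ (Fin n)) X] [IsManifold (𝓡 n) ∞ X] [MeasurableSpace X]
    [BorelSpace X] {μ : Measure X} {γ ε : ℝ} (u : ℝ × X → ℂ)
    (hu : u ∈ coneSchwartzSubmodule n μ γ ε) : ConeSchwartz n μ γ ε := ⟨u, hu⟩

/-- A frame for the spaces `S^γ_ε(X^∧)`: functions `elem γ j` and dual functions `dual γ j` such that
`u = ∑ j, (∫ u * dual γ j) • elem γ j`, with growth and decay measured by `rate δ N j`. -/
structure ConeFrame where
  J : Type
  neg : Equiv.Perm J
  rate : ℝ → ℕ → J → ℝ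
  elem : ℝ → J → ℝ × X → ℂ
  dual : ℝ → J → ℝ × X → ℂ
  rate_pos : ∀ δ N j, 0 < rate δ N j
  rate_mono : ∀ {δ δ' : ℝ} {N N' : ℕ}, δ ≤ δ' → N ≤ N' → ∀ j, rate δ N j ≤ rate δ' N' j
  rate_add : ∀ δ δ' N N' j, rate (δ + δ') (N + N') j = rate δ N j * rate δ' N' j
  rate_neg : ∀ δ N j, rate δ N (neg j) = rate δ N j
  summable_rate : ∃ N, ∀ δ, 0 < δ → Summable fun j => (rate δ N j)⁻¹
  elem_mem : ∀ γ ε j, elem γ j ∈ coneSchwartzSubmodule n μ γ ε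
  elem_bound : ∀ γ ε (i : SchwartzIndex n X ε), ∃ C N, ∀ j,
    coneSeminorms n μ γ ε i (ConeSchwartz.mk (elem γ j) (elem_mem γ ε j)) ≤ C * rate i.2.2.2.1 N j
  elem_neg : ∀ γ j z, elem γ (neg j) z = conj (elem γ j z)
  dual_memLp : ∀ γ j, MemLp (dual γ j) 2 (coneMeasure n μ (-γ))
  dual_bound : ∀ γ, ∃ C : ℝ, ∀ j, (eLpNorm (dual γ j) 2 (coneMeasure n μ (-γ))).toReal ≤ C
  dual_neg : ∀ γ j z, dual γ (neg j) z = conj (dual γ j z)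
  coef_bound : ∀ γ ε δ N, 0 ≤ δ → δ < ε → ∃ q : Seminorm ℂ (ConeSchwartz n μ γ ε), Continuous q ∧
    ∀ (u : ConeSchwartz n μ γ ε) j,
      ‖∫ z, u.toFun z * dual γ j z ∂coneMeasure n μ 0‖ * rate δ N j ≤ q u
  hasSum : ∀ γ ε, 0 < ε → ∀ u : ConeSchwartz n μ γ ε,
    HasSum (fun j => (∫ z, u.toFun z * dual γ j z ∂coneMeasure n μ 0) •
      ConeSchwartz.mk (elem γ j) (elem_mem γ ε j)) u

end Frame

/-! ### Frame expansions in the completed tensor product -/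

namespace ConeFrame

variable {n : ℕ} {X : Type*} [TopologicalSpace X] [ChartedSpace (EuclideanSpace ℝ (Fin n)) X]
  [IsManifold (𝓡 n) ∞ X] [MeasurableSpace X] [BorelSpace X] {μ : Measure X}
  (F : ConeFrame n μ) {γ γ' γ₁ γ₂ ε : ℝ}

/-- The frame functions as elements of `S^γ_ε`. -/
def elt (γ ε : ℝ) (j : F.J) : ConeSchwartz n μ γ ε :=
  ConeSchwartz.mk (F.elem γ j) (F.elem_mem γ ε j)

/-- The coefficient of a function with respect to the frame. -/
def coef (γ : ℝ) (j : F.J) (u : ℝ × X → ℂ) : ℂ := ∫ z, u z * F.dual γ j z ∂coneMeasure n μ 0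

/-- Finitely many seminorms involve finitely many parameters below `ε`, and their maximum is still
strictly below `ε`. The gap that remains is used for summability in `exists_tmul_bound`. -/
theorem exists_elt_bound (hε : 0 < ε) (I : Finset (SchwartzIndex n X ε)) :
    ∃ (C δ : ℝ) (N : ℕ), 0 < C ∧ 0 ≤ δ ∧ δ < ε ∧ ∀ i ∈ I, ∀ j,
      coneSeminorms n μ γ ε i (F.elt γ ε j) ≤ C * F.rate δ N j := by
  classical
  induction I using Finset.induction_on with
  | empty => exact ⟨1, 0, 0, one_pos, le_rfl, hε, by simp⟩
  | insert i I hi ih =>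
    obtain ⟨C, δ, N, hC, hδ, hδ', h⟩ := ih
    obtain ⟨C', N', h'⟩ := F.elem_bound γ ε i
    refine ⟨max C C', max δ i.2.2.2.1, max N N', lt_max_of_lt_left hC, le_max_of_le_left hδ,
      max_lt hδ' i.2.2.2.2.2, fun k hk j => ?_⟩
    rcases Finset.mem_insert.1 hk with rfl | hk
    · refine (h' j).trans ?_
      have := F.rate_pos k.2.2.2.1 N' j
      exact mul_le_mul (le_max_right _ _) (F.rate_mono (le_max_right _ _) (le_max_right _ _) j)
        this.le (le_max_of_le_left hC.le)
    · refine (h k hk j).trans ?_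
      exact mul_le_mul (le_max_left _ _) (F.rate_mono (le_max_left _ _) (le_max_left _ _) j)
        (F.rate_pos _ _ _).le (le_max_of_le_left hC.le)

/-- Every continuous seminorm of the projective tensor product is summable on elementary tensors of
frame functions after division by suitable rates. -/
theorem exists_tmul_bound (hε : 0 < ε)
    {s : Seminorm ℂ (ProjTensor (ConeSchwartz n μ γ₁ ε) (ConeSchwartz n μ γ₂ ε))}
    (hs : Continuous fun x : ConeSchwartz n μ γ₁ ε × ConeSchwartz n μ γ₂ ε =>
      s (ProjTensor.tmul x.1 x.2)) :
    ∃ (δ : ℝ) (N : ℕ) (b : F.J × F.J → ℝ), 0 ≤ δ ∧ δ < ε ∧ Summable b ∧ (∀ x, 0 ≤ b x) ∧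
      ∀ x : F.J × F.J, s (ProjTensor.tmul (F.elt γ₁ ε x.1) (F.elt γ₂ ε x.2)) ≤
        (F.rate δ N x.1 * F.rate δ N x.2) * b x := by
  obtain ⟨I, K, C, hC, h⟩ := exists_bound_projSeminorm coneSeminorms_withSeminorms
    coneSeminorms_withSeminorms hs
  obtain ⟨C₁, δ₁, N₁, hC₁, hδ₁, hδ₁', h₁⟩ := F.exists_elt_bound (γ := γ₁) hε I
  obtain ⟨C₂, δ₂, N₂, hC₂, hδ₂, hδ₂', h₂⟩ := F.exists_elt_bound (γ := γ₂) hε K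
  obtain ⟨M, hM⟩ := F.summable_rate
  set δ₀ := max δ₁ δ₂
  set N₀ := max N₁ N₂
  have hδ₀ : δ₀ < ε := max_lt hδ₁' hδ₂'
  -- Half of the gap between `δ₀` and `ε`: an extra factor `rate η M` in each variable has summable
  -- inverse, while `δ₀ + η` stays below `ε`.
  set η := (ε - δ₀) / 2
  have hη : 0 < η := by simp only [η]; linarith
  refine ⟨δ₀ + η, N₀ + M, fun x => C * C₁ * C₂ * ((F.rate η M x.1)⁻¹ * (F.rate η M x.2)⁻¹),
    add_nonneg (le_max_of_le_left hδ₁) hη.le, by simp only [η]; linarith,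
    ((hM η hη).mul_of_nonneg (hM η hη) (fun j => inv_nonneg.2 (F.rate_pos _ _ _).le)
      (fun j => inv_nonneg.2 (F.rate_pos _ _ _).le)).mul_left _, fun x => ?_, fun x => ?_⟩
  · have := F.rate_pos η M x.1
    have := F.rate_pos η M x.2
    positivity
  · have r1 := F.rate_pos η M x.1
    have r2 := F.rate_pos η M x.2
    have r3 := F.rate_pos δ₀ N₀ x.1
    have r4 := F.rate_pos δ₀ N₀ x.2
    refine (h _ _ (C₁ * F.rate δ₀ N₀ x.1) (C₂ * F.rate δ₀ N₀ x.2) (by positivity) (by positivity)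
      (fun i hi => (h₁ i hi x.1).trans (mul_le_mul_of_nonneg_left
        (F.rate_mono (le_max_left _ _) (le_max_left _ _) _) hC₁.le))
      (fun i hi => (h₂ i hi x.2).trans (mul_le_mul_of_nonneg_left
        (F.rate_mono (le_max_right _ _) (le_max_right _ _) _) hC₂.le))).trans_eq ?_
    rw [F.rate_add, F.rate_add]
    field_simp

variable [IsFiniteMeasure μ]

/-- The inclusion of `S^γ_ε` into `K^{0,γ}`. -/
def toL2 (hε : 0 < ε) : ConeSchwartz n μ γ ε →L[ℂ] ConeL2 n μ γ where
  toFun u := (u.memLp hε).toLp _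
  map_add' _ _ := rfl
  map_smul' _ _ := rfl
  cont := by
    let L : ConeSchwartz n μ γ ε →ₗ[ℂ] ConeL2 n μ γ :=
      { toFun := fun u => (u.memLp hε).toLp _
        map_add' := fun u v => rfl
        map_smul' := fun c u => rfl }
    refine continuous_of_continuousAt_zero L ?_
    have h := (ConeSchwartz.continuous_norm (n := n) (μ := μ) (γ₁ := γ) hε).tendsto 0
    rw [ContinuousAt, map_zero]
    refine tendsto_zero_iff_norm_tendsto_zero.2 ?_
    have e : ∀ u, (eLpNorm (ConeSchwartz.toFun u) 2 (coneMeasure n μ γ)).toReal = ‖L u‖ :=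
      fun u => (Lp.norm_toLp _ (ConeSchwartz.memLp hε u)).symm
    simp only [e, map_zero, norm_zero] at h
    exact h

theorem toL2_ae (hε : 0 < ε) (u : ConeSchwartz n μ γ ε) :
    toL2 hε u =ᵐ[coneMeasure n μ γ] u.toFun := (u.memLp hε).coeFn_toLp

theorem coef_eq_of_ae {u : ConeL2 n μ γ} {f : ConeSchwartz n μ γ ε}
    (h : u =ᵐ[coneMeasure n μ γ] f.toFun) (j : F.J) :
    coneFunctional (F.dual_memLp γ j) u = F.coef γ j f.toFun := by
  rw [coneFunctional_apply, coef]
  refine integral_congr_ae ?_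
  filter_upwards [(coneMeasure_ac_coneMeasure n μ 0 γ).ae_le h] with z hz
  rw [hz]

theorem coef_toL2 (hε : 0 < ε) (u : ConeSchwartz n μ γ ε) (j : F.J) :
    F.coef γ j u.toFun = coneFunctional (F.dual_memLp γ j) (toL2 hε u) :=
  (F.coef_eq_of_ae (toL2_ae hε u) j).symm

/-- The coefficients of a square integrable kernel with respect to the frame. -/
def kernelCoef (x : F.J × F.J) :
    Lp ℂ 2 ((coneMeasure n μ γ₁).prod (coneMeasure n μ γ₂)) →L[ℂ] ℂ :=
  kernelFunctional (F.dual_memLp γ₁ x.1) (F.dual_memLp γ₂ x.2)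

theorem kernelCoef_tmul (hε : 0 < ε) (x : F.J × F.J) (u : ConeSchwartz n μ γ₁ ε)
    (v : ConeSchwartz n μ γ₂ ε) :
    F.kernelCoef x (tensorFun hε (ProjTensor.tmul u v)) =
      F.coef γ₁ x.1 u.toFun * F.coef γ₂ x.2 v.toFun := by
  rw [tensorFun_tmul]
  exact kernelFunctional_tensor _ _ (u.memLp hε) (v.memLp hε)

/-- The elementary tensors of frame functions. -/
def tens (γ₁ γ₂ ε : ℝ) (x : F.J × F.J) :
    ProjTensor (ConeSchwartz n μ γ₁ ε) (ConeSchwartz n μ γ₂ ε) :=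
  ProjTensor.tmul (F.elt γ₁ ε x.1) (F.elt γ₂ ε x.2)

theorem exists_coef_bound {δ : ℝ} {N : ℕ} (hδ : 0 ≤ δ) (hδ' : δ < ε) :
    ∃ (p : Seminorm ℂ (ConeSchwartz n μ γ₁ ε)) (q : Seminorm ℂ (ConeSchwartz n μ γ₂ ε)),
      Continuous p ∧ Continuous q ∧ ∀ u v (x : F.J × F.J),
        ‖F.coef γ₁ x.1 u.toFun * F.coef γ₂ x.2 v.toFun‖ * (F.rate δ N x.1 * F.rate δ N x.2) ≤
          p u * q v := by
  obtain ⟨p, hp, hp'⟩ := F.coef_bound γ₁ ε δ N hδ hδ'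
  obtain ⟨q, hq, hq'⟩ := F.coef_bound γ₂ ε δ N hδ hδ'
  refine ⟨p, q, hp, hq, fun u v x => ?_⟩
  rw [norm_mul, mul_mul_mul_comm]
  have r1 := F.rate_pos δ N x.1
  have r2 := F.rate_pos δ N x.2
  exact mul_le_mul (hp' u x.1) (hq' v x.2) (by positivity) (apply_nonneg _ _)

/-- The seminorm `T ↦ ∑ |coefficients of T| * s (frame tensors)` is well defined and continuous. -/
theorem exists_coefSeminorm (hε : 0 < ε)
    {s : Seminorm ℂ (ProjTensor (ConeSchwartz n μ γ₁ ε) (ConeSchwartz n μ γ₂ ε))}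
    (hs : Continuous fun x : ConeSchwartz n μ γ₁ ε × ConeSchwartz n μ γ₂ ε =>
      s (ProjTensor.tmul x.1 x.2)) :
    ∃ s' : Seminorm ℂ (ProjTensor (ConeSchwartz n μ γ₁ ε) (ConeSchwartz n μ γ₂ ε)),
      (Continuous fun x : ConeSchwartz n μ γ₁ ε × ConeSchwartz n μ γ₂ ε =>
        s' (ProjTensor.tmul x.1 x.2)) ∧
      ∀ T, HasSum (fun x => ‖F.kernelCoef x (tensorFun hε T)‖ * s (F.tens γ₁ γ₂ ε x)) (s' T) := by
  obtain ⟨δ, N, b, hδ, hδ', hb, hb0, h⟩ := F.exists_tmul_bound hε hs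
  obtain ⟨p, q, hp, hq, hpq⟩ := F.exists_coef_bound (γ₁ := γ₁) (γ₂ := γ₂) (N := N) hδ hδ'
  have hbound : ∀ u v x, ‖F.kernelCoef x (tensorFun hε (ProjTensor.tmul u v))‖ *
      s (F.tens γ₁ γ₂ ε x) ≤ p u * q v * b x := by
    intro u v x
    rw [kernelCoef_tmul]
    refine (mul_le_mul_of_nonneg_left (h x) (norm_nonneg _)).trans ?_
    rw [← mul_assoc]
    exact mul_le_mul_of_nonneg_right (hpq u v x) (hb0 x)
  have hsum : ∀ T : ProjTensor (ConeSchwartz n μ γ₁ ε) (ConeSchwartz n μ γ₂ ε), Summable fun x =>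
      ‖F.kernelCoef x (tensorFun hε T)‖ * s (F.tens γ₁ γ₂ ε x) := by
    intro T
    induction T using ProjTensor.induction_on with
    | zero =>
      refine summable_zero.congr fun x => ?_
      rw [map_zero, map_zero, norm_zero, zero_mul]
    | tmul u v =>
      refine Summable.of_nonneg_of_le (fun x => by positivity) (fun x => hbound u v x)
        (hb.mul_left _)
    | add T T' hT hT' =>
      refine Summable.of_nonneg_of_le (fun x => by positivity) (fun x => ?_) (hT.add hT')
      rw [← add_mul]
      refine mul_le_mul_of_nonneg_right ?_ (apply_nonneg _ _)
      rw [map_add, map_add]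
      exact norm_add_le _ _
  let s' : Seminorm ℂ (ProjTensor (ConeSchwartz n μ γ₁ ε) (ConeSchwartz n μ γ₂ ε)) :=
    Seminorm.of (fun T => ∑' x, ‖F.kernelCoef x (tensorFun hε T)‖ * s (F.tens γ₁ γ₂ ε x))
      (fun T T' => by
        rw [← (hsum T).tsum_add (hsum T')]
        refine (hsum _).tsum_le_tsum (fun x => ?_) ((hsum T).add (hsum T'))
        rw [← add_mul, map_add, map_add]
        exact mul_le_mul_of_nonneg_right (norm_add_le _ _) (apply_nonneg _ _))
      (fun c T => by
        rw [← tsum_mul_left]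
        refine tsum_congr fun x => ?_
        rw [map_smul, map_smul, norm_smul, mul_assoc])
  refine ⟨s', ?_, fun T => (hsum T).hasSum⟩
  have hB : 0 ≤ ∑' x, b x := tsum_nonneg hb0
  -- Summing the termwise bound `p u * q v * b x` gives `(∑ b) * p u * q v`; the scalar is absorbed
  -- into the first seminorm.
  refine continuous_tmul_of_bound (p := Real.toNNReal (∑' x, b x) • p) (q := q) ?_ hq
    fun u v => ?_
  · exact (continuous_const.mul hp)
  · change ∑' x, _ ≤ (Real.toNNReal (∑' x, b x) : ℝ) * p u * q v
    rw [Real.coe_toNNReal _ hB]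
    refine ((hsum _).tsum_le_tsum (hbound u v) (hb.mul_left _)).trans_eq ?_
    rw [tsum_mul_left]; ring

theorem kernelFun_sub (hε : 0 < ε) (T T' : ConeKernelSpace n μ γ₁ γ₂ ε) :
    kernelFun hε (T - T') = kernelFun hε T - kernelFun hε T' := by
  have h := continuous_kernelFun (n := n) (μ := μ) (γ₁ := γ₁) (γ₂ := γ₂) hε
  induction T, T' using UniformSpace.Completion.induction_on₂ with
  | hp => exact isClosed_eq (by fun_prop) (by fun_prop)
  | ih x y =>
    rw [← UniformSpace.Completion.coe_sub, kernelFun_coe, kernelFun_coe, kernelFun_coe, map_sub]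

theorem hasSum_coef (hε : 0 < ε) (u : ConeSchwartz n μ γ ε) :
    HasSum (fun j => F.coef γ j u.toFun • F.elt γ ε j) u :=
  F.hasSum γ ε hε u

theorem summable_kernelCoef (hε : 0 < ε)
    (T : ProjTensor (ConeSchwartz n μ γ₁ ε) (ConeSchwartz n μ γ₂ ε)) :
    Summable (fun x => ((F.kernelCoef x (tensorFun hε T) •
      F.tens γ₁ γ₂ ε x : ProjTensor _ _) : ConeKernelSpace n μ γ₁ γ₂ ε)) := by
  refine summable_completion (projSeminorms_withSeminorms _ _) fun s => ?_
  obtain ⟨s', -, h⟩ := F.exists_coefSeminorm hε s.2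
  exact (h T).summable.congr fun x => (map_smul_eq_mul s.1 _ _).symm

/-- Expanding `v` and then `u`, with separate continuity of the tensor map, gives u ⊗ v as an
iterated sum. The double series is already known to be summable, so its sum can be computed
iteratedly and is the same element. -/
theorem hasSum_tmul (hε : 0 < ε) (u : ConeSchwartz n μ γ₁ ε) (v : ConeSchwartz n μ γ₂ ε) :
    HasSum (fun x => ((F.kernelCoef x (tensorFun hε (ProjTensor.tmul u v)) •
      F.tens γ₁ γ₂ ε x : ProjTensor _ _) : ConeKernelSpace n μ γ₁ γ₂ ε))
      (ProjTensor.tmul u v : ProjTensor _ _) := by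
  have hs := F.summable_kernelCoef hε (ProjTensor.tmul u v)
  have h1 : ∀ j, HasSum (fun l => ((F.kernelCoef (j, l) (tensorFun hε (ProjTensor.tmul u v)) •
      F.tens γ₁ γ₂ ε (j, l) : ProjTensor _ _) : ConeKernelSpace n μ γ₁ γ₂ ε))
      ((F.coef γ₁ j u.toFun • ProjTensor.tmul (F.elt γ₁ ε j) v : ProjTensor _ _) :
        ConeKernelSpace n μ γ₁ γ₂ ε) := fun j => by
    have h2 := hasSum_coe_completion (((F.hasSum_coef hε v).mapL
      (ProjTensor.tmulLeft (F.elt γ₁ ε j))).const_smul (F.coef γ₁ j u.toFun))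
    refine (congrArg (HasSum · _) (funext fun l => ?_)).mpr h2
    rw [kernelCoef_tmul, mul_smul]
    congr 2
    exact (ProjTensor.tmul_smul_right _ _ _).symm
  have h3 : HasSum (fun j => ((F.coef γ₁ j u.toFun • ProjTensor.tmul (F.elt γ₁ ε j) v :
      ProjTensor _ _) : ConeKernelSpace n μ γ₁ γ₂ ε)) (ProjTensor.tmul u v : ProjTensor _ _) := by
    have h2 := hasSum_coe_completion ((F.hasSum_coef hε u).mapL (ProjTensor.tmulRight v))
    refine (congrArg (HasSum · _) (funext fun l => ?_)).mpr h2
    exact congrArg _ (ProjTensor.tmul_smul_left _ _ _).symm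
  have h4 := hs.hasSum.prod_fiberwise h1
  rw [← h4.unique h3]
  exact hs.hasSum

theorem hasSum_coe_tensor (hε : 0 < ε)
    (T : ProjTensor (ConeSchwartz n μ γ₁ ε) (ConeSchwartz n μ γ₂ ε)) :
    HasSum (fun x => ((F.kernelCoef x (tensorFun hε T) •
      F.tens γ₁ γ₂ ε x : ProjTensor _ _) : ConeKernelSpace n μ γ₁ γ₂ ε)) T := by
  induction T using ProjTensor.induction_on with
  | zero =>
    simp only [map_zero, zero_smul, UniformSpace.Completion.coe_zero]
    exact hasSum_zero
  | tmul u v => exact F.hasSum_tmul hε u v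
  | add T T' hT hT' =>
    simp only [map_add, add_smul, UniformSpace.Completion.coe_add]
    exact hT.add hT'

/-- Every element of the completed tensor product is the sum of its frame expansion. -/
theorem hasSum_kernel (hε : 0 < ε) (T : ConeKernelSpace n μ γ₁ γ₂ ε) :
    HasSum (fun x => ((F.kernelCoef x (kernelFun hε T) •
      F.tens γ₁ γ₂ ε x : ProjTensor _ _) : ConeKernelSpace n μ γ₁ γ₂ ε)) T := by
  have hw := projSeminorms_withSeminorms (ConeSchwartz n μ γ₁ ε) (ConeSchwartz n μ γ₂ ε)
  refine tendsto_completion_of_seminorms hw fun s₀ => ?_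
  obtain ⟨s', hs', h⟩ := F.exists_coefSeminorm hε s₀.2
  have hsc : Continuous s₀.1 := hw.continuous_seminorm s₀
  have hsc' : Continuous s' := hw.continuous_seminorm ⟨s', hs'⟩
  obtain ⟨s, hs⟩ := s₀
  change Tendsto (fun a => completionSeminorm s _) _ _
  simp only at h hsc
  -- The partial sums of the expansion, viewed as additive maps of `T`. They converge to the
  -- identity on algebraic tensors; the passage to the completion needs only equicontinuity.
  set P : Finset (F.J × F.J) → ConeKernelSpace n μ γ₁ γ₂ ε →
      ProjTensor (ConeSchwartz n μ γ₁ ε) (ConeSchwartz n μ γ₂ ε) :=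
    fun t T => ∑ x ∈ t, F.kernelCoef x (kernelFun hε T) • F.tens γ₁ γ₂ ε x with hP
  have hPc : ∀ t, Continuous (P t) := fun t => by
    refine continuous_finsetSum _ fun x _ => ?_
    let k := F.kernelCoef (γ₁ := γ₁) (γ₂ := γ₂) x
    have hk : Continuous fun T : ConeKernelSpace n μ γ₁ γ₂ ε => k (kernelFun hε T) :=
      k.continuous.comp (continuous_kernelFun hε)
    exact hk.smul (continuous_const (y := F.tens γ₁ γ₂ ε x))
  have hPsub : ∀ t T T', P t (T - T') = P t T - P t T' := fun t T T' => by
    simp only [hP, kernelFun_sub, map_sub, sub_smul, Finset.sum_sub_distrib]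
  -- Equicontinuity in `t`. On algebraic tensors a partial sum of norms is at most the full sum
  -- `s'`, and both sides are continuous in `T`.
  have hPs : ∀ t T, s (P t T) ≤ completionSeminorm s' T := by
    intro t T
    induction T using UniformSpace.Completion.induction_on with
    | hp => exact isClosed_le (hsc.comp (hPc t)) (continuous_completionSeminorm _)
    | ih T =>
      rw [completionSeminorm_coe hsc']
      simp only [hP, kernelFun_coe]
      refine (seminorm_sum_le _ _ _).trans ?_
      refine le_trans (Finset.sum_le_sum fun x _ => ?_)
        (sum_le_hasSum t (fun x _ => by positivity) (h T))
      exact (map_smul_eq_mul s _ _).le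
  have e : ∀ T t, ∑ x ∈ t, ((F.kernelCoef x (kernelFun hε T) •
      F.tens γ₁ γ₂ ε x : ProjTensor _ _) : ConeKernelSpace n μ γ₁ γ₂ ε) = (P t T : ProjTensor _ _) :=
    fun T t => (map_sum (UniformSpace.Completion.toCompl
      (α := ProjTensor (ConeSchwartz n μ γ₁ ε) (ConeSchwartz n μ γ₂ ε))) _ t).symm
  have c1 := continuous_completionSeminorm s
  have c2 := continuous_completionSeminorm s'
  have h0 : ∀ {r : Seminorm ℂ (ProjTensor (ConeSchwartz n μ γ₁ ε) (ConeSchwartz n μ γ₂ ε))},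
      Continuous r → completionSeminorm r 0 = 0 := fun {r} hr => by
    rw [← UniformSpace.Completion.coe_zero, completionSeminorm_coe hr, map_zero]
  rw [Metric.tendsto_nhds]
  intro η hη
  have ho : IsOpen {S : ConeKernelSpace n μ γ₁ γ₂ ε |
      completionSeminorm s (S - T) < η / 3 ∧ completionSeminorm s' (T - S) < η / 3} :=
    (isOpen_lt (c1.comp (continuous_id.sub continuous_const)) continuous_const).inter
      (isOpen_lt (c2.comp (continuous_const.sub continuous_id)) continuous_const)
  -- An algebraic tensor close to `T` both for `s`, which controls `T₀ - T`, and for `s'`, which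
  -- controls the partial sums of `T - T₀`. The third `η / 3` is the error of the expansion of `T₀`.
  obtain ⟨T₀, h1, h2⟩ := UniformSpace.Completion.denseRange_coe.exists_mem_open ho
    ⟨T, by rw [sub_self, h0 hsc]; linarith, by rw [sub_self, h0 hsc']; linarith⟩
  have h3 : Tendsto (fun t => completionSeminorm s
      ((P t T₀ : ProjTensor _ _) - (T₀ : ConeKernelSpace n μ γ₁ γ₂ ε))) atTop (𝓝 0) := by
    have h4 : Tendsto (fun t => ((P t T₀ : ProjTensor _ _) : ConeKernelSpace n μ γ₁ γ₂ ε)) atTop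
        (𝓝 (T₀ : ConeKernelSpace n μ γ₁ γ₂ ε)) := by
      have h5 := F.hasSum_coe_tensor hε T₀
      simp only [← kernelFun_coe] at h5
      exact Tendsto.congr (e _) h5
    have h6 := c1.continuousAt.tendsto.comp (tendsto_sub_nhds_zero_iff.2 h4)
    rwa [h0 hsc] at h6
  filter_upwards [h3.eventually_lt_const (show 0 < η / 3 by linarith)] with t ht
  rw [e, Real.dist_0_eq_abs, abs_of_nonneg (completionSeminorm_nonneg hsc _)]
  have e2 : ((P t T : ProjTensor _ _) : ConeKernelSpace n μ γ₁ γ₂ ε) - T =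
      (P t (T - T₀) : ProjTensor _ _) + (((P t T₀ : ProjTensor _ _) - T₀) + (T₀ - T)) := by
    rw [hPsub, UniformSpace.Completion.coe_sub]; abel
  rw [e2]
  refine (completionSeminorm_add_le hsc _ _).trans_lt ?_
  have h4 := completionSeminorm_add_le hsc (((P t T₀ : ProjTensor _ _) - T₀)) (T₀ - T)
  have h5 := hPs t (T - T₀)
  rw [completionSeminorm_coe hsc]
  linarith

end ConeFrame

/-! ### The kernel of a Green operator -/

namespace ConeFrame

variable {n : ℕ} {X : Type*} [TopologicalSpace X] [ChartedSpace (EuclideanSpace ℝ (Fin n)) X]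
  [IsManifold (𝓡 n) ∞ X] [MeasurableSpace X] [BorelSpace X] {μ : Measure X}
  (F : ConeFrame n μ) {γ γ' ε : ℝ}

theorem dual_memLp_neg (γ : ℝ) (l : F.J) : MemLp (F.dual (-γ) l) 2 (coneMeasure n μ γ) := by
  have := F.dual_memLp (-γ) l
  rwa [neg_neg] at this

/-- The dual functions as elements of `K^{0,γ}`. -/
def dualLp (γ : ℝ) (l : F.J) : ConeL2 n μ γ := (F.dual_memLp_neg γ l).toLp _

/-- The complex conjugates of the dual functions as elements of `K^{0,-γ}`. -/
def conjDualLp (γ : ℝ) (j : F.J) : ConeL2 n μ (-γ) := (F.dual_memLp γ (F.neg j)).toLp _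

theorem exists_norm_dualLp_le (γ : ℝ) : ∃ C : ℝ, ∀ l, ‖F.dualLp γ l‖ ≤ C := by
  obtain ⟨C, hC⟩ := F.dual_bound (-γ)
  refine ⟨C, fun l => ?_⟩
  have := hC l
  rw [neg_neg] at this
  rwa [dualLp, Lp.norm_toLp]

theorem exists_norm_conjDualLp_le (γ : ℝ) : ∃ C : ℝ, ∀ l, ‖F.conjDualLp γ l‖ ≤ C := by
  obtain ⟨C, hC⟩ := F.dual_bound γ
  refine ⟨C, fun l => ?_⟩
  rw [conjDualLp, Lp.norm_toLp]
  exact hC _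

variable [IsFiniteMeasure μ]

/-- The frame coefficients of the kernel of a Green operator. -/
def greenCoef (A : GreenOp n μ γ γ' ε) (x : F.J × F.J) : ℂ :=
  coneFunctional (F.dual_memLp γ' x.1) (A.op (F.dualLp γ x.2))

/-- Frame coefficients are bilinear, the adjoint is defined by a sesquilinear pairing. Conjugation
permutes the dual functions through `neg`, and this reconciles the two. -/
theorem coneFunctional_dual_eq (w : ConeL2 n μ γ) (j : F.J) :
    coneFunctional (F.dual_memLp γ j) w = conePairing w (F.conjDualLp γ j) := by
  rw [coneFunctional_apply, conePairing]
  refine integral_congr_ae ?_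
  filter_upwards [(coneMeasure_ac_coneMeasure n μ 0 (-γ)).ae_le
    (F.dual_memLp γ (F.neg j)).coeFn_toLp] with z hz
  rw [conjDualLp, hz, F.dual_neg, Complex.conj_conj]

/-- The same matrix entry, read as a coefficient of an image of the adjoint: this is the source of
decay in the second index. -/
theorem greenCoef_eq_adj (A : GreenOp n μ γ γ' ε) (x : F.J × F.J) :
    F.greenCoef A x =
      conj (coneFunctional (F.dual_memLp (-γ) (F.neg x.2)) (A.adj (F.conjDualLp γ' x.1))) := by
  rw [greenCoef, coneFunctional_dual_eq, A.adj_spec, coneFunctional_apply, ← integral_conj,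
    conePairing]
  refine integral_congr_ae ?_
  filter_upwards [(coneMeasure_ac_coneMeasure n μ 0 γ).ae_le
    (F.dual_memLp_neg γ x.2).coeFn_toLp] with z hz
  rw [dualLp, hz, F.dual_neg, map_mul, Complex.conj_conj, mul_comm]

theorem greenCoef_eq_coef (A : GreenOp n μ γ γ' ε) (x : F.J × F.J) :
    F.greenCoef A x = F.coef γ' x.1 (A.toSchwartz (F.dualLp γ x.2)).toFun :=
  F.coef_eq_of_ae (A.toSchwartz_spec _) _

theorem greenCoef_eq_conj_coef (A : GreenOp n μ γ γ' ε) (x : F.J × F.J) :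
    F.greenCoef A x =
      conj (F.coef (-γ) (F.neg x.2) (A.adjToSchwartz (F.conjDualLp γ' x.1)).toFun) := by
  rw [greenCoef_eq_adj, F.coef_eq_of_ae (A.adjToSchwartz_spec _)]

theorem coef_sub (hε : 0 < ε) (j : F.J) (u v : ConeSchwartz n μ γ ε) :
    F.coef γ j (u - v).toFun = F.coef γ j u.toFun - F.coef γ j v.toFun := by
  rw [F.coef_toL2 hε, F.coef_toL2 hε, F.coef_toL2 hε, map_sub, map_sub]

/-- The geometric mean of two one-sided bounds. -/
theorem mul_rate_le {c : ℝ} (hc : 0 ≤ c) {δ : ℝ} {N : ℕ} {B : ℝ} (x : F.J × F.J)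
    (h1 : c * F.rate (δ + δ) (N + N) x.1 ≤ B) (h2 : c * F.rate (δ + δ) (N + N) x.2 ≤ B) :
    c * (F.rate δ N x.1 * F.rate δ N x.2) ≤ B := by
  have r1 := F.rate_pos δ N x.1
  have r2 := F.rate_pos δ N x.2
  rw [F.rate_add] at h1 h2
  have hB : 0 ≤ B := le_trans (by positivity) h1
  refine abs_le_of_sq_le_sq' ?_ hB |>.2
  calc (c * (F.rate δ N x.1 * F.rate δ N x.2)) ^ 2
      = (c * (F.rate δ N x.1 * F.rate δ N x.1)) * (c * (F.rate δ N x.2 * F.rate δ N x.2)) := by ring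
    _ ≤ B * B := mul_le_mul h1 h2 (by positivity) hB
    _ = B ^ 2 := (sq B).symm

/-- For each `u` the weighted coefficients of `A u` are bounded in `j`, because `A u` lies in S^γ_ε.
Each of them is a bounded functional on a Banach space, so Banach–Steinhaus gives a bound uniform in
`u`, without first proving that `A` is continuous into the Fréchet space. -/
theorem exists_functional_bound {δ : ℝ} {N : ℕ} (hδ : 0 ≤ δ) (hδ' : δ < ε) {V : Type*}
    [NormedAddCommGroup V] [NormedSpace ℂ V] [CompleteSpace V] (A : V →L[ℂ] ConeL2 n μ γ)
    (hA : ∀ u, InConeSchwartz ε (A u)) :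
    ∃ C, ∀ u j, ‖coneFunctional (F.dual_memLp γ j) (A u)‖ * F.rate δ N j ≤ C * ‖u‖ := by
  obtain ⟨q, hq, hq'⟩ := F.coef_bound γ ε δ N hδ hδ'
  let L : F.J → V →L[ℂ] ℂ := fun j =>
    ((F.rate δ N j : ℝ) : ℂ) • (coneFunctional (F.dual_memLp γ j)).comp A
  have hL : ∀ j u, ‖L j u‖ = ‖coneFunctional (F.dual_memLp γ j) (A u)‖ * F.rate δ N j := by
    intro j u
    change ‖((F.rate δ N j : ℝ) : ℂ) • coneFunctional (F.dual_memLp γ j) (A u)‖ = _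
    rw [norm_smul, Complex.norm_real, Real.norm_of_nonneg (F.rate_pos _ _ _).le, mul_comm]
  obtain ⟨C, hC⟩ := banach_steinhaus (g := L) (fun u => by
    obtain ⟨f, hf⟩ := hA u
    refine ⟨q f, fun j => ?_⟩
    rw [hL, F.coef_eq_of_ae hf]
    exact hq' f j)
  refine ⟨C, fun u j => ?_⟩
  rw [← hL]
  exact (L j).le_of_opNorm_le (hC j) u

/-- The origin of ε/2. Decay of rate 2δ in the first index comes from `A`, in the second from the
adjoint, and the geometric mean is decay of rate δ in both; the one-sided bounds require 2δ < ε. -/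
theorem exists_greenCoef_bound (A : GreenOp n μ γ γ' ε) {δ : ℝ} (N : ℕ) (hδ : 0 ≤ δ)
    (hδ' : δ < ε / 2) :
    ∃ B, ∀ x, ‖F.greenCoef A x‖ * (F.rate δ N x.1 * F.rate δ N x.2) ≤ B := by
  obtain ⟨C₁, h₁⟩ := F.exists_functional_bound (N := N + N) (add_nonneg hδ hδ)
    (show δ + δ < ε by linarith) A.op A.2.1
  obtain ⟨C₂, h₂⟩ := F.exists_functional_bound (N := N + N) (add_nonneg hδ hδ)
    (show δ + δ < ε by linarith) A.adj A.2.2.choose_spec.2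
  obtain ⟨D₁, hD₁⟩ := F.exists_norm_dualLp_le γ
  obtain ⟨D₂, hD₂⟩ := F.exists_norm_conjDualLp_le γ'
  refine ⟨max (|C₁| * D₁) (|C₂| * D₂), fun x => F.mul_rate_le (norm_nonneg _) x ?_ ?_⟩
  · refine ((h₁ _ _).trans ?_).trans (le_max_left _ _)
    exact mul_le_mul (le_abs_self _) (hD₁ _) (norm_nonneg _) (abs_nonneg _)
  · refine le_trans ?_ (le_max_right _ _)
    rw [greenCoef_eq_adj, RCLike.norm_conj, ← F.rate_neg]
    refine (h₂ _ _).trans ?_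
    exact mul_le_mul (le_abs_self _) (hD₂ _) (norm_nonneg _) (abs_nonneg _)

theorem summable_greenCoef (hε : 0 < ε) (A : GreenOp n μ γ γ' ε) :
    Summable fun x => ((F.greenCoef A x • F.tens γ' (-γ) (ε / 2) x : ProjTensor _ _) :
      ConeKernelSpace n μ γ' (-γ) (ε / 2)) := by
  refine summable_completion (projSeminorms_withSeminorms _ _) fun s => ?_
  obtain ⟨δ, N, b, hδ, hδ', hb, hb0, h⟩ := F.exists_tmul_bound (half_pos hε) s.2
  obtain ⟨B, hB⟩ := F.exists_greenCoef_bound A N hδ hδ'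
  refine Summable.of_nonneg_of_le (fun x => apply_nonneg _ _) (fun x => ?_) (hb.mul_left B)
  refine (map_smul_eq_mul s.1 _ _).le.trans ?_
  refine (mul_le_mul_of_nonneg_left (h x) (norm_nonneg _)).trans ?_
  rw [← mul_assoc]
  exact mul_le_mul_of_nonneg_right (hB x) (hb0 x)

/-- The map that sends a Green operator to its kernel. -/
def kernelMap (hε : 0 < ε) : GreenOp n μ γ γ' ε →ₗ[ℂ] ConeKernelSpace n μ γ' (-γ) (ε / 2) where
  toFun A := ∑' x, ((F.greenCoef A x • F.tens γ' (-γ) (ε / 2) x : ProjTensor _ _) :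
    ConeKernelSpace n μ γ' (-γ) (ε / 2))
  map_add' A B := by
    rw [← (F.summable_greenCoef hε A).tsum_add (F.summable_greenCoef hε B)]
    refine tsum_congr fun x => ?_
    rw [← UniformSpace.Completion.coe_add, ← add_smul]
    congr 2
    exact map_add (coneFunctional (F.dual_memLp γ' x.1)) _ _
  map_smul' c A := by
    rw [RingHom.id_apply, ← (F.summable_greenCoef hε A).tsum_const_smul c]
    refine tsum_congr fun x => ?_
    rw [← UniformSpace.Completion.coe_smul, ← smul_assoc]
    congr 2
    exact map_smul (coneFunctional (F.dual_memLp γ' x.1)) _ _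

theorem hasSum_kernelMap (hε : 0 < ε) (A : GreenOp n μ γ γ' ε) :
    HasSum (fun x => ((F.greenCoef A x • F.tens γ' (-γ) (ε / 2) x : ProjTensor _ _) :
      ConeKernelSpace n μ γ' (-γ) (ε / 2))) (F.kernelMap hε A) :=
  (F.summable_greenCoef hε A).hasSum

/-- Continuity into the topology of uniform convergence, unpacked for one seminorm `q` and one set
`S` of the family. -/
theorem eventually_seminorm_lt {V α : Type*} {𝔖 : Set (Set V)} {S : Set V} (hS : S ∈ 𝔖)
    [TopologicalSpace α] {f : α → V → ConeSchwartz n μ γ ε}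
    (hf : Continuous fun a => UniformOnFun.ofFun 𝔖 (f a)) {q : Seminorm ℂ (ConeSchwartz n μ γ ε)}
    (hq : Continuous q) {η : ℝ} (hη : 0 < η) (a₀ : α) :
    ∀ᶠ a in 𝓝 a₀, ∀ v ∈ S, q (f a v - f a₀ v) < η := by
  have h := UniformOnFun.tendsto_iff_tendstoUniformlyOn.1 (hf.tendsto a₀) S hS
  have hg : IsUniformAddGroup (ConeSchwartz n μ γ ε) := isUniformAddGroup_of_addCommGroup
  have hU : {x : ConeSchwartz n μ γ ε × ConeSchwartz n μ γ ε | q (x.2 - x.1) < η} ∈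
      uniformity (ConeSchwartz n μ γ ε) := by
    rw [uniformity_eq_comap_nhds_zero]
    refine ⟨{u | q u < η}, (isOpen_lt hq continuous_const).mem_nhds (by simpa using hη),
      fun x hx => hx⟩
  exact h _ hU

/-- The dual functions and their conjugates lie in fixed balls, which are bounded sets. Nearness of
`A` to `A₀` therefore controls all coefficients of `A - A₀` at once, in the first index through the
operator and in the second through the adjoint, and the geometric mean is again summable against
`b`. -/
theorem continuous_kernelMap (hε : 0 < ε) :
    Continuous (F.kernelMap (n := n) (μ := μ) (γ := γ) (γ' := γ') hε) := by
  rw [continuous_iff_continuousAt]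
  intro A₀
  refine tendsto_completion_of_seminorms (projSeminorms_withSeminorms _ _) fun s => ?_
  have hsc := (projSeminorms_withSeminorms (ConeSchwartz n μ γ' (ε / 2))
    (ConeSchwartz n μ (-γ) (ε / 2))).continuous_seminorm s
  obtain ⟨δ, N, b, hδ, hδ', hb, hb0, h⟩ := F.exists_tmul_bound (half_pos hε) s.2
  obtain ⟨q₁, hq₁, h₁⟩ := F.coef_bound γ' ε (δ + δ) (N + N) (add_nonneg hδ hδ) (by linarith)
  obtain ⟨q₂, hq₂, h₂⟩ := F.coef_bound (-γ) ε (δ + δ) (N + N) (add_nonneg hδ hδ) (by linarith)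
  obtain ⟨D₁, hD₁⟩ := F.exists_norm_dualLp_le γ
  obtain ⟨D₂, hD₂⟩ := F.exists_norm_conjDualLp_le γ'
  rw [Metric.tendsto_nhds]
  intro η hη
  set B := ∑' x, b x
  have hB : 0 ≤ B := tsum_nonneg hb0
  -- The final bound is `η / (B + 1) * B`, which is strictly below `η` even if `B = 0`.
  have hη' : 0 < η / (B + 1) := by positivity
  have c₁ : Continuous fun A : GreenOp n μ γ γ' ε =>
      UniformOnFun.ofFun {S : Set (ConeL2 n μ γ) | Bornology.IsBounded S} A.toSchwartz :=
    continuous_iff_le_induced.2 inf_le_left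
  have c₂ : Continuous fun A : GreenOp n μ γ γ' ε =>
      UniformOnFun.ofFun {S : Set (ConeL2 n μ (-γ')) | Bornology.IsBounded S} A.adjToSchwartz :=
    continuous_iff_le_induced.2 inf_le_right
  have e₁ := eventually_seminorm_lt (𝔖 := {S : Set (ConeL2 n μ γ) | Bornology.IsBounded S})
    (S := Metric.closedBall 0 D₁) (by rw [Set.mem_ofPred_eq]; exact Metric.isBounded_closedBall)
    (f := fun A : GreenOp n μ γ γ' ε =>
      A.toSchwartz) c₁ hq₁ hη' A₀
  have e₂ := eventually_seminorm_lt (𝔖 := {S : Set (ConeL2 n μ (-γ')) | Bornology.IsBounded S})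
    (S := Metric.closedBall 0 D₂) (by rw [Set.mem_ofPred_eq]; exact Metric.isBounded_closedBall)
    (f := fun A : GreenOp n μ γ γ' ε =>
      A.adjToSchwartz) c₂ hq₂ hη' A₀
  filter_upwards [e₁, e₂] with A hA hA'
  rw [Real.dist_0_eq_abs, abs_of_nonneg (completionSeminorm_nonneg hsc _)]
  have hsum := (F.hasSum_kernelMap hε A).sub (F.hasSum_kernelMap hε A₀)
  simp only [← UniformSpace.Completion.coe_sub, ← sub_smul] at hsum
  have hle := completionSeminorm_le_of_hasSum hsc hsum (hb.hasSum.mul_left (η / (B + 1)))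
    (fun x => by
      refine (map_smul_eq_mul s.1 _ _).le.trans ?_
      refine (mul_le_mul_of_nonneg_left (h x) (norm_nonneg _)).trans ?_
      rw [← mul_assoc]
      refine mul_le_mul_of_nonneg_right (F.mul_rate_le (norm_nonneg _) x ?_ ?_) (hb0 x)
      · rw [greenCoef_eq_coef, greenCoef_eq_coef, ← F.coef_sub hε]
        exact (h₁ _ _).trans (hA _ (by simpa using hD₁ x.2)).le
      · rw [greenCoef_eq_conj_coef, greenCoef_eq_conj_coef, ← map_sub, RCLike.norm_conj,
          ← F.coef_sub hε, ← F.rate_neg]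
        exact (h₂ _ _).trans (hA' _ (by simpa using hD₂ x.1)).le)
  refine hle.trans_lt ?_
  rw [div_mul_eq_mul_div, div_lt_iff₀ (by positivity)]
  nlinarith

theorem kernelFunctional_congr {γ₁ γ₂ : ℝ} {a b b' : ℝ × X → ℂ}
    (ha : MemLp a 2 (coneMeasure n μ (-γ₁))) (hb : MemLp b 2 (coneMeasure n μ (-γ₂)))
    (hb' : MemLp b' 2 (coneMeasure n μ (-γ₂))) (h : b =ᵐ[coneMeasure n μ (-γ₂)] b')
    (κ : Lp ℂ 2 ((coneMeasure n μ γ₁).prod (coneMeasure n μ γ₂))) :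
    kernelFunctional ha hb κ = kernelFunctional ha hb' κ := by
  rw [kernelFunctional_apply, kernelFunctional_apply]
  refine integral_congr_ae ?_
  filter_upwards [Measure.quasiMeasurePreserving_snd.ae
    ((coneMeasure_ac_coneMeasure n μ 0 (-γ₂)).ae_le h)] with q hq
  rw [hq]

/-- The weak identity tested with dual functions in both variables leaves no freedom for the
coefficients of a kernel of `A`. -/
theorem kernelCoef_of_isIntegralOperator {A : GreenOp n μ γ γ' ε}
    {κ : Lp ℂ 2 ((coneMeasure n μ γ').prod (coneMeasure n μ (-γ)))}
    (h : IsIntegralOperator A.op κ) (x : F.J × F.J) : F.kernelCoef x κ = F.greenCoef A x := by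
  rw [greenCoef, (isIntegralOperator_iff A.op κ).1 h, kernelCoef]
  refine (kernelFunctional_congr _ _ _ ?_ κ).symm
  have := (F.dual_memLp_neg γ x.2).coeFn_toLp
  rw [neg_neg]
  exact this

theorem op_eq_toL2 (hε : 0 < ε) (A : GreenOp n μ γ γ' ε) (u : ConeL2 n μ γ) :
    A.op u = toL2 hε (A.toSchwartz u) :=
  Lp.ext ((A.toSchwartz_spec u).trans (toL2_ae hε _).symm)

theorem adj_eq_toL2 (hε : 0 < ε) (A : GreenOp n μ γ γ' ε) (v : ConeL2 n μ (-γ')) :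
    A.adj v = toL2 hε (A.adjToSchwartz v) :=
  Lp.ext ((A.adjToSchwartz_spec v).trans (toL2_ae hε _).symm)

theorem coneFunctional_toL2 (hε : 0 < ε) {a : ℝ × X → ℂ} (ha : MemLp a 2 (coneMeasure n μ (-γ)))
    (u : ConeSchwartz n μ γ ε) :
    coneFunctional ha (toL2 hε u) = ∫ z, u.toFun z * a z ∂coneMeasure n μ 0 := by
  rw [coneFunctional_apply]
  refine integral_congr_ae ?_
  filter_upwards [(coneMeasure_ac_coneMeasure n μ 0 γ).ae_le (toL2_ae hε u)] with z hz
  rw [hz]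

theorem hasSum_coneFunctional (hε : 0 < ε) {a : ℝ × X → ℂ}
    (ha : MemLp a 2 (coneMeasure n μ (-γ))) (u : ConeSchwartz n μ γ ε) :
    HasSum (fun j => F.coef γ j u.toFun * ∫ z, F.elem γ j z * a z ∂coneMeasure n μ 0)
      (coneFunctional ha (toL2 hε u)) := by
  have h := (F.hasSum_coef hε u).mapL ((coneFunctional ha).comp (toL2 hε))
  refine (congrArg (HasSum · _) (funext fun l => ?_)).mpr h
  rw [map_smul, smul_eq_mul, ContinuousLinearMap.comp_apply, coneFunctional_toL2]
  rfl

/-- The image under the adjoint of the conjugate of the `j`-th dual function lies in S^{-γ}_ε and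
has a frame expansion there. Pairing it with `u`, which is merely square integrable, yields the
`j`-th coefficient of `A u`. -/
theorem hasSum_greenCoef_left (hε : 0 < ε) (A : GreenOp n μ γ γ' ε) (u : ConeL2 n μ γ) (j : F.J) :
    HasSum (fun l => F.greenCoef A (j, l) * ∫ z, F.elem (-γ) l z * u z ∂coneMeasure n μ 0)
      (coneFunctional (F.dual_memLp γ' j) (A.op u)) := by
  have h := F.hasSum_coneFunctional hε (memLp_neg_neg u).star (A.adjToSchwartz (F.conjDualLp γ' j))
  have h2 := Complex.hasSum_conj'.2 h
  -- Complex conjugation sends the term with index `l` to the one with index `neg l`; reindexing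
  -- restores the order.
  rw [← F.neg.hasSum_iff] at h2
  have e : coneFunctional (F.dual_memLp γ' j) (A.op u) =
      conj (coneFunctional (memLp_neg_neg u).star
        (toL2 hε (A.adjToSchwartz (F.conjDualLp γ' j)))) := by
    rw [coneFunctional_dual_eq, A.adj_spec, ← adj_eq_toL2, coneFunctional_apply, ← integral_conj,
      conePairing]
    refine integral_congr_ae (ae_of_all _ fun z => ?_)
    simp [mul_comm]
  rw [e]
  refine (congrArg (HasSum · _) (funext fun l => ?_)).mpr h2
  simp only [Function.comp, map_mul]
  rw [← F.greenCoef_eq_conj_coef A (j, l), ← integral_conj]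
  congr 1
  refine integral_congr_ae (ae_of_all _ fun z => ?_)
  simp [F.elem_neg]

/-- It suffices to verify the weak identity. There the kernel becomes a double series of products;
the sum over the second index is a coefficient of `A u`, by the expansion on the adjoint side, and
the sum over the first is then the expansion of `A u` itself. -/
theorem isIntegralOperator_kernelMap (hε : 0 < ε) (A : GreenOp n μ γ γ' ε) :
    IsIntegralOperator A.op (kernelFun (half_pos hε) (F.kernelMap hε A)) := by
  rw [isIntegralOperator_iff]
  intro u a ha
  let K : ConeKernelSpace n μ γ' (-γ) (ε / 2) →+
      Lp ℂ 2 ((coneMeasure n μ γ').prod (coneMeasure n μ (-γ))) :=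
    AddMonoidHom.ofMapSub (kernelFun (half_pos hε)) (kernelFun_sub (half_pos hε))
  have h1 := ((F.hasSum_kernelMap hε A).map K (continuous_kernelFun (half_pos hε))).mapL
    (kernelFunctional ha (memLp_neg_neg u))
  have h2 : HasSum (fun x : F.J × F.J => F.greenCoef A x *
      ((∫ z, F.elem γ' x.1 z * a z ∂coneMeasure n μ 0) *
        ∫ z, F.elem (-γ) x.2 z * u z ∂coneMeasure n μ 0))
      (kernelFunctional ha (memLp_neg_neg u) (kernelFun (half_pos hε) (F.kernelMap hε A))) := by
    refine (congrArg (HasSum · _) (funext fun x => ?_)).mpr h1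
    change _ = kernelFunctional ha (memLp_neg_neg u) (kernelFun (half_pos hε) _)
    rw [kernelFun_coe, map_smul, map_smul, tens, tensorFun_tmul, smul_eq_mul]
    congr 1
    exact (kernelFunctional_tensor ha (memLp_neg_neg u) ((F.elt γ' (ε / 2) x.1).memLp (half_pos hε))
      ((F.elt (-γ) (ε / 2) x.2).memLp (half_pos hε))).symm
  have h3 : HasSum (fun j => coneFunctional (F.dual_memLp γ' j) (A.op u) *
      ∫ z, F.elem γ' j z * a z ∂coneMeasure n μ 0)
      (kernelFunctional ha (memLp_neg_neg u) (kernelFun (half_pos hε) (F.kernelMap hε A))) := by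
    refine h2.prod_fiberwise fun j => ?_
    have h4 := (F.hasSum_greenCoef_left hε A u j).mul_right
      (∫ z, F.elem γ' j z * a z ∂coneMeasure n μ 0)
    refine (congrArg (HasSum · _) (funext fun l => ?_)).mpr h4
    simp only; ring
  have h5 := F.hasSum_coneFunctional hε ha (A.toSchwartz u)
  rw [← op_eq_toL2] at h5
  refine h5.unique ?_
  refine (congrArg (HasSum · _) (funext fun l => ?_)).mpr h3
  rw [F.coef_eq_of_ae (A.toSchwartz_spec u)]

/-- For uniqueness, `k` is the sum of its own frame expansion, and the coefficients of that
expansion are forced to be those of `A`. -/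
theorem isIntegralOperator_iff_eq_kernelMap (hε : 0 < ε) (A : GreenOp n μ γ γ' ε)
    (k : ConeKernelSpace n μ γ' (-γ) (ε / 2)) :
    IsIntegralOperator A.op (kernelFun (half_pos hε) k) ↔ k = F.kernelMap hε A := by
  constructor
  · intro h
    have h1 := F.hasSum_kernel (half_pos hε) k
    simp only [F.kernelCoef_of_isIntegralOperator h] at h1
    exact h1.unique (F.hasSum_kernelMap hε A)
  · rintro rfl
    exact F.isIntegralOperator_kernelMap hε A

end ConeFrame

/-! ### Fourier series of functions supported in the unit cube -/

section FourierBox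

open UnitAddTorus

/-- The representative of a point of the torus in the cube `(-1/2, 1/2]^d`. -/
def torusRep {d : Type*} (τ : UnitAddTorus d) : d → ℝ :=
  fun i => (AddCircle.equivIoc (1 : ℝ) (-1 / 2) (τ i)).1

theorem torusRep_coe {d : Type*} {v : d → ℝ} (hv : ∀ i, v i ∈ Ioc (-1 / 2 : ℝ) (-1 / 2 + 1)) :
    torusRep (fun i => (v i : UnitAddCircle)) = v := by
  ext i
  exact congrArg Subtype.val (AddCircle.equivIoc_coe_eq (hv i))

theorem coe_torusRep {d : Type*} (τ : UnitAddTorus d) :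
    (fun i => (torusRep τ i : UnitAddCircle)) = τ := by
  ext i
  exact (AddCircle.equivIoc (1 : ℝ) (-1 / 2)).symm_apply_apply (τ i)

/-- The representative jumps only where some coordinate is the class of 1/2. The support condition
makes the periodised function vanish near all such points. -/
theorem continuous_comp_torusRep {d : Type*} [Fintype d] {G : (d → ℝ) → ℂ} (hG : Continuous G)
    (h0 : ∀ v, G v ≠ 0 → ∀ i, |v i| ≤ 3 / 8) : Continuous fun τ => G (torusRep τ) := by
  rw [continuous_iff_continuousAt]
  intro τ
  by_cases h : ∃ i, τ i = ((-1 / 2 : ℝ) : UnitAddCircle)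
  · obtain ⟨i, hi⟩ := h
    set C : Set UnitAddCircle := (fun r : ℝ => (r : UnitAddCircle)) '' Icc (-(3 / 8)) (3 / 8)
    have hC : IsClosed C :=
      (isCompact_Icc.image (AddCircle.continuous_mk' (1 : ℝ))).isClosed
    have hz : ∀ σ : UnitAddTorus d, σ i ∉ C → G (torusRep σ) = 0 := by
      intro σ hσ
      by_contra hne
      refine hσ ⟨torusRep σ i, abs_le.1 (h0 _ hne i), ?_⟩
      exact congrFun (coe_torusRep σ) i
    -- In the half-open cube the class of -1/2 is represented by 1/2, which exceeds 3/8.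
    have hτ : τ i ∉ C := by
      rintro ⟨r, hr, hr'⟩
      rw [hi] at hr'
      have h1 : r ∈ Ioc (-1 / 2 : ℝ) (-1 / 2 + 1) := ⟨by linarith [hr.1], by linarith [hr.2]⟩
      have h2 : (1 / 2 : ℝ) ∈ Ioc (-1 / 2 : ℝ) (-1 / 2 + 1) := by constructor <;> norm_num
      have h3 : ((-1 / 2 : ℝ) : UnitAddCircle) = ((1 / 2 : ℝ) : UnitAddCircle) := by
        have h5 : (-1 / 2 : ℝ) + 1 = 1 / 2 := by norm_num
        have h4 := AddCircle.coe_add_period (1 : ℝ) (-1 / 2 : ℝ)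
        rw [h5] at h4
        exact h4.symm
      rw [h3] at hr'
      have h4 := congrArg (AddCircle.equivIoc (1 : ℝ) (-1 / 2)) hr'
      have e1 := AddCircle.equivIoc_coe_eq (p := (1 : ℝ)) (a := -1 / 2) h1
      have e2 := AddCircle.equivIoc_coe_eq (p := (1 : ℝ)) (a := -1 / 2) h2
      have h5 : r = 1 / 2 := by
        have := e1.symm.trans (h4.trans e2)
        simpa using this
      linarith [hr.2]
    have hev : (fun σ => G (torusRep σ)) =ᶠ[𝓝 τ] fun _ => 0 := by
      filter_upwards [(hC.isOpen_compl.preimage (continuous_apply i)).mem_nhds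
        (show τ ∈ (fun σ : UnitAddTorus d => σ i) ⁻¹' Cᶜ from by simpa using hτ)] with σ hσ
      exact hz σ (by simpa using hσ)
    exact continuousAt_const.congr hev.symm
  · push Not at h
    refine hG.continuousAt.comp ?_
    refine continuousAt_pi.2 fun i => ?_
    have h1 : ContinuousAt (fun σ : UnitAddTorus d => σ i) τ := (continuous_apply i).continuousAt
    exact continuous_subtype_val.continuousAt.comp
      (ContinuousAt.comp (f := fun σ : UnitAddTorus d => σ i)
        (AddCircle.continuousAt_equivIoc (1 : ℝ) (-1 / 2) (h i)) h1)

theorem mFourier_coe {d : Type*} [Fintype d] (k : d → ℤ) (v : d → ℝ) :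
    mFourier k (fun i => (v i : UnitAddCircle)) =
      Complex.exp (2 * Real.pi * Complex.I * ∑ i, (k i : ℂ) * v i) := by
  simp only [mFourier, ContinuousMap.coe_mk]
  rw [Finset.mul_sum, Complex.exp_sum]
  refine Finset.prod_congr rfl fun i _ => ?_
  rw [fourier_coe_apply]
  congr 1
  push_cast
  ring

/-- Fourier expansion of a continuous function supported inside the unit cube. -/
theorem hasSum_fourier_cube {d : Type*} [Fintype d] {G : (d → ℝ) → ℂ} (hG : Continuous G)
    (h0 : ∀ v, G v ≠ 0 → ∀ i, |v i| ≤ 3 / 8)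
    (hs : Summable fun k : d → ℤ =>
      ∫ v, G v * Complex.exp (-(2 * Real.pi * Complex.I * ∑ i, (k i : ℂ) * v i)))
    {v₀ : d → ℝ} (hv : ∀ i, |v₀ i| < 1 / 2) :
    HasSum (fun k : d → ℤ =>
      (∫ v, G v * Complex.exp (-(2 * Real.pi * Complex.I * ∑ i, (k i : ℂ) * v i))) *
        Complex.exp (2 * Real.pi * Complex.I * ∑ i, (k i : ℂ) * v₀ i)) (G v₀) := by
  have hmem : ∀ {v : d → ℝ}, (∀ i, |v i| < 1 / 2) →
      ∀ i, v i ∈ Ioc (-1 / 2 : ℝ) (-1 / 2 + 1) := fun {v} h i =>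
    ⟨by linarith [(abs_lt.1 (h i)).1], by linarith [(abs_lt.1 (h i)).2]⟩
  let f : C(UnitAddTorus d, ℂ) := ⟨fun τ => G (torusRep τ), continuous_comp_torusRep hG h0⟩
  have hc : ∀ k, mFourierCoeff f k =
      ∫ v, G v * Complex.exp (-(2 * Real.pi * Complex.I * ∑ i, (k i : ℂ) * v i)) := by
    intro k
    rw [mFourierCoeff_eq_integral _ _ (fun _ => (-1 / 2 : ℝ))]
    have hms : MeasurableSet {x : d → ℝ | ∀ i, x i ∈ Ioc (-1 / 2 : ℝ) (-1 / 2 + 1)} :=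
      MeasurableSet.univ_pi' fun i => measurableSet_Ioc
    rw [← integral_indicator hms]
    refine integral_congr_ae (ae_of_all _ fun v => ?_)
    simp only
    by_cases hv : v ∈ {x : d → ℝ | ∀ i, x i ∈ Ioc (-1 / 2 : ℝ) (-1 / 2 + 1)}
    · rw [indicator_of_mem hv, mFourier_coe, smul_eq_mul, mul_comm]
      congr 1
      · change G (torusRep _) = _
        rw [torusRep_coe hv]
      · simp
    · rw [indicator_of_notMem hv]
      by_contra hne
      have hGv : G v ≠ 0 := fun h => hne (by rw [h, zero_mul])
      exact hv (hmem fun i => lt_of_le_of_lt (h0 v hGv i) (by norm_num))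
  have h1 := hasSum_mFourier_series_apply_of_summable (f := f)
    (hs.congr fun k => (hc k).symm) (fun i => (v₀ i : UnitAddCircle))
  have h2 : f (fun i => (v₀ i : UnitAddCircle)) = G v₀ := by
    change G (torusRep _) = _
    rw [torusRep_coe (hmem hv)]
  rw [h2] at h1
  simpa only [hc, mFourier_coe, smul_eq_mul] using h1

/-- The phase `k₀ r + ∑ kₐ yₐ`. -/
def phase {n : ℕ} (k : ℤ × (Fin n → ℤ)) (r : ℝ) (y : EuclideanSpace ℝ (Fin n)) : ℝ :=
  k.1 * r + ∑ a, k.2 a * y a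

/-- The character `exp (2πi (k₀ r + ∑ kₐ yₐ))`. -/
def character {n : ℕ} (k : ℤ × (Fin n → ℤ)) (r : ℝ) (y : EuclideanSpace ℝ (Fin n)) : ℂ :=
  Complex.exp (2 * Real.pi * Complex.I * phase k r y)

theorem norm_character {n : ℕ} (k : ℤ × (Fin n → ℤ)) (r : ℝ) (y : EuclideanSpace ℝ (Fin n)) :
    ‖character k r y‖ = 1 := by
  rw [character, show 2 * (Real.pi : ℂ) * Complex.I * phase k r y =
    ((2 * Real.pi * phase k r y : ℝ) : ℂ) * Complex.I by push_cast; ring,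
    Complex.norm_exp_ofReal_mul_I]

theorem phase_neg {n : ℕ} (k : ℤ × (Fin n → ℤ)) (r : ℝ) (y : EuclideanSpace ℝ (Fin n)) :
    phase (-k) r y = -phase k r y := by
  simp only [phase, Prod.fst_neg, Prod.snd_neg, Pi.neg_apply, Int.cast_neg, neg_mul,
    Finset.sum_neg_distrib]
  ring

theorem character_neg {n : ℕ} (k : ℤ × (Fin n → ℤ)) (r : ℝ) (y : EuclideanSpace ℝ (Fin n)) :
    character (-k) r y = conj (character k r y) := by
  rw [character, character, ← Complex.exp_conj, phase_neg]
  simp [Complex.conj_ofReal, Complex.conj_ofNat]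

/-- `hasSum_fourier_cube` in dimension n + 1, transported by the measure preserving map that splits
off the first coordinate as the radial variable. -/
theorem hasSum_fourier_box {n : ℕ} {G : ℝ × EuclideanSpace ℝ (Fin n) → ℂ} (hG : Continuous G)
    (h0 : ∀ q, G q ≠ 0 → |q.1| ≤ 3 / 8 ∧ ∀ a, |q.2 a| ≤ 3 / 8)
    (hs : Summable fun k : ℤ × (Fin n → ℤ) => ∫ q, G q * character (-k) q.1 q.2)
    {r : ℝ} {y : EuclideanSpace ℝ (Fin n)} (hr : |r| < 1 / 2) (hy : ∀ a, |y a| < 1 / 2) :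
    HasSum (fun k : ℤ × (Fin n → ℤ) => (∫ q, G q * character (-k) q.1 q.2) * character k r y)
      (G (r, y)) := by
  let ι : (Fin (n + 1) → ℝ) → ℝ × EuclideanSpace ℝ (Fin n) :=
    fun v => (v 0, WithLp.toLp 2 fun a => v a.succ)
  have hι : MeasurePreserving ι := by
    have h1 := volume_preserving_piFinSuccAbove (fun _ : Fin (n + 1) => ℝ) 0
    have h2 := (MeasurePreserving.id (volume : Measure ℝ)).prod (PiLp.volume_preserving_toLp (Fin n))
    exact h2.comp h1
  have hιe : MeasurableEmbedding ι := by
    have h1 := (MeasurableEquiv.piFinSuccAbove (fun _ : Fin (n + 1) => ℝ) 0).measurableEmbedding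
    have h2 := ((MeasurableEquiv.refl ℝ).prodCongr
      (MeasurableEquiv.toLp 2 (Fin n → ℝ))).measurableEmbedding
    exact h2.comp h1
  have hιc : Continuous ι := by
    refine (continuous_apply 0).prodMk ((PiLp.continuous_toLp 2 _).comp ?_)
    exact continuous_pi fun a => continuous_apply _
  let κ : (Fin (n + 1) → ℤ) ≃ ℤ × (Fin n → ℤ) := (Fin.consEquiv fun _ => ℤ).symm
  have hκ : ∀ (k : Fin (n + 1) → ℤ) (v : Fin (n + 1) → ℝ),
      2 * Real.pi * Complex.I * ∑ i, (k i : ℂ) * v i =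
        2 * Real.pi * Complex.I * (phase (κ k) (ι v).1 (ι v).2 : ℝ) := by
    intro k v
    congr 1
    rw [Fin.sum_univ_succ, phase]
    push_cast
    rfl
  have hc : ∀ k : Fin (n + 1) → ℤ, ∫ v, G (ι v) *
      Complex.exp (-(2 * Real.pi * Complex.I * ∑ i, (k i : ℂ) * v i)) =
        ∫ q, G q * character (-κ k) q.1 q.2 := by
    intro k
    rw [← hι.integral_comp hιe]
    refine integral_congr_ae (ae_of_all _ fun v => ?_)
    simp only [hκ, character, phase_neg]
    push_cast
    ring_nf
  let v₀ : Fin (n + 1) → ℝ := Fin.cons r y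
  have hv₀ : ι v₀ = (r, y) := rfl
  have h := hasSum_fourier_cube (G := fun v => G (ι v)) (hG.comp hιc)
    (fun v hv i => by
      have := h0 _ hv
      refine Fin.cases this.1 (fun a => this.2 a) i)
    (by simp only [hc]; exact (κ.summable_iff (f := fun k => ∫ q, G q * character (-k) q.1 q.2)).2 hs)
    (v₀ := v₀) (fun i => by refine Fin.cases hr (fun a => hy a) i)
  simp only [hc] at h
  simp only [hκ, hv₀] at h
  exact (κ.hasSum_iff (f := fun k => (∫ q, G q * character (-k) q.1 q.2) * character k r y)).1 h

end FourierBox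

/-! ### Summation over frequencies -/

section Lattice

theorem summable_one_add_abs_sq_inv : Summable fun k : ℤ => ((1 + |(k : ℝ)|) ^ 2)⁻¹ := by
  have h : Summable fun k : ℕ => ((1 + |((k : ℤ) : ℝ)|) ^ 2)⁻¹ := by
    have h1 : Summable fun k : ℕ => (((k : ℝ) + 1) ^ 2)⁻¹ := by
      have := (summable_nat_add_iff 1).2 (Real.summable_nat_pow_inv.2 (one_lt_two : 1 < 2))
      exact_mod_cast this
    refine h1.congr fun k => ?_
    rw [Int.cast_natCast, Nat.abs_cast, add_comm]
  exact Summable.of_nat_of_neg h (by simpa using h)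

theorem summable_prod_one_add_abs_sq_inv (n : ℕ) :
    Summable fun k : Fin n → ℤ => ∏ a, ((1 + |(k a : ℝ)|) ^ 2)⁻¹ := by
  induction n with
  | zero => exact (hasSum_fintype _).summable
  | succ n ih =>
    rw [← (Fin.consEquiv fun _ : Fin (n + 1) => ℤ).summable_iff]
    refine (Summable.mul_of_nonneg summable_one_add_abs_sq_inv ih (fun k => by positivity)
      (fun k => by simp only [Pi.zero_apply]; positivity)).congr fun p => ?_
    simp [Fin.prod_univ_succ, Fin.consEquiv, mul_comm]

/-- The weight `1 + |k₀| + ∑ |kₐ|` of a frequency. -/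
def freqWeight {n : ℕ} (k : ℤ × (Fin n → ℤ)) : ℝ := 1 + |(k.1 : ℝ)| + ∑ a, |(k.2 a : ℝ)|

theorem one_le_freqWeight {n : ℕ} (k : ℤ × (Fin n → ℤ)) : 1 ≤ freqWeight k := by
  have : 0 ≤ ∑ a, |(k.2 a : ℝ)| := Finset.sum_nonneg fun a _ => abs_nonneg _
  unfold freqWeight
  linarith [abs_nonneg (k.1 : ℝ)]

theorem freqWeight_neg {n : ℕ} (k : ℤ × (Fin n → ℤ)) : freqWeight (-k) = freqWeight k := by
  simp [freqWeight]

theorem abs_snd_le_freqWeight {n : ℕ} (k : ℤ × (Fin n → ℤ)) (a : Fin n) :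
    |(k.2 a : ℝ)| ≤ freqWeight k := by
  have : |(k.2 a : ℝ)| ≤ ∑ a, |(k.2 a : ℝ)| :=
    Finset.single_le_sum (f := fun a => |(k.2 a : ℝ)|) (fun a _ => abs_nonneg _) (Finset.mem_univ a)
  unfold freqWeight
  linarith [abs_nonneg (k.1 : ℝ)]

/-- The weight dominates each 1 + |k_i|, so one square for each of the n + 1 coordinates reduces the
sum to a product of convergent one-dimensional series. -/
theorem summable_freqWeight_inv (n : ℕ) :
    Summable fun k : ℤ × (Fin n → ℤ) => (freqWeight k ^ (2 * (n + 1)))⁻¹ := by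
  refine Summable.of_nonneg_of_le (fun k => ?_) (fun k => ?_)
    (Summable.mul_of_nonneg summable_one_add_abs_sq_inv (summable_prod_one_add_abs_sq_inv n)
      (fun k => by positivity) (fun k => by simp only [Pi.zero_apply]; positivity))
  · have := one_le_freqWeight k
    positivity
  · have h1 := one_le_freqWeight k
    rw [Finset.prod_inv_distrib, ← mul_inv]
    refine inv_anti₀ (by positivity) ?_
    have h0 : 0 ≤ ∑ a, |(k.2 a : ℝ)| := Finset.sum_nonneg fun a _ => abs_nonneg _
    calc (1 + |(k.1 : ℝ)|) ^ 2 * ∏ a, (1 + |(k.2 a : ℝ)|) ^ 2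
        ≤ freqWeight k ^ 2 * ∏ _a : Fin n, freqWeight k ^ 2 := by
          refine mul_le_mul ?_ ?_ (by positivity) (by positivity)
          · refine pow_le_pow_left₀ (by positivity) ?_ 2
            unfold freqWeight; linarith
          · refine Finset.prod_le_prod (fun a _ => by positivity) fun a _ => ?_
            refine pow_le_pow_left₀ (by positivity) ?_ 2
            have : |(k.2 a : ℝ)| ≤ ∑ a, |(k.2 a : ℝ)| :=
              Finset.single_le_sum (f := fun a => |(k.2 a : ℝ)|) (fun a _ => abs_nonneg _)
                (Finset.mem_univ a)
            unfold freqWeight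
            linarith [abs_nonneg (k.1 : ℝ)]
      _ = freqWeight k ^ (2 * (n + 1)) := by
          rw [Finset.prod_const, Finset.card_univ, Fintype.card_fin]; ring

/-- If `b` is bounded by `C` after multiplication with each pure power of the frequency, then it is
bounded by a multiple of a power of the frequency weight. -/
theorem mul_freqWeight_pow_le {n : ℕ} (N : ℕ) (k : ℤ × (Fin n → ℤ)) {b C : ℝ}
    (hb : 0 ≤ b) (h : b ≤ C) (h0 : |(k.1 : ℝ)| ^ N * b ≤ C) (ha : ∀ a, |(k.2 a : ℝ)| ^ N * b ≤ C) :
    b * freqWeight k ^ N ≤ ((n : ℝ) + 2) ^ N * C := by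
  have hC : 0 ≤ C := hb.trans h
  -- The weight is a sum of n + 2 terms 1, |k₀|, |k_a|, so one of them is at least the (n + 2)-nd
  -- part of it, and for each of them the bound is available. The argument is by contradiction: the
  -- strict reverse inequalities would add up to weight < weight.
  obtain ⟨m, hm, hmb, hm0⟩ : ∃ m : ℝ, freqWeight k ≤ (n + 2) * m ∧ m ^ N * b ≤ C ∧ 0 ≤ m := by
    by_contra hcon
    push Not at hcon
    have key : ∀ m : ℝ, 0 ≤ m → m ^ N * b ≤ C → (n + 2) * m < freqWeight k := fun m hm hmb => by
      by_contra h'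
      exact absurd (hcon m (not_lt.1 h') hmb) (not_lt.2 hm)
    have k1 := key 1 zero_le_one (by simpa using h)
    have k2 := key _ (abs_nonneg _) h0
    have k3 : ∑ a : Fin n, (n + 2) * |(k.2 a : ℝ)| ≤ ∑ _a : Fin n, freqWeight k :=
      Finset.sum_le_sum fun a _ => (key _ (abs_nonneg _) (ha a)).le
    rw [← Finset.mul_sum, Finset.sum_const, Finset.card_univ, Fintype.card_fin, nsmul_eq_mul] at k3
    have : (n + 2) * freqWeight k = (n + 2) * (1 + |(k.1 : ℝ)| + ∑ a, |(k.2 a : ℝ)|) := rfl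
    nlinarith
  calc b * freqWeight k ^ N ≤ b * ((n + 2) * m) ^ N :=
        mul_le_mul_of_nonneg_left
          (pow_le_pow_left₀ (zero_le_one.trans (one_le_freqWeight k)) hm N) hb
    _ = ((n : ℝ) + 2) ^ N * (m ^ N * b) := by rw [mul_pow]; ring
    _ ≤ _ := mul_le_mul_of_nonneg_left hmb (by positivity)

end Lattice

/-! ### Calculus along vector fields on X -/

section Calculus

variable {n : ℕ} {X : Type*} [TopologicalSpace X] [ChartedSpace (EuclideanSpace ℝ (Fin n)) X]

/-- Smooth complex-valued functions on `X`. -/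
abbrev IsSmooth (n : ℕ) {X : Type*} [TopologicalSpace X]
    [ChartedSpace (EuclideanSpace ℝ (Fin n)) X] (f : X → ℂ) : Prop :=
  ContMDiff (𝓡 n) 𝓘(ℝ, ℂ) ∞ f

/-- The derivative of a function along a vector field. -/
def lieD (V : ∀ x : X, TangentSpace (𝓡 n) x) (f : X → ℂ) (x : X) : ℂ :=
  mfderiv (𝓡 n) 𝓘(ℝ, ℂ) f x (V x)

theorem mem_cone {t : ℝ} {x : X} (ht : 0 < t) : (t, x) ∈ cone X := ⟨mem_Ioi.2 ht, trivial⟩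

/-- Smooth vector fields on `X`. -/
abbrev IsSmoothField [IsManifold (𝓡 n) ∞ X] (V : ∀ x : X, TangentSpace (𝓡 n) x) : Prop :=
  ContMDiff (𝓡 n) (𝓡 n).tangent ∞ (fun x => (⟨x, V x⟩ : TangentBundle (𝓡 n) X))

theorem IsSmooth.mul {f g : X → ℂ} (hf : IsSmooth n f) (hg : IsSmooth n g) :
    IsSmooth n fun x => f x * g x := by
  have h : ContMDiff 𝓘(ℝ, ℂ × ℂ) 𝓘(ℝ, ℂ) ∞ (fun w : ℂ × ℂ => w.1 * w.2) :=
    (contDiff_fst.mul contDiff_snd).contMDiff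
  exact h.comp (hf.prodMk_space hg)

theorem IsSmooth.add {f g : X → ℂ} (hf : IsSmooth n f) (hg : IsSmooth n g) :
    IsSmooth n fun x => f x + g x := ContMDiff.add hf hg

theorem IsSmooth.exp {f : X → ℂ} (hf : IsSmooth n f) : IsSmooth n fun x => Complex.exp (f x) := by
  have h : ContMDiff 𝓘(ℝ, ℂ) 𝓘(ℝ, ℂ) ∞ Complex.exp := Complex.contDiff_exp.contMDiff
  exact h.comp hf

theorem IsSmooth.mdifferentiableAt {f : X → ℂ} (hf : IsSmooth n f) (x : X) :
    MDifferentiableAt (𝓡 n) 𝓘(ℝ, ℂ) f x :=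
  ContMDiffAt.mdifferentiableAt (hf x) (by simp)

variable [IsManifold (𝓡 n) ∞ X]

/-- A function on X is a function on the cone that does not depend on t; the statements on the cone
are applied to it and restricted to t = 1. The next two lemmas use the same device. -/
theorem IsDiffOp.isSmooth {D : (X → ℂ) → (X → ℂ)} (hD : IsDiffOp n D) {f : X → ℂ}
    (hf : IsSmooth n f) : IsSmooth n (D f) := by
  have h1 : SmoothOnCone n (fun z : ℝ × X => f z.2) := (hf.comp contMDiff_snd).contMDiffOn
  have h2 := hD.smoothOnCone h1
  have h3 : ContMDiff (𝓡 n) (𝓘(ℝ, ℝ).prod (𝓡 n)) ∞ (fun x : X => ((1 : ℝ), x)) :=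
    contMDiff_const.prodMk contMDiff_id
  exact contMDiffOn_univ.1 (h2.comp h3.contMDiffOn (s := univ) fun x _ =>
    mem_cone one_pos)

theorem IsDiffOp.add_apply {D : (X → ℂ) → (X → ℂ)} (hD : IsDiffOp n D) {f g : X → ℂ}
    (hf : IsSmooth n f) (hg : IsSmooth n g) : D (fun x => f x + g x) = fun x => D f x + D g x := by
  have h1 : SmoothOnCone n (fun z : ℝ × X => f z.2) := (hf.comp contMDiff_snd).contMDiffOn
  have h2 : SmoothOnCone n (fun z : ℝ × X => g z.2) := (hg.comp contMDiff_snd).contMDiffOn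
  ext x
  exact hD.map_add h1 h2 (mem_cone (t := 1) one_pos)

theorem IsDiffOp.smul_apply {D : (X → ℂ) → (X → ℂ)} (hD : IsDiffOp n D) (c : ℂ) {f : X → ℂ}
    (hf : IsSmooth n f) : D (fun x => c * f x) = fun x => c * D f x := by
  have h1 : SmoothOnCone n (fun z : ℝ × X => f z.2) := (hf.comp contMDiff_snd).contMDiffOn
  ext x
  exact hD.map_smul c h1 (mem_cone (t := 1) one_pos)

theorem IsSmooth.lieD {V : ∀ x : X, TangentSpace (𝓡 n) x} (hV : IsSmoothField V) {f : X → ℂ}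
    (hf : IsSmooth n f) : IsSmooth n (lieD V f) :=
  (IsDiffOp.vectorField V hV).isSmooth hf

/-- Local integral curves compute derivatives along a vector field. -/
theorem exists_curve {V : ∀ x : X, TangentSpace (𝓡 n) x} (hV : IsSmoothField V) (x : X) :
    ∃ (σ : ℝ → X) (r : ℝ), 0 < r ∧ σ 0 = x ∧ ∀ s ∈ Metric.ball (0 : ℝ) r, ∀ f : X → ℂ,
      MDifferentiableAt (𝓡 n) 𝓘(ℝ, ℂ) f (σ s) →
        HasDerivAt (fun s => f (σ s)) (lieD V f (σ s)) s := by
  have : IsManifold (𝓡 n) 1 X := IsManifold.of_le (n := ∞) (by simp)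
  obtain ⟨σ, h0, hσ⟩ := exists_isMIntegralCurveAt_of_contMDiffAt_boundaryless (I := 𝓡 n) (t₀ := 0)
    (v := V) (x₀ := x) ((hV x).of_le (by simp))
  obtain ⟨r, hr, h⟩ := Metric.eventually_nhds_iff_ball.1 hσ
  refine ⟨σ, r, hr, h0, fun s hs f hf => ?_⟩
  let L : EuclideanSpace ℝ (Fin n) →L[ℝ] ℂ := mfderiv (𝓡 n) 𝓘(ℝ, ℂ) f (σ s)
  let v : EuclideanSpace ℝ (Fin n) := V (σ s)
  have h1 : HasFDerivAt (fun s => f (σ s)) (L.comp ((1 : ℝ →L[ℝ] ℝ).smulRight v)) s :=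
    (hf.hasMFDerivAt.comp s (h s hs)).hasFDerivAt
  refine h1.hasDerivAt.congr_deriv ?_
  change _ = L v
  simp

/-- One curve through `x` serves all smooth functions, so sum, product and chain rules for `lieD`
follow from those for functions of one real variable. -/
theorem lieD_eq_of_curve {V : ∀ x : X, TangentSpace (𝓡 n) x} (hV : IsSmoothField V) (x : X) :
    ∃ σ : ℝ → X, σ 0 = x ∧ ∀ f : X → ℂ, IsSmooth n f →
        HasDerivAt (fun s => f (σ s)) (lieD V f x) 0 := by
  obtain ⟨σ, r, hr, h0, h⟩ := exists_curve hV x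
  refine ⟨σ, h0, fun f hf => ?_⟩
  have := h 0 (Metric.mem_ball_self hr) f (hf.mdifferentiableAt _)
  rwa [h0] at this

theorem lieD_mul {V : ∀ x : X, TangentSpace (𝓡 n) x} (hV : IsSmoothField V) {f g : X → ℂ}
    (hf : IsSmooth n f) (hg : IsSmooth n g) (x : X) :
    lieD V (fun y => f y * g y) x = lieD V f x * g x + f x * lieD V g x := by
  obtain ⟨σ, h0, h⟩ := lieD_eq_of_curve hV x
  have h1 := (h f hf).mul (h g hg)
  rw [h0] at h1
  exact (h _ (hf.mul hg)).unique h1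

theorem lieD_exp {V : ∀ x : X, TangentSpace (𝓡 n) x} (hV : IsSmoothField V) {f : X → ℂ}
    (hf : IsSmooth n f) (x : X) :
    lieD V (fun y => Complex.exp (f y)) x = Complex.exp (f x) * lieD V f x := by
  obtain ⟨σ, h0, h⟩ := lieD_eq_of_curve hV x
  have h1 := (h f hf).cexp
  rw [h0] at h1
  exact (h _ hf.exp).unique h1

theorem isSmooth_sum {ι : Type*} (s : Finset ι) {f : ι → X → ℂ} (hf : ∀ i ∈ s, IsSmooth n (f i)) :
    IsSmooth n fun x => ∑ i ∈ s, f i x :=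
  contMDiff_finsetSum hf

theorem lieD_sum {V : ∀ x : X, TangentSpace (𝓡 n) x} (hV : IsSmoothField V) {ι : Type*}
    (s : Finset ι) (c : ι → ℂ) {f : ι → X → ℂ} (hf : ∀ i, IsSmooth n (f i)) (x : X) :
    lieD V (fun y => ∑ i ∈ s, c i * f i y) x = ∑ i ∈ s, c i * lieD V (f i) x := by
  obtain ⟨σ, h0, h⟩ := lieD_eq_of_curve hV x
  have h1 := HasDerivAt.fun_sum (u := s) fun i _ => (h _ (hf i)).const_mul (c i)
  exact (h _ (isSmooth_sum s fun i _ => IsSmooth.mul (contMDiff_const (c := c i)) (hf i))).unique h1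

end Calculus

/-! ### Differential operators on oscillating functions -/

section Symbols

variable {n : ℕ} {X : Type*} [TopologicalSpace X] [ChartedSpace (EuclideanSpace ℝ (Fin n)) X]

/-- Families of smooth functions depending on a frequency in a polynomially bounded way. -/
inductive IsSymbol : ((ℤ × (Fin n → ℤ)) → X → ℂ) → Prop
  | mk (P : (ℤ × (Fin n → ℤ)) → ℂ) (hP : ∃ (C : ℝ) (N : ℕ), ∀ k, ‖P k‖ ≤ C * freqWeight k ^ N)
      (a : X → ℂ) (ha : IsSmooth n a) : IsSymbol fun k x => P k * a x
  | add {b b' : (ℤ × (Fin n → ℤ)) → X → ℂ} (hb : IsSymbol b) (hb' : IsSymbol b') :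
      IsSymbol fun k x => b k x + b' k x

theorem IsSymbol.isSmooth {b : (ℤ × (Fin n → ℤ)) → X → ℂ} (hb : IsSymbol b) (k) :
    IsSmooth n (b k) := by
  induction hb with
  | mk P hP a ha => exact IsSmooth.mul (contMDiff_const (c := P k)) ha
  | add _ _ h1 h2 => exact h1.add h2

theorem freqWeight_pow_mono (k : ℤ × (Fin n → ℤ)) {N N' : ℕ} (h : N ≤ N') :
    freqWeight k ^ N ≤ freqWeight k ^ N' :=
  pow_le_pow_right₀ (one_le_freqWeight k) h

theorem le_mul_freqWeight_pow {C C' : ℝ} (hC : C ≤ C') (hC' : 0 ≤ C') {N N' : ℕ} (h : N ≤ N')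
    (k : ℤ × (Fin n → ℤ)) : C * freqWeight k ^ N ≤ C' * freqWeight k ^ N' := by
  have h0 := zero_le_one.trans (one_le_freqWeight k)
  exact mul_le_mul hC (freqWeight_pow_mono k h) (pow_nonneg h0 _) hC'

theorem IsSymbol.bound [CompactSpace X] {b : (ℤ × (Fin n → ℤ)) → X → ℂ} (hb : IsSymbol b) :
    ∃ (C : ℝ) (N : ℕ), 0 ≤ C ∧ ∀ k x, ‖b k x‖ ≤ C * freqWeight k ^ N := by
  induction hb with
  | mk P hP a ha =>
    obtain ⟨C, N, h⟩ := hP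
    obtain ⟨B, hB⟩ := isCompact_univ.exists_bound_of_continuousOn
      (ContMDiff.continuous ha).continuousOn
    refine ⟨|C| * |B|, N, by positivity, fun k x => ?_⟩
    have h0 := zero_le_one.trans (one_le_freqWeight k)
    rw [norm_mul, mul_right_comm]
    refine mul_le_mul ((h k).trans ?_) ((hB x trivial).trans (le_abs_self _)) (norm_nonneg _)
      (by positivity)
    exact le_mul_freqWeight_pow (le_abs_self _) (abs_nonneg _) le_rfl k
  | add _ _ h1 h2 =>
    obtain ⟨C, N, hC, h⟩ := h1
    obtain ⟨C', N', hC', h'⟩ := h2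
    refine ⟨C + C', N + N', by positivity, fun k x => (norm_add_le _ _).trans ?_⟩
    rw [add_mul]
    exact add_le_add ((h k x).trans (le_mul_freqWeight_pow le_rfl hC (by simp) k))
      ((h' k x).trans (le_mul_freqWeight_pow le_rfl hC' (by simp) k))

theorem IsSymbol.mul_left {b : (ℤ × (Fin n → ℤ)) → X → ℂ} (hb : IsSymbol b) {a : X → ℂ}
    (ha : IsSmooth n a) : IsSymbol fun k x => a x * b k x := by
  induction hb with
  | mk P hP a' ha' =>
    refine (congrArg IsSymbol (funext fun k => funext fun x => ?_)).mp
      (IsSymbol.mk P hP _ (ha.mul ha'))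
    ring
  | add _ _ h1 h2 =>
    refine (congrArg IsSymbol (funext fun k => funext fun x => ?_)).mp (h1.add h2)
    ring

theorem IsSymbol.freq_mul {b : (ℤ × (Fin n → ℤ)) → X → ℂ} (hb : IsSymbol b) (a : Fin n) :
    IsSymbol fun k x => (2 * Real.pi * Complex.I * (k.2 a : ℂ)) * b k x := by
  induction hb with
  | mk P hP a' ha' =>
    obtain ⟨C, N, h⟩ := hP
    refine (congrArg IsSymbol (funext fun k => funext fun x => ?_)).mp
      (IsSymbol.mk (fun k => (2 * Real.pi * Complex.I * (k.2 a : ℂ)) * P k)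
        ⟨2 * Real.pi * |C|, N + 1, fun k => ?_⟩ _ ha')
    · ring
    · have h0 := zero_le_one.trans (one_le_freqWeight k)
      have h1 : ‖(2 * Real.pi * Complex.I * (k.2 a : ℂ))‖ = 2 * Real.pi * |(k.2 a : ℝ)| := by
        simp [abs_of_pos Real.pi_pos]
      rw [norm_mul, h1, pow_succ]
      have h2 := (h k).trans (le_mul_freqWeight_pow (le_abs_self C) (abs_nonneg _) le_rfl k)
      calc _ ≤ 2 * Real.pi * freqWeight k * (|C| * freqWeight k ^ N) := by
            have := Real.pi_pos
            refine mul_le_mul (mul_le_mul_of_nonneg_left (abs_snd_le_freqWeight k a) (by positivity))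
              h2 (norm_nonneg _) (by positivity)
        _ = _ := by ring
  | add _ _ h1 h2 =>
    refine (congrArg IsSymbol (funext fun k => funext fun x => ?_)).mp (h1.add h2)
    ring

theorem isSymbol_zero : IsSymbol (n := n) (X := X) fun _ _ => 0 := by
  refine (congrArg IsSymbol (funext fun k => funext fun x => ?_)).mp
    (IsSymbol.mk (n := n) (X := X) (fun _ => 0) ⟨0, 0, fun k => by simp⟩ (fun _ => 0)
      contMDiff_const)
  simp

theorem IsSymbol.sum {ι : Type*} (s : Finset ι) {b : ι → (ℤ × (Fin n → ℤ)) → X → ℂ}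
    (hb : ∀ i, IsSymbol (b i)) : IsSymbol fun k x => ∑ i ∈ s, b i k x := by
  classical
  induction s using Finset.induction_on with
  | empty => simpa using isSymbol_zero
  | insert i s hi ih =>
    simp only [Finset.sum_insert hi]
    exact (hb i).add ih

variable [IsManifold (𝓡 n) ∞ X]

theorem IsSymbol.lieD {V : ∀ x : X, TangentSpace (𝓡 n) x} (hV : IsSmoothField V)
    {b : (ℤ × (Fin n → ℤ)) → X → ℂ} (hb : IsSymbol b) : IsSymbol fun k x => lieD V (b k) x := by
  induction hb with
  | mk P hP a ha =>
    refine (congrArg IsSymbol (funext fun k => funext fun x => ?_)).mp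
      (IsSymbol.mk P hP _ (ha.lieD hV))
    exact (congrFun ((IsDiffOp.vectorField V hV).smul_apply (P k) ha) x).symm
  | add h h' h1 h2 =>
    refine (congrArg IsSymbol (funext fun k => funext fun x => ?_)).mp (h1.add h2)
    exact (congrFun ((IsDiffOp.vectorField V hV).add_apply (h.isSmooth k) (h'.isSmooth k)) x).symm

/-- The coordinate functions of a smooth map into Euclidean space. -/
theorem isSmooth_coord {κ : X → EuclideanSpace ℝ (Fin n)}
    (hκ : ContMDiff (𝓡 n) 𝓘(ℝ, EuclideanSpace ℝ (Fin n)) ∞ κ) (a : Fin n) :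
    IsSmooth n fun x => ((κ x a : ℝ) : ℂ) := by
  have h : ContMDiff 𝓘(ℝ, EuclideanSpace ℝ (Fin n)) 𝓘(ℝ, ℂ) ∞
      (fun y : EuclideanSpace ℝ (Fin n) => ((y a : ℝ) : ℂ)) :=
    (Complex.ofRealCLM.contDiff.comp (EuclideanSpace.proj (𝕜 := ℝ) a).contDiff).contMDiff
  exact h.comp hκ

theorem character_zero_eq {κ : X → EuclideanSpace ℝ (Fin n)} (k : ℤ × (Fin n → ℤ)) :
    (fun x => character k 0 (κ x)) = fun x =>
      Complex.exp (∑ a, (2 * Real.pi * Complex.I * (k.2 a : ℂ)) * ((κ x a : ℝ) : ℂ)) := by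
  ext x
  rw [character, phase]
  congr 1
  push_cast
  rw [mul_zero, zero_add, Finset.mul_sum]
  refine Finset.sum_congr rfl fun a _ => by ring

theorem isSmooth_character {κ : X → EuclideanSpace ℝ (Fin n)}
    (hκ : ContMDiff (𝓡 n) 𝓘(ℝ, EuclideanSpace ℝ (Fin n)) ∞ κ) (k : ℤ × (Fin n → ℤ)) :
    IsSmooth n fun x => character k 0 (κ x) := by
  rw [character_zero_eq]
  exact (isSmooth_sum _ fun a _ => IsSmooth.mul contMDiff_const (isSmooth_coord hκ a)).exp

theorem lieD_character {V : ∀ x : X, TangentSpace (𝓡 n) x} (hV : IsSmoothField V)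
    {κ : X → EuclideanSpace ℝ (Fin n)}
    (hκ : ContMDiff (𝓡 n) 𝓘(ℝ, EuclideanSpace ℝ (Fin n)) ∞ κ) (k : ℤ × (Fin n → ℤ)) (x : X) :
    lieD V (fun x => character k 0 (κ x)) x = character k 0 (κ x) *
      ∑ a, (2 * Real.pi * Complex.I * (k.2 a : ℂ)) * lieD V (fun x => ((κ x a : ℝ) : ℂ)) x := by
  have h := congrFun (character_zero_eq (κ := κ) k) x
  simp only at h
  rw [h, character_zero_eq, lieD_exp hV
    (isSmooth_sum _ fun a _ => IsSmooth.mul contMDiff_const (isSmooth_coord hκ a)),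
    lieD_sum hV _ _ (fun a => isSmooth_coord hκ a)]

/-- A differential operator acts on oscillating functions through symbols. -/
theorem IsDiffOp.exists_symbol {κ : X → EuclideanSpace ℝ (Fin n)}
    (hκ : ContMDiff (𝓡 n) 𝓘(ℝ, EuclideanSpace ℝ (Fin n)) ∞ κ) {D : (X → ℂ) → (X → ℂ)}
    (hD : IsDiffOp n D) : ∀ b : (ℤ × (Fin n → ℤ)) → X → ℂ, IsSymbol b → ∃ b', IsSymbol b' ∧
      ∀ k, D (fun x => b k x * character k 0 (κ x)) = fun x => b' k x * character k 0 (κ x) := by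
  induction hD with
  | mul a ha =>
    intro b hb
    exact ⟨_, hb.mul_left ha, fun k => funext fun x => by ring⟩
  | vectorField V hV =>
    intro b hb
    -- The field falls either on the amplitude or on the phase; the latter produces ∑ 2πi k_a (V
    -- κ_a), a symbol again because one power of the frequency keeps the growth polynomial.
    refine ⟨_, (hb.lieD hV).add (IsSymbol.sum Finset.univ fun a =>
      (hb.mul_left ((isSmooth_coord hκ a).lieD hV)).freq_mul a), fun k => funext fun x => ?_⟩
    refine (lieD_mul hV (hb.isSmooth k) (isSmooth_character hκ k) x).trans ?_
    rw [lieD_character hV hκ, add_mul, Finset.sum_mul, Finset.mul_sum, Finset.mul_sum]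
    congr 1
    refine Finset.sum_congr rfl fun a _ => ?_
    ring
  | add _ _ h1 h2 =>
    intro b hb
    obtain ⟨b1, hb1, e1⟩ := h1 b hb
    obtain ⟨b2, hb2, e2⟩ := h2 b hb
    refine ⟨_, hb1.add hb2, fun k => funext fun x => ?_⟩
    simp only [Pi.add_apply, e1, e2]
    ring
  | comp _ _ h1 h2 =>
    intro b hb
    obtain ⟨b2, hb2, e2⟩ := h2 b hb
    obtain ⟨b1, hb1, e1⟩ := h1 b2 hb2
    exact ⟨b1, hb1, fun k => by simp only [e2, e1]⟩

/-- The character has modulus one, so only the symbol counts, and symbols are bounded on the compact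
X by a power of the frequency weight. -/
theorem IsDiffOp.bound_character [CompactSpace X] {κ : X → EuclideanSpace ℝ (Fin n)}
    (hκ : ContMDiff (𝓡 n) 𝓘(ℝ, EuclideanSpace ℝ (Fin n)) ∞ κ) {D : (X → ℂ) → (X → ℂ)}
    (hD : IsDiffOp n D) {η : X → ℂ} (hη : IsSmooth n η) :
    ∃ (C : ℝ) (N : ℕ), 0 ≤ C ∧ ∀ k x,
      ‖D (fun x => η x * character k 0 (κ x)) x‖ ≤ C * freqWeight k ^ N := by
  obtain ⟨b, hb, h⟩ := hD.exists_symbol hκ (fun _ x => η x)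
    ((congrArg IsSymbol (funext fun k => funext fun x => one_mul (η x))).mp
      (IsSymbol.mk (fun _ => 1) ⟨1, 0, fun k => by simp⟩ η hη))
  obtain ⟨C, N, hC, hb⟩ := hb.bound
  refine ⟨C, N, hC, fun k x => ?_⟩
  rw [h, norm_mul, norm_character, mul_one]
  exact hb k x

end Symbols

/-! ### Termwise differentiation of series on the cone -/

section TermwiseDerivative

variable {n : ℕ} {X : Type*} [TopologicalSpace X] [ChartedSpace (EuclideanSpace ℝ (Fin n)) X]

theorem SmoothOnCone.isSmooth_slice {u : ℝ × X → ℂ} (hu : SmoothOnCone n u) {t : ℝ} (ht : 0 < t) :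
    IsSmooth n fun x => u (t, x) := by
  have h : ContMDiff (𝓡 n) (𝓘(ℝ, ℝ).prod (𝓡 n)) ∞ (fun x : X => (t, x)) :=
    contMDiff_const.prodMk contMDiff_id
  exact contMDiffOn_univ.1 (ContMDiffOn.comp hu h.contMDiffOn (s := univ) fun x _ => mem_cone ht)

variable [IsManifold (𝓡 n) ∞ X]

/-- Termwise application of a differential operator on `X` to a series. -/
theorem hasSum_sliceOp {ι : Type*} {D : (X → ℂ) → (X → ℂ)} (hD : IsDiffOp n D) :
    ∀ {f : ι → ℝ × X → ℂ} {u : ℝ × X → ℂ}, (∀ j, SmoothOnCone n (f j)) → SmoothOnCone n u →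
      (∀ z ∈ cone X, HasSum (fun j => f j z) (u z)) →
      (∀ D : (X → ℂ) → (X → ℂ), IsDiffOp n D → ∀ t : ℝ, 0 < t → ∃ b : ι → ℝ, Summable b ∧
        ∀ j x, ‖sliceOp D (f j) (t, x)‖ ≤ b j) →
      ∀ z ∈ cone X, HasSum (fun j => sliceOp D (f j) z) (sliceOp D u z) := by
  induction hD with
  | mul a ha =>
    intro f u hf hu hs hb z hz
    exact (hs z hz).mul_left (a z.2)
  | vectorField V hV =>
    rintro f u hf hu hs hb ⟨t, x⟩ hz
    have ht : 0 < t := hz.1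
    obtain ⟨b, hb, hfb⟩ := hb _ (IsDiffOp.vectorField V hV) t ht
    -- Restricting to an integral curve reduces the claim to termwise differentiation in one real
    -- variable. The majorant is uniform in `x`, hence valid along the whole curve.
    obtain ⟨σ, r, hr, h0, h⟩ := exists_curve hV x
    have h1 := hasDerivAt_tsum_of_isPreconnected (g := fun j s => f j (t, σ s))
      (g' := fun j s => lieD V (fun x => f j (t, x)) (σ s)) hb Metric.isOpen_ball
      (convex_ball (0 : ℝ) r).isPreconnected
      (fun j s hs => h s hs (fun x => f j (t, x))
        (((hf j).isSmooth_slice ht).mdifferentiableAt _))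
      (fun j s _ => hfb j (σ s)) (Metric.mem_ball_self hr)
      (hs (t, σ 0) (mem_cone ht)).summable (Metric.mem_ball_self hr)
    have h2 := h 0 (Metric.mem_ball_self hr) (fun x => u (t, x))
      ((hu.isSmooth_slice ht).mdifferentiableAt _)
    have h3 : (fun s => ∑' j, f j (t, σ s)) = fun s => u (t, σ s) :=
      funext fun s => (hs (t, σ s) (mem_cone ht)).tsum_eq
    rw [h3] at h1
    have h4 := h1.unique h2
    rw [h0] at h4
    change HasSum (fun j => lieD V (fun x => f j (t, x)) x) (lieD V (fun x => u (t, x)) x)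
    rw [← h4]
    exact (Summable.of_norm_bounded hb fun j => hfb j x).hasSum
  | add _ _ h1 h2 =>
    intro f u hf hu hs hb z hz
    exact (h1 hf hu hs hb z hz).add (h2 hf hu hs hb z hz)
  | @comp D D' hD hD' h1 h2 =>
    intro f u hf hu hs hb z hz
    -- The majorants are assumed for all differential operators, so they are at hand for
    -- compositions with `D'`; the induction depends on this form of the hypothesis.
    exact h1 (fun j => hD'.smoothOnCone (hf j)) (hD'.smoothOnCone hu) (h2 hf hu hs hb)
      (fun D'' hD'' t ht => hb _ (hD''.comp hD') t ht) z hz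

/-- Termwise differentiation needs a uniform majorant only near the given point. A continuous factor
`W` is bounded on compact intervals of (0, ∞), and so is the factor 1/t that turns t∂_t into ∂_t. -/
theorem hasSum_radialDeriv {ι : Type*} {f : ι → ℝ × X → ℂ} {u : ℝ × X → ℂ}
    (hf : ∀ j, SmoothOnCone n (f j)) (hu : SmoothOnCone n u)
    (hs : ∀ z ∈ cone X, HasSum (fun j => f j z) (u z)) {W : ℝ → ℝ} (hW : ContinuousOn W (Ioi 0))
    {b : ι → ℝ} (hb : Summable b) (hfb : ∀ j, ∀ z ∈ cone X, ‖radialDeriv (f j) z‖ ≤ W z.1 * b j)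
    {z : ℝ × X} (hz : z ∈ cone X) :
    HasSum (fun j => radialDeriv (f j) z) (radialDeriv u z) := by
  obtain ⟨t, x⟩ := z
  have ht : 0 < t := hz.1
  have hball : Metric.ball t (t / 2) ⊆ Icc (t / 2) (3 * t / 2) := by
    intro s hs
    have := abs_lt.1 (Real.dist_eq s t ▸ Metric.mem_ball.1 hs)
    exact ⟨by linarith [this.1], by linarith [this.2]⟩
  have hI : Icc (t / 2) (3 * t / 2) ⊆ Ioi 0 := fun s hs => lt_of_lt_of_le (by positivity) hs.1
  -- `B` bounds |W(s)/s| on [t/2, 3t/2], the closure of the ball of radius t/2, which stays away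
  -- from 0.
  obtain ⟨B, hB⟩ := isCompact_Icc.exists_bound_of_continuousOn
    ((hW.mono hI).div continuousOn_id fun s hs => (hI hs).ne')
  have hder : ∀ j, ∀ s ∈ Metric.ball t (t / 2),
      ‖deriv (fun t : ℝ => f j (t, x)) s‖ ≤ B * |b j| := by
    intro j s hs
    have hs0 : 0 < s := hI (hball hs)
    have h1 := hfb j (s, x) (mem_cone hs0)
    simp only [radialDeriv, norm_mul, Complex.norm_real, Real.norm_eq_abs, abs_of_pos hs0] at h1
    have h2 := hB s (hball hs)
    simp only [Pi.div_apply, id, norm_div, Real.norm_eq_abs, abs_of_pos hs0] at h2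
    have h3 : W s * b j ≤ |W s| * |b j| := (le_abs_self _).trans (abs_mul _ _).le
    rw [div_le_iff₀ hs0] at h2
    have h4 : |W s| * |b j| ≤ B * s * |b j| := mul_le_mul_of_nonneg_right h2 (abs_nonneg _)
    refine le_of_mul_le_mul_left (?_ : s * _ ≤ s * _) hs0
    linarith
  have htb : t ∈ Metric.ball t (t / 2) := Metric.mem_ball_self (by positivity)
  have hsum : Summable fun j => B * |b j| := hb.abs.mul_left B
  have h1 := hasDerivAt_tsum_of_isPreconnected (g := fun j s => f j (s, x)) hsum Metric.isOpen_ball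
    (convex_ball t (t / 2)).isPreconnected
    (fun j s hs => ((hf j).differentiableAt_radial (z := (s, x))
      (mem_cone (hI (hball hs)))).hasDerivAt)
    hder htb (hs (t, x) hz).summable htb
  have h2 := (hu.differentiableAt_radial hz).hasDerivAt
  have h3 : (fun s => ∑' j, f j (s, x)) =ᶠ[𝓝 t] fun s => u (s, x) := by
    filter_upwards [Metric.isOpen_ball.mem_nhds htb] with s hs'
    exact (hs (s, x) (mem_cone (hI (hball hs')))).tsum_eq
  have h4 := (h1.congr_of_eventuallyEq h3.symm).unique h2
  simp only [radialDeriv]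
  rw [← h4]
  exact (Summable.of_norm_bounded hsum fun j => hder j t htb).hasSum.mul_left _

theorem hasSum_coneOp {ι : Type*} {f : ι → ℝ × X → ℂ} {u : ℝ × X → ℂ}
    (hf : ∀ j, SmoothOnCone n (f j)) (hu : SmoothOnCone n u)
    (hs : ∀ z ∈ cone X, HasSum (fun j => f j z) (u z))
    (hb : ∀ (p : ℕ) (D : (X → ℂ) → (X → ℂ)), IsDiffOp n D → ∃ (W : ℝ → ℝ) (b : ι → ℝ),
      ContinuousOn W (Ioi 0) ∧ Summable b ∧ ∀ j, ∀ z ∈ cone X, ‖coneOp p D (f j) z‖ ≤ W z.1 * b j)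
    (p : ℕ) {D : (X → ℂ) → (X → ℂ)} (hD : IsDiffOp n D) :
    ∀ z ∈ cone X, HasSum (fun j => coneOp p D (f j) z) (coneOp p D u z) := by
  induction p with
  | zero =>
    refine hasSum_sliceOp hD hf hu hs fun D hD t ht => ?_
    obtain ⟨W, b, -, hb, h⟩ := hb 0 D hD
    exact ⟨fun j => W t * b j, hb.mul_left _, fun j x => h j (t, x) (mem_cone ht)⟩
  | succ p ih =>
    intro z hz
    obtain ⟨W, b, hW, hb, h⟩ := hb (p + 1) D hD
    simp only [coneOp, Function.iterate_succ_apply'] at h ⊢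
    exact hasSum_radialDeriv (fun j => coneOp_smooth hD p (hf j)) (coneOp_smooth hD p hu) ih hW hb h
      hz

end TermwiseDerivative

/-! ### Products of a radial and a tangential factor -/

section ProductFunctions

variable {n : ℕ} {X : Type*} [TopologicalSpace X] [ChartedSpace (EuclideanSpace ℝ (Fin n)) X]

/-- The function `A (log t) H(x)` on the cone. -/
def coneFn (A : ℝ → ℂ) (H : X → ℂ) : ℝ × X → ℂ :=
  fun z => if 0 < z.1 then A (Real.log z.1) * H z.2 else 0

theorem coneFn_of_pos {A : ℝ → ℂ} {H : X → ℂ} {z : ℝ × X} (hz : 0 < z.1) :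
    coneFn A H z = A (Real.log z.1) * H z.2 := if_pos hz

theorem coneFn_of_notMem {A : ℝ → ℂ} {H : X → ℂ} {z : ℝ × X} (hz : z ∉ cone X) :
    coneFn A H z = 0 := if_neg fun h => hz (mem_cone h)

theorem smoothOnCone_coneFn {A : ℝ → ℂ} {H : X → ℂ} (hA : ContDiff ℝ ∞ A) (hH : IsSmooth n H) :
    SmoothOnCone n (coneFn A H) := by
  have h1 : ContMDiffOn (𝓘(ℝ, ℝ).prod (𝓡 n)) 𝓘(ℝ, ℂ) ∞
      (fun z : ℝ × X => A (Real.log z.1)) (cone X) := by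
    have h2 : ContMDiffOn 𝓘(ℝ, ℝ) 𝓘(ℝ, ℂ) ∞ (fun t : ℝ => A (Real.log t)) (Ioi 0) :=
      (hA.comp_contDiffOn (Real.contDiffOn_log.mono fun t ht => ne_of_gt ht)).contMDiffOn
    exact h2.comp contMDiff_fst.contMDiffOn fun z hz => hz.1
  have h2 : ContMDiffOn (𝓘(ℝ, ℝ).prod (𝓡 n)) 𝓘(ℝ, ℂ) ∞ (fun z : ℝ × X => H z.2) (cone X) :=
    (hH.comp contMDiff_snd).contMDiffOn
  have h : ContMDiff 𝓘(ℝ, ℂ × ℂ) 𝓘(ℝ, ℂ) ∞ (fun w : ℂ × ℂ => w.1 * w.2) :=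
    (contDiff_fst.mul contDiff_snd).contMDiff
  exact (h.comp_contMDiffOn (h1.prodMk_space h2)).congr fun z hz => coneFn_of_pos hz.1

/-- In the variable log t the operator t∂_t is the ordinary derivative. -/
theorem radialDeriv_coneFn {A : ℝ → ℂ} {H : X → ℂ} (hA : Differentiable ℝ A) :
    EqOn (radialDeriv (coneFn A H)) (coneFn (deriv A) H) (cone X) := by
  rintro ⟨t, x⟩ hz
  have ht : 0 < t := hz.1
  have h1 : (fun s : ℝ => coneFn A H (s, x)) =ᶠ[𝓝 t] fun s => A (Real.log s) * H x := by
    filter_upwards [isOpen_Ioi.mem_nhds hz.1] with s hs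
    exact coneFn_of_pos hs
  have h2 : HasDerivAt (fun s : ℝ => A (Real.log s) * H x)
      ((t⁻¹ : ℝ) • deriv A (Real.log t) * H x) t :=
    (((hA (Real.log t)).hasDerivAt.scomp t (Real.hasDerivAt_log ht.ne')).mul_const (H x))
  rw [coneFn_of_pos ht]
  simp only [radialDeriv]
  rw [h1.deriv_eq, h2.deriv]
  have : (t : ℂ) ≠ 0 := by exact_mod_cast ht.ne'
  simp only [Complex.real_smul]
  push_cast
  field_simp

variable [IsManifold (𝓡 n) ∞ X]

theorem coneOp_coneFn {A : ℝ → ℂ} {H : X → ℂ} (hA : ContDiff ℝ ∞ A) (hH : IsSmooth n H)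
    {D : (X → ℂ) → (X → ℂ)} (hD : IsDiffOp n D) (p : ℕ) :
    EqOn (coneOp p D (coneFn A H)) (coneFn (iteratedDeriv p A) (D H)) (cone X) := by
  induction p with
  | zero =>
    rintro ⟨t, x⟩ hz
    have ht : 0 < t := hz.1
    rw [iteratedDeriv_zero, coneFn_of_pos ht]
    have : (fun y => coneFn A H (t, y)) = fun y => A (Real.log t) * H y :=
      funext fun y => coneFn_of_pos ht
    simp only [coneOp, Function.iterate_zero, id, sliceOp, this, hD.smul_apply _ hH]
  | succ p ih =>
    intro z hz
    simp only [coneOp, Function.iterate_succ_apply'] at ih ⊢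
    rw [radialDeriv_congr ih hz, radialDeriv_coneFn _ hz, iteratedDeriv_succ]
    exact hA.differentiable_iteratedDeriv p (by exact_mod_cast ENat.natCast_lt_top p)

/-- The oscillation `ψ(r) exp(2πi k r)`. -/
def osc (ψ : ℝ → ℂ) (k : ℤ) : ℝ → ℂ := fun r => ψ r * Complex.exp (2 * Real.pi * Complex.I * k * r)

theorem contDiff_osc {ψ : ℝ → ℂ} (hψ : ContDiff ℝ ∞ ψ) (k : ℤ) : ContDiff ℝ ∞ (osc ψ k) := by
  refine hψ.mul (Complex.contDiff_exp.comp ?_)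
  exact contDiff_const.mul Complex.ofRealCLM.contDiff

theorem deriv_osc {ψ : ℝ → ℂ} (hψ : ContDiff ℝ ∞ ψ) (k : ℤ) :
    deriv (osc ψ k) = osc (deriv ψ) k + fun r => (2 * Real.pi * Complex.I * k) * osc ψ k r := by
  ext r
  have h1 := (hψ.differentiable (by simp) r).hasDerivAt
  have h2 : HasDerivAt (fun r : ℝ => 2 * Real.pi * Complex.I * k * (r : ℂ))
      (2 * Real.pi * Complex.I * k * 1) r :=
    (HasDerivAt.ofReal_comp (hasDerivAt_id r)).const_mul _
  have h3 := h1.mul h2.cexp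
  refine h3.deriv.trans ?_
  simp only [osc, Pi.add_apply]
  ring

theorem norm_osc (ψ : ℝ → ℂ) (k : ℤ) (r : ℝ) : ‖osc ψ k r‖ = ‖ψ r‖ := by
  rw [osc, norm_mul, show 2 * (Real.pi : ℂ) * Complex.I * k * r =
    ((2 * Real.pi * k * r : ℝ) : ℂ) * Complex.I by push_cast; ring,
    Complex.norm_exp_ofReal_mul_I, mul_one]

/-- Each derivative falls on `ψ` or produces a factor 2πik. The induction runs over all `ψ`
simultaneously, since `ψ` is replaced by its derivative. -/
theorem iteratedDeriv_osc_bound (p : ℕ) : ∀ ψ : ℝ → ℂ, ContDiff ℝ ∞ ψ → HasCompactSupport ψ →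
    ∃ C : ℝ, 0 ≤ C ∧ ∀ (k : ℤ) (r : ℝ), ‖iteratedDeriv p (osc ψ k) r‖ ≤ C * (1 + |(k : ℝ)|) ^ p := by
  induction p with
  | zero =>
    intro ψ hψ hc
    obtain ⟨C, hC⟩ := hc.exists_bound_of_continuous hψ.continuous
    refine ⟨C, (norm_nonneg _).trans (hC 0), fun k r => ?_⟩
    rw [iteratedDeriv_zero, norm_osc, pow_zero, mul_one]
    exact hC r
  | succ p ih =>
    intro ψ hψ hc
    have hψ' : ContDiff ℝ ∞ (deriv ψ) := (contDiff_infty_iff_deriv.1 hψ).2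
    obtain ⟨C, hC, h⟩ := ih ψ hψ hc
    obtain ⟨C', hC', h'⟩ := ih _ hψ' hc.deriv
    have := Real.pi_pos
    refine ⟨C' + 2 * Real.pi * C, by positivity, fun k r => ?_⟩
    have hp : ((p : ℕ∞) : WithTop ℕ∞) ≤ ((⊤ : ℕ∞) : WithTop ℕ∞) := by exact_mod_cast le_top
    rw [iteratedDeriv_succ', deriv_osc hψ, iteratedDeriv_add
      ((contDiff_osc hψ' k).contDiffAt.of_le hp)
      ((contDiff_const.mul (contDiff_osc hψ k)).contDiffAt.of_le hp),
      iteratedDeriv_const_mul_field]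
    refine (norm_add_le _ _).trans ?_
    have h1 : ‖(2 * Real.pi * Complex.I * (k : ℂ))‖ = 2 * Real.pi * |(k : ℝ)| := by
      simp [abs_of_pos Real.pi_pos]
    rw [norm_mul, h1, add_mul, pow_succ]
    have hk := abs_nonneg (k : ℝ)
    have hX : 0 ≤ (1 + |(k : ℝ)|) ^ p := by positivity
    refine add_le_add ((h' k r).trans ?_)
      ((mul_le_mul_of_nonneg_left (h k r) (by positivity)).trans ?_)
    · rw [← mul_assoc]
      exact le_mul_of_one_le_right (by positivity) (by linarith)
    · have : 2 * Real.pi * |(k : ℝ)| * (C * (1 + |(k : ℝ)|) ^ p) =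
        2 * Real.pi * C * ((1 + |(k : ℝ)|) ^ p * |(k : ℝ)|) := by ring
      rw [this]
      gcongr
      linarith

theorem iteratedDeriv_eq_zero_of_notMem {f : ℝ → ℂ} {s : Set ℝ} (hs : IsClosed s)
    (hf : ∀ r ∉ s, f r = 0) (p : ℕ) {r : ℝ} (hr : r ∉ s) : iteratedDeriv p f r = 0 := by
  have h : f =ᶠ[𝓝 r] fun _ => 0 := by
    filter_upwards [hs.isOpen_compl.mem_nhds hr] with r' hr'
    exact hf r' hr'
  rw [h.iteratedDeriv_eq]
  simp

end ProductFunctions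

/-! ### Logarithmic coordinates -/

section LogCoordinates

variable {X : Type*}

/-- Logarithmic coordinates centred at `t = exp M`. -/
def logCoord (M : ℝ) (q : ℝ × X) : ℝ × X := (Real.exp (M + q.1), q.2)

theorem logCoord_mem_cone (M : ℝ) (q : ℝ × X) : logCoord M q ∈ cone X :=
  ⟨mem_Ioi.2 (Real.exp_pos _), trivial⟩

/-- dt/t is the Haar measure of the multiplicative group: the exponential carries Lebesgue measure
to it, and translation by `M` is harmless. -/
theorem measurePreserving_exp_add (M : ℝ) :
    MeasurePreserving (fun r => Real.exp (M + r)) volume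
      ((volume.restrict (Ioi (0 : ℝ))).withDensity fun t => ENNReal.ofReal t⁻¹) := by
  have hmeas : Measurable fun t : ℝ => ENNReal.ofReal t⁻¹ := by fun_prop
  have h : MeasurePreserving Real.exp volume
      ((volume.restrict (Ioi (0 : ℝ))).withDensity fun t => ENNReal.ofReal t⁻¹) := by
    refine ⟨Real.measurable_exp, ?_⟩
    ext s hs
    rw [Measure.map_apply Real.measurable_exp hs, withDensity_apply _ hs,
      ← lintegral_indicator hs]
    have h1 := lintegral_image_eq_lintegral_abs_deriv_mul (s := univ) (f := Real.exp)
      (f' := Real.exp) MeasurableSet.univ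
      (fun x _ => (Real.hasDerivAt_exp x).hasDerivWithinAt) Real.exp_injective.injOn
      (s.indicator fun t => ENNReal.ofReal t⁻¹)
    rw [image_univ, Real.range_exp] at h1
    rw [h1, Measure.restrict_univ, ← lintegral_indicator_one (hs.preimage Real.measurable_exp)]
    refine lintegral_congr fun x => ?_
    by_cases hx : Real.exp x ∈ s
    · rw [indicator_of_mem (show x ∈ Real.exp ⁻¹' s from hx), indicator_of_mem hx,
        ← ENNReal.ofReal_mul (abs_nonneg _), abs_of_pos (Real.exp_pos x),
        mul_inv_cancel₀ (Real.exp_pos x).ne']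
      simp
    · rw [indicator_of_notMem (show x ∉ Real.exp ⁻¹' s from hx), indicator_of_notMem hx, mul_zero]
  exact h.comp (measurePreserving_add_left volume M)

variable [TopologicalSpace X]

theorem continuous_logCoord (M : ℝ) : Continuous (logCoord (X := X) M) := by
  unfold logCoord
  fun_prop

variable [MeasurableSpace X] [BorelSpace X]

theorem measurePreserving_logCoord (μ : Measure X) [SFinite μ] (M : ℝ) :
    MeasurePreserving (logCoord M) (volume.prod μ) (mellinMeasure μ) := by
  have h1 : mellinMeasure μ =
      ((volume.restrict (Ioi (0 : ℝ))).withDensity fun t => ENNReal.ofReal t⁻¹).prod μ := by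
    rw [prod_withDensity_left (by fun_prop), mellinMeasure, coneVol, cone]
    congr 1
    rw [← Measure.prod_restrict, Measure.restrict_univ]
  rw [h1]
  exact (measurePreserving_exp_add M).prod (MeasurePreserving.id μ)

theorem measurableEmbedding_logCoord (M : ℝ) : MeasurableEmbedding (logCoord (X := X) M) := by
  have h1 : MeasurableEmbedding fun r : ℝ => Real.exp (M + r) :=
    Real.isOpenEmbedding_exp.measurableEmbedding.comp (measurableEmbedding_addLeft M)
  exact h1.prodMap MeasurableEmbedding.id

theorem integral_mellinMeasure (μ : Measure X) [SFinite μ] (M : ℝ) (f : ℝ × X → ℂ) :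
    ∫ z, f z ∂mellinMeasure μ = ∫ q, f (logCoord M q) ∂volume.prod μ :=
  ((measurePreserving_logCoord μ M).integral_comp (measurableEmbedding_logCoord M) f).symm

theorem eLpNorm_mellinMeasure (μ : Measure X) [SFinite μ] (M : ℝ) (f : ℝ × X → ℂ) :
    eLpNorm f 2 (mellinMeasure μ) = eLpNorm (fun q => f (logCoord M q)) 2 (volume.prod μ) := by
  have h := measurePreserving_logCoord μ M
  rw [← h.map_eq, (measurableEmbedding_logCoord M).eLpNorm_map_measure]
  rfl

theorem coneMeasure_eq_mellin (n : ℕ) (μ : Measure X) (γ : ℝ) :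
    coneMeasure n μ γ = (mellinMeasure μ).withDensity fun z =>
      ENNReal.ofReal (min z.1 1 ^ (-2 * γ) * z.1 ^ (n + 1)) := by
  rw [mellinMeasure, ← withDensity_mul _ (by fun_prop) (by fun_prop), coneMeasure]
  refine withDensity_congr_ae ?_
  filter_upwards [ae_mem_cone μ] with z hz
  have ht : (0 : ℝ) < z.1 := hz.1
  rw [Pi.mul_apply, ← ENNReal.ofReal_mul (by positivity)]
  congr 1
  rw [pow_succ]
  field_simp

theorem integral_coneMeasure_zero (n : ℕ) (μ : Measure X) (f : ℝ × X → ℂ) :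
    ∫ z, f z ∂coneMeasure n μ 0 = ∫ z, ((z.1 ^ (n + 1) : ℝ) : ℂ) * f z ∂mellinMeasure μ := by
  rw [coneMeasure_eq_mellin, integral_withDensity_eq_integral_toReal_smul (by fun_prop) (by simp)]
  refine integral_congr_ae ?_
  filter_upwards [(mellinMeasure_ac μ).ae_le (ae_mem_cone μ)] with z hz
  have ht : (0 : ℝ) < z.1 := hz.1
  rw [ENNReal.toReal_ofReal (by positivity), mul_zero, Real.rpow_zero, one_mul, Complex.real_smul]

/-- The slab `|r| ≤ 1/2` in logarithmic coordinates. -/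
def slab (X : Type*) : Set (ℝ × X) := Icc (-(1 / 2)) (1 / 2) ×ˢ univ

theorem measurableSet_slab : MeasurableSet (slab X) := measurableSet_Icc.prod MeasurableSet.univ

theorem mem_slab {q : ℝ × X} : q ∈ slab X ↔ |q.1| ≤ 1 / 2 := by
  rw [abs_le]
  exact ⟨fun h => h.1, fun h => ⟨h, trivial⟩⟩

theorem measure_slab (μ : Measure X) [SFinite μ] : (volume.prod μ) (slab X) = μ univ := by
  rw [slab, Measure.prod_prod, Real.volume_Icc]
  norm_num

variable {μ : Measure X} [IsFiniteMeasure μ]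

theorem eLpNorm_le_of_slab {F : ℝ × X → ℂ} {B : ℝ} (hB : 0 ≤ B) (h : ∀ q ∈ slab X, ‖F q‖ ≤ B)
    (h0 : ∀ q ∉ slab X, F q = 0) :
    eLpNorm F 2 (volume.prod μ) ≤ ENNReal.ofReal (B * √(μ.real univ)) := by
  have h1 : eLpNorm F 2 (volume.prod μ) ≤
      eLpNorm ((slab X).indicator fun _ => B) 2 (volume.prod μ) := by
    refine eLpNorm_mono fun q => ?_
    by_cases hq : q ∈ slab X
    · rw [indicator_of_mem hq, Real.norm_of_nonneg hB]
      exact h q hq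
    · rw [h0 q hq, norm_zero]
      positivity
  refine h1.trans ?_
  rw [eLpNorm_indicator_const measurableSet_slab (by simp) (by simp), measure_slab,
    Real.enorm_of_nonneg hB, ENNReal.ofReal_mul hB, Real.sqrt_eq_rpow,
    ← ENNReal.ofReal_rpow_of_nonneg (by positivity) (by positivity), ofReal_measureReal]
  simp

theorem integrable_of_slab {F : ℝ × X → ℂ} {B : ℝ} (hF : AEStronglyMeasurable F (volume.prod μ))
    (h : ∀ q ∈ slab X, ‖F q‖ ≤ B) (h0 : ∀ q ∉ slab X, F q = 0) : Integrable F (volume.prod μ) := by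
  have h1 : IntegrableOn F (slab X) (volume.prod μ) := by
    refine IntegrableOn.of_bound ?_ hF.restrict B ?_
    · rw [measure_slab]; exact measure_lt_top μ univ
    · filter_upwards [ae_restrict_mem measurableSet_slab] with q hq
      exact h q hq
  refine (integrable_indicator_iff measurableSet_slab).2 h1 |>.congr (ae_of_all _ fun q => ?_)
  by_cases hq : q ∈ slab X
  · rw [indicator_of_mem hq]
  · rw [indicator_of_notMem hq, h0 q hq]

/-- Cauchy–Schwarz on the slab, whose measure is that of X because the radial interval has length 1.
It converts the L² seminorms into the L¹ bounds that coefficients require. -/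
theorem setIntegral_slab_le {F : ℝ × X → ℂ} (hF : AEStronglyMeasurable F (volume.prod μ)) :
    ENNReal.ofReal (∫ q in slab X, ‖F q‖ ∂volume.prod μ) ≤
      eLpNorm F 2 (volume.prod μ) * ENNReal.ofReal √(μ.real univ) := by
  have hfin : IsFiniteMeasure ((volume.prod μ).restrict (slab X)) :=
    ⟨by rw [Measure.restrict_apply_univ, measure_slab]; exact measure_lt_top μ univ⟩
  have h1 : ENNReal.ofReal (∫ q in slab X, ‖F q‖ ∂volume.prod μ) ≤
      eLpNorm F 1 ((volume.prod μ).restrict (slab X)) := by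
    rw [eLpNorm_one_eq_lintegral_enorm, integral_norm_eq_lintegral_enorm hF.restrict]
    exact ENNReal.ofReal_toReal_le
  refine h1.trans ((eLpNorm_le_eLpNorm_mul_rpow_measure_univ (p := 1) (q := 2) (by norm_num)
    hF.restrict).trans ?_)
  refine mul_le_mul' (eLpNorm_mono_measure F Measure.restrict_le_self) (le_of_eq ?_)
  rw [Measure.restrict_apply_univ, measure_slab, Real.sqrt_eq_rpow,
    ← ENNReal.ofReal_rpow_of_nonneg (by positivity) (by positivity), ofReal_measureReal]
  norm_num

end LogCoordinates

/-! ### Comparison of the weights at a radial position -/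

section Weights

/-- The normalisation of the frame functions at `t = exp M`. -/
def frameScale (n : ℕ) (γ M : ℝ) : ℝ := Real.exp (M * (((n : ℝ) + 1) / 2) + γ * max (-M) 0)

theorem frameScale_pos (n : ℕ) (γ M : ℝ) : 0 < frameScale n γ M := Real.exp_pos _

theorem mul_le_abs_of_abs_le_one {a r : ℝ} (hr : |r| ≤ 1) : a * r ≤ |a| := by
  calc a * r ≤ |a * r| := le_abs_self _
    _ = |a| * |r| := abs_mul _ _
    _ ≤ |a| := mul_le_of_le_one_right (abs_nonneg _) hr

theorem neg_abs_le_mul {a r : ℝ} (hr : |r| ≤ 1) : -|a| ≤ a * r := by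
  have := mul_le_abs_of_abs_le_one (a := -a) hr
  rw [abs_neg] at this
  linarith

theorem max_sub_max_neg (M : ℝ) : max M 0 - max (-M) 0 = M := by
  rcases le_total 0 M with h | h
  · rw [max_eq_left h, max_eq_right (by linarith)]; ring
  · rw [max_eq_right h, max_eq_left (by linarith)]; ring

/-- For |r| ≤ 1 the weight is comparable to its value at t = e^M. For M ≤ 0 the scale cancels
t^((n+1)/2-γ), which leaves e^(-δM); for M ≥ 0 it cancels only t^((n+1)/2), and the remaining power
of t together with ⟨t⟩^k is absorbed by `N`. -/
theorem weight_le (n : ℕ) (γ δ : ℝ) (k : ℤ) : ∃ (C : ℝ) (N : ℕ), 0 < C ∧ ∀ M r : ℝ, |r| ≤ 1 →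
    Real.exp (M + r) ^ (((n : ℝ) + 1) / 2 - γ - δ) * √(1 + Real.exp (M + r) ^ 2) ^ k *
      (frameScale n γ M)⁻¹ ≤ C * Real.exp (δ * max (-M) 0 + N * max M 0) := by
  set a := ((n : ℝ) + 1) / 2 - γ - δ with ha
  -- The first factor pays for the shift by `r` in the power of t. The second comes from ⟨t⟩ ≤ 2e ·
  -- exp(max(M, 0)), and the sign of `k` is disregarded since ⟨t⟩ ≥ 1.
  refine ⟨Real.exp |a| * (2 * Real.exp 1) ^ k.natAbs, ⌈|γ + δ|⌉₊ + k.natAbs, by positivity,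
    fun M r hr => ?_⟩
  have hr' := abs_le.1 hr
  set P := max M 0 with hP
  set Q := max (-M) 0 with hQ
  have hPQ : P - Q = M := max_sub_max_neg M
  have hP0 : 0 ≤ P := le_max_right _ _
  have hQ0 : 0 ≤ Q := le_max_right _ _
  have hs1 : 1 ≤ √(1 + Real.exp (M + r) ^ 2) := Real.one_le_sqrt.2 (by nlinarith [Real.exp_pos (M + r)])
  have hs2 : √(1 + Real.exp (M + r) ^ 2) ≤ 2 * Real.exp 1 * Real.exp P := by
    rw [mul_assoc, ← Real.exp_add]
    have e1 : Real.exp (M + r) ≤ Real.exp (1 + P) := Real.exp_le_exp.2 (by linarith)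
    have e2 : 1 ≤ Real.exp (1 + P) := Real.one_le_exp (by linarith)
    refine Real.sqrt_le_iff.2 ⟨by positivity, ?_⟩
    nlinarith [Real.exp_pos (M + r)]
  have hz : √(1 + Real.exp (M + r) ^ 2) ^ k ≤ (2 * Real.exp 1) ^ k.natAbs * Real.exp (k.natAbs * P) := by
    calc √(1 + Real.exp (M + r) ^ 2) ^ k ≤ √(1 + Real.exp (M + r) ^ 2) ^ (k.natAbs : ℤ) :=
          zpow_le_zpow_right₀ hs1 Int.le_natAbs
      _ ≤ (2 * Real.exp 1 * Real.exp P) ^ k.natAbs := by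
          rw [zpow_natCast]; exact pow_le_pow_left₀ (by positivity) hs2 _
      _ = _ := by rw [mul_pow, ← Real.exp_nat_mul]
  have hx : Real.exp (M + r) ^ a * (frameScale n γ M)⁻¹ ≤
      Real.exp |a| * Real.exp (δ * Q + ⌈|γ + δ|⌉₊ * P) := by
    rw [← Real.exp_mul, frameScale, ← Real.exp_neg, ← Real.exp_add, ← Real.exp_add]
    refine Real.exp_le_exp.2 ?_
    have h1 := mul_le_abs_of_abs_le_one (a := a) hr
    have h2 : (M + r) * a + -(M * (((n : ℝ) + 1) / 2) + γ * Q) =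
        a * r + δ * Q - (γ + δ) * P + (P - Q - M) * (γ + δ) := by rw [ha]; ring
    rw [h2, hPQ]
    have h3 : -(γ + δ) * P ≤ ⌈|γ + δ|⌉₊ * P :=
      mul_le_mul_of_nonneg_right ((neg_le_abs _).trans (Nat.le_ceil _)) hP0
    linarith
  calc Real.exp (M + r) ^ a * √(1 + Real.exp (M + r) ^ 2) ^ k * (frameScale n γ M)⁻¹
      = (Real.exp (M + r) ^ a * (frameScale n γ M)⁻¹) * √(1 + Real.exp (M + r) ^ 2) ^ k := by ring
    _ ≤ (Real.exp |a| * Real.exp (δ * Q + ⌈|γ + δ|⌉₊ * P)) *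
        ((2 * Real.exp 1) ^ k.natAbs * Real.exp (k.natAbs * P)) :=
          mul_le_mul hx hz (by positivity) (by positivity)
    _ = Real.exp |a| * (2 * Real.exp 1) ^ k.natAbs *
        (Real.exp (δ * Q + ⌈|γ + δ|⌉₊ * P) * Real.exp (k.natAbs * P)) := by ring
    _ = _ := by
      rw [← Real.exp_add]
      congr 2
      push_cast
      ring

/-- The converse estimate, for the coefficients. Since all powers of ⟨t⟩ are available, a large `k`
beats e^(NM) and the stray power t^(γ+δ) at infinity; near t = 0 the two sides have the same power
of t. -/
theorem le_weight (n : ℕ) (γ δ : ℝ) (N : ℕ) : ∃ (C : ℝ) (k : ℤ), 0 < C ∧ ∀ M r : ℝ, |r| ≤ 1 →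
    frameScale n γ M * Real.exp (δ * max (-M) 0 + N * max M 0) ≤
      C * (Real.exp (M + r) ^ (((n : ℝ) + 1) / 2 - γ - δ) * √(1 + Real.exp (M + r) ^ 2) ^ k) := by
  set a := ((n : ℝ) + 1) / 2 - γ - δ with ha
  set K := N + ⌈|γ + δ|⌉₊ with hK
  refine ⟨Real.exp (|a| + K), K, by positivity, fun M r hr => ?_⟩
  have hr' := abs_le.1 hr
  set P := max M 0 with hP
  set Q := max (-M) 0 with hQ
  have hPQ : P - Q = M := max_sub_max_neg M
  have hP0 : 0 ≤ P := le_max_right _ _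
  have hs : Real.exp (P - 1) ≤ √(1 + Real.exp (M + r) ^ 2) := by
    rcases le_total 0 M with h | h
    · refine Real.le_sqrt_of_sq_le ?_
      have : Real.exp (P - 1) ≤ Real.exp (M + r) :=
        Real.exp_le_exp.2 (by rw [hP, max_eq_left h]; linarith)
      nlinarith [Real.exp_pos (P - 1)]
    · refine le_trans (Real.exp_le_one_iff.2 ?_)
        (Real.one_le_sqrt.2 (by nlinarith [Real.exp_pos (M + r)]))
      rw [hP, max_eq_right h]; norm_num
  rw [zpow_natCast]
  have hs' : Real.exp (K * (P - 1)) ≤ √(1 + Real.exp (M + r) ^ 2) ^ K := by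
    rw [Real.exp_nat_mul]; exact pow_le_pow_left₀ (Real.exp_pos _).le hs _
  refine le_trans ?_ (mul_le_mul_of_nonneg_left (mul_le_mul_of_nonneg_left hs'
    (Real.rpow_nonneg (Real.exp_pos _).le _)) (Real.exp_pos _).le)
  rw [← Real.exp_mul, frameScale, ← Real.exp_add, ← Real.exp_add, ← Real.exp_add]
  refine Real.exp_le_exp.2 ?_
  have h1 := neg_abs_le_mul (a := a) hr
  have h2 : (M + r) * a = (P - Q) * (((n : ℝ) + 1) / 2) - (γ + δ) * P + (γ + δ) * Q + a * r := by
    rw [hPQ, ← hPQ, ha]; ring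
  have h3 : (γ + δ) * P ≤ ⌈|γ + δ|⌉₊ * P :=
    mul_le_mul_of_nonneg_right ((le_abs_self _).trans (Nat.le_ceil _)) hP0
  have h4 : (K : ℝ) * (P - 1) = N * P + ⌈|γ + δ|⌉₊ * P - K := by rw [hK]; push_cast; ring
  rw [h2, h4, hPQ]
  linarith

/-- The left side is the squared scale times the density of K^{0,-γ} with respect to dt/t dx. The
right side cancels against the squared denominator t^(n+1) of the dual functions, so their norms do
not depend on the radial position. -/
theorem dual_weight_le (n : ℕ) (γ : ℝ) : ∃ C : ℝ, 0 < C ∧ ∀ M r : ℝ, |r| ≤ 1 →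
    frameScale n γ M ^ 2 * (min (Real.exp (M + r)) 1 ^ (-2 * -γ) * Real.exp (M + r) ^ (n + 1)) ≤
      C * (Real.exp (M + r) ^ (n + 1)) ^ 2 := by
  refine ⟨Real.exp ((n + 1) + |2 * γ|), by positivity, fun M r hr => ?_⟩
  have hr' := abs_le.1 hr
  have hmin : min (Real.exp (M + r)) 1 = Real.exp (min (M + r) 0) := by
    rw [← Real.exp_zero, ← Real.exp_monotone.map_min]
  rw [hmin, ← Real.exp_mul, frameScale, ← Real.exp_nat_mul, ← Real.exp_nat_mul, ← Real.exp_nat_mul,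
    ← Real.exp_add, ← Real.exp_add, ← Real.exp_add]
  refine Real.exp_le_exp.2 ?_
  push_cast
  -- The second term is -min(M, 0), and x ↦ min(x, 0) is 1-Lipschitz.
  have h1 : |min (M + r) 0 + max (-M) 0| ≤ 1 := by
    rw [abs_le]
    rcases le_total 0 M with h | h <;> rcases le_total 0 (M + r) with h' | h' <;>
      simp only [h, h', min_eq_left, min_eq_right, max_eq_left, max_eq_right, Left.neg_nonpos_iff,
        Left.nonneg_neg_iff] <;> constructor <;> linarith
  have h2 := mul_le_abs_of_abs_le_one (a := 2 * γ) h1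
  nlinarith [hr'.1, hr'.2]

end Weights

/-! ### Coordinate patches -/

section Patch

variable (n : ℕ) {X : Type*} [TopologicalSpace X] [ChartedSpace (EuclideanSpace ℝ (Fin n)) X]
  [IsManifold (𝓡 n) ∞ X] [MeasurableSpace X] [BorelSpace X] (μ : Measure X)

/-- A coordinate patch with global extensions of the local coordinates and of the coordinate vector
fields near a closed set `K`, and with the density `w` that turns `μ` into Lebesgue measure in these
coordinates on `K`. -/
structure ChartPatch where
  K : Set X
  φ : X → ℝ
  η : X → ℝ
  w : X → ℝ
  κ : X → EuclideanSpace ℝ (Fin n)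
  V : Fin n → ∀ x : X, TangentSpace (𝓡 n) x
  isClosed_K : IsClosed K
  smooth_φ : IsSmooth n fun x => (φ x : ℂ)
  smooth_η : IsSmooth n fun x => (η x : ℂ)
  smooth_κ : ContMDiff (𝓡 n) 𝓘(ℝ, EuclideanSpace ℝ (Fin n)) ∞ κ
  smooth_V : ∀ a, IsSmoothField (V a)
  measurable_w : Measurable w
  bound_w : ∃ C : ℝ, ∀ x, |w x| ≤ C
  φ_eq_zero : ∀ x ∉ K, φ x = 0
  η_eq_one : ∀ x ∈ K, η x = 1
  κ_lt : ∀ x, η x ≠ 0 → ∀ a, |κ x a| < 1 / 2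
  κ_le : ∀ x ∈ K, ∀ a, |κ x a| ≤ 3 / 8
  κ_inj : ∀ x ∈ K, ∀ x', η x' ≠ 0 → κ x' = κ x → x' = x
  lieD_κ : ∀ x ∈ K, ∀ a b, lieD (V a) (fun x => ((κ x b : ℝ) : ℂ)) x = if a = b then 1 else 0
  integral_lieD : ∀ a, ∀ F : X → ℂ, IsSmooth n F → (∀ x ∉ K, F x = 0) →
    ∫ x, lieD (V a) F x * (w x : ℂ) ∂μ = 0
  extend : ∀ F : ℝ × X → ℂ, Continuous F → (∀ q : ℝ × X, q.2 ∉ K → F q = 0) →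
    ∃ G : ℝ × EuclideanSpace ℝ (Fin n) → ℂ, Continuous G ∧
      (∀ r, ∀ x ∈ K, G (r, κ x) = F (r, x)) ∧ (∀ r y, G (r, y) ≠ 0 → ∃ x ∈ K, κ x = y) ∧
      ∀ r, ∀ g : EuclideanSpace ℝ (Fin n) → ℂ, Continuous g →
        ∫ x, F (r, x) * g (κ x) * (w x : ℂ) ∂μ = ∫ y, G (r, y) * g y

end Patch

/-! ### Decay of coefficients by integration by parts -/

section Coefficients

variable {n : ℕ} {X : Type*} [TopologicalSpace X] [ChartedSpace (EuclideanSpace ℝ (Fin n)) X]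

/-- Smooth functions supported in `[-1/2, 1/2]`. -/
structure IsCutoff (χ : ℝ → ℂ) : Prop where
  contDiff : ContDiff ℝ ∞ χ
  eq_zero : ∀ r ∉ Icc (-(1 / 2) : ℝ) (1 / 2), χ r = 0

theorem IsCutoff.deriv {χ : ℝ → ℂ} (h : IsCutoff χ) : IsCutoff (deriv χ) := by
  refine ⟨(contDiff_infty_iff_deriv.1 h.contDiff).2, fun r hr => ?_⟩
  rw [← iteratedDeriv_one]
  exact iteratedDeriv_eq_zero_of_notMem isClosed_Icc h.eq_zero 1 hr

theorem IsCutoff.hasCompactSupport {χ : ℝ → ℂ} (h : IsCutoff χ) : HasCompactSupport χ :=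
  HasCompactSupport.intro isCompact_Icc h.eq_zero

theorem IsCutoff.osc {χ : ℝ → ℂ} (h : IsCutoff χ) (k : ℤ) : IsCutoff (osc χ k) :=
  ⟨contDiff_osc h.contDiff k, fun r hr => by simp [ConeGreen.osc, h.eq_zero r hr]⟩

theorem SmoothOnCone.continuous_logCoord {u : ℝ × X → ℂ} (hu : SmoothOnCone n u) (M : ℝ) :
    Continuous fun q => u (logCoord M q) :=
  (ContMDiffOn.continuousOn hu).comp_continuous (ConeGreen.continuous_logCoord M)
    (logCoord_mem_cone M)

variable [IsManifold (𝓡 n) ∞ X]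

theorem SmoothOnCone.hasDerivAt_logCoord {u : ℝ × X → ℂ} (hu : SmoothOnCone n u) (M r : ℝ) (x : X) :
    HasDerivAt (fun r => u (logCoord M (r, x))) (ConeGreen.radialDeriv u (logCoord M (r, x))) r := by
  have h1 := (hu.differentiableAt_radial (logCoord_mem_cone M (r, x))).hasDerivAt
  have h2 : HasDerivAt (fun r : ℝ => Real.exp (M + r)) (Real.exp (M + r)) r := by
    simpa using ((hasDerivAt_id r).const_add M).exp
  have h3 := h1.scomp r h2
  rw [Complex.real_smul] at h3
  exact h3

theorem lieD_eq_zero {V : ∀ x : X, TangentSpace (𝓡 n) x} {K : Set X} (hK : IsClosed K) {f : X → ℂ}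
    (hf : ∀ x ∉ K, f x = 0) {x : X} (hx : x ∉ K) : lieD V f x = 0 := by
  have h : f =ᶠ[𝓝 x] fun _ => 0 := by
    filter_upwards [hK.isOpen_compl.mem_nhds hx] with y hy
    exact hf y hy
  rw [lieD, h.mfderiv_eq, mfderiv_const]
  rfl

variable [MeasurableSpace X] [BorelSpace X] {μ : Measure X}

/-- The weight with which the coefficients of a function are formed. -/
def ChartPatch.test (P : ChartPatch n μ) (χ : ℝ → ℂ) (φ : X → ℂ) (k : ℤ × (Fin n → ℤ))
    (q : ℝ × X) : ℂ :=
  osc χ (-k.1) q.1 * (φ q.2 * character (-k) 0 (P.κ q.2)) * (P.w q.2 : ℂ)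

/-- The coefficients of a function in logarithmic coordinates. -/
def ChartPatch.fint (P : ChartPatch n μ) (M : ℝ) (χ : ℝ → ℂ) (φ : X → ℂ) (k : ℤ × (Fin n → ℤ))
    (u : ℝ × X → ℂ) : ℂ :=
  ∫ q, u (logCoord M q) * P.test χ φ k q ∂volume.prod μ

variable [CompactSpace X] [IsFiniteMeasure μ]

theorem ChartPatch.exists_bound_test (P : ChartPatch n μ) {χ : ℝ → ℂ} (hχ : IsCutoff χ)
    {φ : X → ℂ} (hφ : IsSmooth n φ) : ∃ C : ℝ, 0 ≤ C ∧ ∀ k q, ‖P.test χ φ k q‖ ≤ C := by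
  obtain ⟨A, hA⟩ := hχ.hasCompactSupport.exists_bound_of_continuous hχ.contDiff.continuous
  obtain ⟨B, hB⟩ := isCompact_univ.exists_bound_of_continuousOn
    (ContMDiff.continuous hφ).continuousOn
  obtain ⟨C, hC⟩ := P.bound_w
  refine ⟨|A| * |B| * |C|, by positivity, fun k q => ?_⟩
  rw [ChartPatch.test, norm_mul, norm_mul, norm_mul, norm_osc, norm_character, mul_one,
    Complex.norm_real, Real.norm_eq_abs]
  exact mul_le_mul (mul_le_mul ((hA _).trans (le_abs_self _)) ((hB _ trivial).trans (le_abs_self _))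
    (norm_nonneg _) (abs_nonneg _)) ((hC _).trans (le_abs_self _)) (abs_nonneg _) (by positivity)

theorem ChartPatch.test_eq_zero (P : ChartPatch n μ) {χ : ℝ → ℂ} (hχ : IsCutoff χ)
    {φ : X → ℂ} (k) {q : ℝ × X} (hq : q ∉ slab X) : P.test χ φ k q = 0 := by
  have : χ q.1 = 0 := hχ.eq_zero _ fun h => hq ⟨h, trivial⟩
  simp [ChartPatch.test, osc, this]

theorem continuous_character (k : ℤ × (Fin n → ℤ)) :
    Continuous fun q : ℝ × EuclideanSpace ℝ (Fin n) => character k q.1 q.2 := by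
  unfold character phase
  fun_prop

theorem ChartPatch.measurable_test (P : ChartPatch n μ) {χ : ℝ → ℂ} (hχ : IsCutoff χ)
    {φ : X → ℂ} (hφ : IsSmooth n φ) (k) : Measurable (P.test χ φ k) := by
  have h1 : Continuous fun q : ℝ × X =>
      osc χ (-k.1) q.1 * (φ q.2 * character (-k) 0 (P.κ q.2)) := by
    refine ((hχ.osc _).contDiff.continuous.comp continuous_fst).mul ?_
    exact ((ContMDiff.continuous hφ).mul
      (ContMDiff.continuous (isSmooth_character P.smooth_κ (-k)))).comp continuous_snd
  exact h1.measurable.mul (Complex.measurable_ofReal.comp (P.measurable_w.comp measurable_snd))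

theorem exists_bound_slab {F : ℝ × X → ℂ} (hF : Continuous F) : ∃ B, ∀ q ∈ slab X, ‖F q‖ ≤ B :=
  (isCompact_Icc.prod isCompact_univ).exists_bound_of_continuousOn hF.continuousOn

theorem ChartPatch.integrable_fint (P : ChartPatch n μ) {χ : ℝ → ℂ} (hχ : IsCutoff χ)
    {φ : X → ℂ} (hφ : IsSmooth n φ) (k) {F : ℝ × X → ℂ} (hF : Continuous F) :
    Integrable (fun q => F q * P.test χ φ k q) (volume.prod μ) := by
  obtain ⟨B, hB⟩ := exists_bound_slab hF
  obtain ⟨C, hC0, hC⟩ := P.exists_bound_test hχ hφ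
  refine integrable_of_slab (B := B * C)
    (hF.measurable.mul (P.measurable_test hχ hφ k)).aestronglyMeasurable (fun q hq => ?_)
    fun q hq => by rw [P.test_eq_zero hχ k hq, mul_zero]
  rw [norm_mul]
  exact mul_le_mul (hB q hq) (hC k q) (norm_nonneg _) ((norm_nonneg _).trans (hB q hq))

theorem integrableOn_slab {F : ℝ × X → ℂ} (hF : Continuous F) :
    IntegrableOn F (slab X) (volume.prod μ) := by
  obtain ⟨B, hB⟩ := exists_bound_slab hF
  refine IntegrableOn.of_bound ?_ hF.aestronglyMeasurable B ?_
  · rw [measure_slab]; exact measure_lt_top μ univ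
  · filter_upwards [ae_restrict_mem measurableSet_slab] with q hq
    exact hB q hq

theorem ChartPatch.norm_fint_le (P : ChartPatch n μ) {χ : ℝ → ℂ} (hχ : IsCutoff χ)
    {φ : X → ℂ} (hφ : IsSmooth n φ) : ∃ C : ℝ, 0 ≤ C ∧ ∀ (M : ℝ) (k) (u : ℝ × X → ℂ),
      SmoothOnCone n u →
        ‖P.fint M χ φ k u‖ ≤ C * ∫ q in slab X, ‖u (logCoord M q)‖ ∂volume.prod μ := by
  obtain ⟨C, hC0, hC⟩ := P.exists_bound_test hχ hφ
  refine ⟨C, hC0, fun M k u hu => (norm_integral_le_integral_norm _).trans ?_⟩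
  have hc := hu.continuous_logCoord M
  rw [← setIntegral_eq_integral_of_forall_compl_eq_zero (s := slab X)
    fun q hq => by rw [P.test_eq_zero hχ k hq, mul_zero, norm_zero], ← integral_const_mul]
  refine setIntegral_mono (P.integrable_fint hχ hφ k hc).norm.integrableOn
    ((integrableOn_slab hc).norm.const_mul C) fun q => ?_
  rw [norm_mul, mul_comm]
  exact mul_le_mul_of_nonneg_right (hC k q) (norm_nonneg _)

/-- Integration by parts in r: a factor 2πik₀ is traded for a derivative of the cut-off or of `u`,
and in logarithmic coordinates the latter is t∂_t u. There is no boundary term because χ has compact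
support. -/
theorem ChartPatch.fint_radial (P : ChartPatch n μ) {χ : ℝ → ℂ} (hχ : IsCutoff χ)
    {φ : X → ℂ} (hφ : IsSmooth n φ) (M : ℝ) (k) {u : ℝ × X → ℂ} (hu : SmoothOnCone n u) :
    (2 * Real.pi * Complex.I * k.1) * P.fint M χ φ k u =
      P.fint M (deriv χ) φ k u + P.fint M χ φ k (radialDeriv u) := by
  have i1 := P.integrable_fint hχ hφ k (hu.continuous_logCoord M)
  have i2 := P.integrable_fint hχ.deriv hφ k (hu.continuous_logCoord M)
  have i3 := P.integrable_fint hχ hφ k (hu.radialDeriv.continuous_logCoord M)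
  have i4 := (i2.add i3).sub (i1.const_mul (2 * Real.pi * Complex.I * k.1))
  have e := integral_sub (i2.add i3) (i1.const_mul (2 * Real.pi * Complex.I * k.1))
  simp only [Pi.add_apply] at e
  rw [integral_add i2 i3, integral_const_mul] at e
  refine (sub_eq_zero.1 ?_).symm
  rw [ChartPatch.fint, ChartPatch.fint, ChartPatch.fint, ← e]
  -- The integral over r is taken first, for fixed `x`; it is the integral of the derivative of a
  -- compactly supported function.
  refine (integral_prod_symm _ i4).trans ?_
  refine integral_eq_zero_of_ae (ae_of_all _ fun x => ?_)
  simp only [Pi.zero_apply]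
  have hd : ∀ r, HasDerivAt (fun r => u (logCoord M (r, x)) * osc χ (-k.1) r)
      (radialDeriv u (logCoord M (r, x)) * osc χ (-k.1) r +
        u (logCoord M (r, x)) * deriv (osc χ (-k.1)) r) r := fun r =>
    (hu.hasDerivAt_logCoord M r x).mul
      ((hχ.osc (-k.1)).contDiff.differentiable (by simp) r).hasDerivAt
  have hx : Continuous fun r : ℝ => ((r, x) : ℝ × X) := by fun_prop
  have c1 := (hu.continuous_logCoord M).comp hx
  have c2 := (hu.radialDeriv.continuous_logCoord M).comp hx
  have c3 := (hχ.osc (-k.1)).contDiff.continuous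
  have c4 := (hχ.osc (-k.1)).deriv.contDiff.continuous
  have s3 := (hχ.osc (-k.1)).hasCompactSupport
  have s4 := (hχ.osc (-k.1)).deriv.hasCompactSupport
  have h := integral_eq_zero_of_hasDerivAt_of_integrable hd
    (((c2.mul c3).integrable_of_hasCompactSupport s3.mul_left).add
      ((c1.mul c4).integrable_of_hasCompactSupport s4.mul_left))
    ((c1.mul c3).integrable_of_hasCompactSupport s3.mul_left)
  have h' := congrArg (fun a => a * (φ x * character (-k) 0 (P.κ x) * (P.w x : ℂ))) h
  simp only [zero_mul] at h'
  rw [← integral_mul_const] at h'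
  rw [← h']
  refine integral_congr_ae (ae_of_all _ fun r => ?_)
  simp only [ChartPatch.test, deriv_osc hχ.contDiff, Pi.add_apply, Pi.sub_apply, Int.cast_neg]
  ring

/-- Integration by parts along `V a`, whose integral against `w` vanishes on functions supported in
`K`. On `K` the field differentiates exactly the a-th coordinate, hence produces the frequency k_a;
off `K` everything vanishes with φ. -/
theorem ChartPatch.fint_field (P : ChartPatch n μ) {χ : ℝ → ℂ} (hχ : IsCutoff χ)
    {φ : X → ℂ} (hφ : IsSmooth n φ) (h0 : ∀ x ∉ P.K, φ x = 0) (M : ℝ) (k) (a : Fin n)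
    {u : ℝ × X → ℂ} (hu : SmoothOnCone n u) :
    (2 * Real.pi * Complex.I * k.2 a) * P.fint M χ φ k u =
      P.fint M χ (lieD (P.V a) φ) k u + P.fint M χ φ k (sliceOp (lieD (P.V a)) u) := by
  have hV := P.smooth_V a
  have hu' : SmoothOnCone n (sliceOp (lieD (P.V a)) u) :=
    (IsDiffOp.vectorField _ hV).smoothOnCone hu
  have i1 := P.integrable_fint hχ hφ k (hu.continuous_logCoord M)
  have i2 := P.integrable_fint hχ (hφ.lieD hV) k (hu.continuous_logCoord M)
  have i3 := P.integrable_fint hχ hφ k (hu'.continuous_logCoord M)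
  have i4 := (i2.add i3).sub (i1.const_mul (2 * Real.pi * Complex.I * k.2 a))
  have e := integral_sub (i2.add i3) (i1.const_mul (2 * Real.pi * Complex.I * k.2 a))
  simp only [Pi.add_apply] at e
  rw [integral_add i2 i3, integral_const_mul] at e
  refine (sub_eq_zero.1 ?_).symm
  rw [ChartPatch.fint, ChartPatch.fint, ChartPatch.fint, ← e]
  refine (integral_prod _ i4).trans ?_
  refine integral_eq_zero_of_ae (ae_of_all _ fun r => ?_)
  simp only [Pi.zero_apply]
  have hv : IsSmooth n fun x => u (logCoord M (r, x)) :=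
    hu.isSmooth_slice (Real.exp_pos (M + r))
  have hc := isSmooth_character P.smooth_κ (-k)
  have h := P.integral_lieD a _ (hv.mul (hφ.mul hc)) fun x hx => by simp [h0 x hx]
  have h' := congrArg (fun b => osc χ (-k.1) r * b) h
  simp only [mul_zero] at h'
  rw [← integral_const_mul] at h'
  rw [← h']
  refine integral_congr_ae (ae_of_all _ fun x => ?_)
  simp only [ChartPatch.test, Pi.add_apply, Pi.sub_apply]
  rw [lieD_mul hV hv (hφ.mul hc), lieD_mul hV hφ hc, lieD_character hV P.smooth_κ]
  have e : sliceOp (lieD (P.V a)) u (logCoord M (r, x)) =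
    lieD (P.V a) (fun x => u (logCoord M (r, x))) x := rfl
  rw [e]
  by_cases hx : x ∈ P.K
  · simp only [P.lieD_κ x hx, mul_ite, mul_one, mul_zero, Finset.sum_ite_eq, Finset.mem_univ,
      if_true, Prod.snd_neg, Pi.neg_apply, Int.cast_neg]
    ring
  · rw [h0 x hx, lieD_eq_zero P.isClosed_K h0 hx]
    ring

theorem two_pi_mul_norm_le (k : ℤ) (z : ℂ) :
    |(k : ℝ)| * ‖z‖ ≤ ‖(2 * Real.pi * Complex.I * k) * z‖ := by
  have h1 : ‖(2 * Real.pi * Complex.I * (k : ℂ))‖ = 2 * Real.pi * |(k : ℝ)| := by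
    simp [abs_of_pos Real.pi_pos]
  rw [norm_mul, h1]
  refine mul_le_mul_of_nonneg_right ?_ (norm_nonneg _)
  exact le_mul_of_one_le_left (abs_nonneg _) (by linarith [Real.pi_gt_three])

theorem sum_succ_le {I I' : ℕ → ℝ} (hI : ∀ l, 0 ≤ I l) (hI' : ∀ l, I' l = I (l + 1)) {C C' : ℝ}
    (hC : 0 ≤ C) (hC' : 0 ≤ C') (N : ℕ) :
    C' * ∑ l ∈ Finset.range (N + 1), I l + C * ∑ l ∈ Finset.range (N + 1), I' l ≤
      (C' + C) * ∑ l ∈ Finset.range (N + 1 + 1), I l := by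
  rw [add_mul]
  refine add_le_add (mul_le_mul_of_nonneg_left ?_ hC') (mul_le_mul_of_nonneg_left ?_ hC)
  · rw [Finset.sum_range_succ _ (N + 1)]
    exact le_add_of_nonneg_right (hI _)
  · simp only [hI']
    rw [Finset.sum_range_succ' _ (N + 1)]
    exact le_add_of_nonneg_right (hI _)

/-- Repeated use of `fint_radial`. The cut-off is quantified inside the induction because one term
of each step has it replaced by its derivative. -/
theorem ChartPatch.fint_radial_bound (P : ChartPatch n μ) (N : ℕ) : ∀ {χ : ℝ → ℂ}, IsCutoff χ →
    ∀ {φ : X → ℂ}, IsSmooth n φ → ∃ C : ℝ, 0 ≤ C ∧ ∀ (M : ℝ) (k) (u : ℝ × X → ℂ),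
      SmoothOnCone n u → |(k.1 : ℝ)| ^ N * ‖P.fint M χ φ k u‖ ≤ C * ∑ l ∈ Finset.range (N + 1),
        ∫ q in slab X, ‖radialDeriv^[l] u (logCoord M q)‖ ∂volume.prod μ := by
  induction N with
  | zero =>
    intro χ hχ φ hφ
    simpa using P.norm_fint_le hχ hφ
  | succ N ih =>
    intro χ hχ φ hφ
    obtain ⟨C, hC, h⟩ := ih hχ hφ
    obtain ⟨C', hC', h'⟩ := ih hχ.deriv hφ
    refine ⟨C' + C, by positivity, fun M k u hu => ?_⟩
    refine le_trans ?_ (sum_succ_le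
      (I := fun l => ∫ q in slab X, ‖radialDeriv^[l] u (logCoord M q)‖ ∂volume.prod μ)
      (fun l => by positivity) (fun l => rfl) hC hC' N)
    refine le_trans ?_ (add_le_add (h' M k u hu) (h M k _ hu.radialDeriv))
    rw [pow_succ, mul_assoc, ← mul_add]
    refine mul_le_mul_of_nonneg_left ?_ (by positivity)
    refine (two_pi_mul_norm_le _ _).trans ?_
    rw [P.fint_radial hχ hφ M k hu]
    exact norm_add_le _ _

theorem ChartPatch.fint_field_bound (P : ChartPatch n μ) (a : Fin n) (N : ℕ) {χ : ℝ → ℂ}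
    (hχ : IsCutoff χ) : ∀ {φ : X → ℂ}, IsSmooth n φ → (∀ x ∉ P.K, φ x = 0) → ∃ C : ℝ, 0 ≤ C ∧
      ∀ (M : ℝ) (k) (u : ℝ × X → ℂ), SmoothOnCone n u →
      |(k.2 a : ℝ)| ^ N * ‖P.fint M χ φ k u‖ ≤ C * ∑ l ∈ Finset.range (N + 1),
        ∫ q in slab X, ‖sliceOp ((lieD (P.V a))^[l]) u (logCoord M q)‖ ∂volume.prod μ := by
  induction N with
  | zero =>
    intro φ hφ h0
    simpa [sliceOp] using P.norm_fint_le hχ hφ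
  | succ N ih =>
    intro φ hφ h0
    have hV := P.smooth_V a
    obtain ⟨C, hC, h⟩ := ih hφ h0
    obtain ⟨C', hC', h'⟩ := ih (hφ.lieD hV) fun x hx => lieD_eq_zero P.isClosed_K h0 hx
    refine ⟨C' + C, by positivity, fun M k u hu => ?_⟩
    refine le_trans ?_ (sum_succ_le
      (I := fun l => ∫ q in slab X, ‖sliceOp ((lieD (P.V a))^[l]) u (logCoord M q)‖ ∂volume.prod μ)
      (fun l => by positivity) (fun l => rfl) hC hC' N)
    refine le_trans ?_ (add_le_add (h' M k u hu) (h M k (sliceOp (lieD (P.V a)) u)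
      ((IsDiffOp.vectorField _ hV).smoothOnCone hu)))
    rw [pow_succ, mul_assoc, ← mul_add]
    refine mul_le_mul_of_nonneg_left ?_ (by positivity)
    refine (two_pi_mul_norm_le _ _).trans ?_
    rw [P.fint_field hχ hφ h0 M k a hu]
    exact norm_add_le _ _

theorem isDiffOp_iterate_lieD {V : ∀ x : X, TangentSpace (𝓡 n) x} (hV : IsSmoothField V) (l : ℕ) :
    IsDiffOp n ((lieD V)^[l]) := by
  induction l with
  | zero =>
    refine (congrArg (IsDiffOp n) (funext fun f => funext fun x => ?_)).mp isDiffOp_one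
    simp
  | succ l ih => exact ih.comp (IsDiffOp.vectorField V hV)

end Coefficients

/-! ### The radial partition of unity -/

section RadialCutoffs

/-- The radial partition function, supported in `[-1/4, 1/4]`. -/
def radialPart (r : ℝ) : ℝ :=
  Real.smoothTransition (1 + 4 * r) * Real.smoothTransition (1 - 4 * r)

/-- A cut-off function that is `1` on `[-1/4, 1/4]` and supported in `[-3/8, 3/8]`. -/
def radialBump (r : ℝ) : ℝ :=
  Real.smoothTransition (3 + 8 * r) * Real.smoothTransition (3 - 8 * r)

theorem smoothTransition_add (s : ℝ) :
    Real.smoothTransition s + Real.smoothTransition (1 - s) = 1 := by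
  have h := Real.smoothTransition.pos_denom s
  rw [Real.smoothTransition, Real.smoothTransition, sub_sub_cancel,
    add_comm (expNegInvGlue (1 - s)) (expNegInvGlue s), ← add_div, div_self h.ne']

/-- Only m = ⌊4s⌋ and m = ⌊4s⌋ + 1 contribute. Their values are the smooth transition at 1 - x and
at x, with x the fractional part of 4s, and these add up to 1. -/
theorem hasSum_radialPart (s : ℝ) : HasSum (fun m : ℤ => radialPart (s - m / 4)) 1 := by
  set f : ℤ := ⌊4 * s⌋ with hf
  have h1 : (f : ℝ) ≤ 4 * s := Int.floor_le _
  have h2 : 4 * s < f + 1 := Int.lt_floor_add_one _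
  have hz : ∀ m ∉ ({f, f + 1} : Finset ℤ), radialPart (s - m / 4) = 0 := by
    intro m hm
    simp only [Finset.mem_insert, Finset.mem_singleton, not_or] at hm
    rcases lt_or_gt_of_ne hm.1 with h | h
    · have h3 : (m : ℝ) + 1 ≤ f := by exact_mod_cast h
      rw [radialPart, Real.smoothTransition.zero_of_nonpos (x := 1 - 4 * (s - m / 4)) (by linarith),
        mul_zero]
    · have h4 : f + 2 ≤ m := by omega
      have h3 : (f : ℝ) + 2 ≤ m := by exact_mod_cast h4
      rw [radialPart, Real.smoothTransition.zero_of_nonpos (x := 1 + 4 * (s - m / 4)) (by linarith),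
        zero_mul]
  have h : HasSum (fun m : ℤ => radialPart (s - m / 4)) (∑ m ∈ {f, f + 1}, radialPart (s - m / 4)) :=
    hasSum_sum_of_ne_finset_zero hz
  rw [Finset.sum_pair (by omega)] at h
  have e1 : radialPart (s - f / 4) = Real.smoothTransition (1 - (4 * s - f)) := by
    rw [radialPart, Real.smoothTransition.one_of_one_le (x := 1 + 4 * (s - f / 4)) (by linarith),
      one_mul]
    congr 1; ring
  have e2 : radialPart (s - (f + 1 : ℤ) / 4) = Real.smoothTransition (4 * s - f) := by
    rw [radialPart, Real.smoothTransition.one_of_one_le (x := 1 - 4 * (s - (f + 1 : ℤ) / 4))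
      (by push_cast; linarith), mul_one]
    congr 1; push_cast; ring
  rw [e1, e2, add_comm, smoothTransition_add] at h
  exact h

theorem abs_le_of_radialPart_ne_zero {r : ℝ} (h : radialPart r ≠ 0) : |r| ≤ 1 / 4 := by
  by_contra hr
  rw [abs_le, not_and_or, not_le, not_le] at hr
  rcases hr with hr | hr
  · exact h (by rw [radialPart, Real.smoothTransition.zero_of_nonpos (x := 1 + 4 * r) (by linarith),
      zero_mul])
  · exact h (by rw [radialPart, Real.smoothTransition.zero_of_nonpos (x := 1 - 4 * r) (by linarith),
      mul_zero])

theorem abs_lt_of_radialBump_ne_zero {r : ℝ} (h : radialBump r ≠ 0) : |r| < 3 / 8 := by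
  by_contra hr
  rw [abs_lt, not_and_or, not_lt, not_lt] at hr
  rcases hr with hr | hr
  · exact h (by rw [radialBump, Real.smoothTransition.zero_of_nonpos (x := 3 + 8 * r) (by linarith),
      zero_mul])
  · exact h (by rw [radialBump, Real.smoothTransition.zero_of_nonpos (x := 3 - 8 * r) (by linarith),
      mul_zero])

theorem radialBump_mul_radialPart (r : ℝ) : radialBump r * radialPart r = radialPart r := by
  by_cases h : radialPart r = 0
  · rw [h, mul_zero]
  · have hr := abs_le.1 (abs_le_of_radialPart_ne_zero h)
    rw [radialBump, Real.smoothTransition.one_of_one_le (x := 3 + 8 * r) (by linarith),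
      Real.smoothTransition.one_of_one_le (x := 3 - 8 * r) (by linarith), one_mul, one_mul]

theorem isCutoff_radialPart : IsCutoff fun r => (radialPart r : ℂ) := by
  refine ⟨Complex.ofRealCLM.contDiff.comp ?_, fun r hr => ?_⟩
  · exact (Real.smoothTransition.contDiff.comp (by fun_prop)).mul
      (Real.smoothTransition.contDiff.comp (by fun_prop))
  · by_contra h
    have := abs_le.1 (abs_le_of_radialPart_ne_zero fun h' => h (by rw [h', Complex.ofReal_zero]))
    exact hr ⟨by linarith, by linarith⟩

theorem isCutoff_radialBump : IsCutoff fun r => (radialBump r : ℂ) := by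
  refine ⟨Complex.ofRealCLM.contDiff.comp ?_, fun r hr => ?_⟩
  · exact (Real.smoothTransition.contDiff.comp (by fun_prop)).mul
      (Real.smoothTransition.contDiff.comp (by fun_prop))
  · by_contra h
    have := abs_lt.1 (abs_lt_of_radialBump_ne_zero fun h' => h (by rw [h', Complex.ofReal_zero]))
    exact hr ⟨by linarith, by linarith⟩

end RadialCutoffs

/-! ### Growth rates and their summability -/

section Rates

/-- The indices of the frame: a patch, a radial position and a frequency. -/
abbrev FrameIndex (n m : ℕ) : Type := (Fin m × ℤ) × (ℤ × (Fin n → ℤ))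

variable {n m : ℕ}

/-- The logarithmic radial position of a frame function. -/
def FrameIndex.center (j : FrameIndex n m) : ℝ := j.1.2 / 4

/-- The growth of the frame functions. -/
def frameRate (δ : ℝ) (N : ℕ) (j : FrameIndex n m) : ℝ :=
  freqWeight j.2 ^ N * Real.exp (δ * max (-j.center) 0 + N * max j.center 0)

theorem frameRate_pos (δ : ℝ) (N : ℕ) (j : FrameIndex n m) : 0 < frameRate δ N j :=
  mul_pos (pow_pos (zero_lt_one.trans_le (one_le_freqWeight _)) _) (Real.exp_pos _)

theorem frameRate_mono {δ δ' : ℝ} {N N' : ℕ} (hδ : δ ≤ δ') (hN : N ≤ N') (j : FrameIndex n m) :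
    frameRate δ N j ≤ frameRate δ' N' j := by
  have h0 := zero_le_one.trans (one_le_freqWeight j.2)
  refine mul_le_mul (freqWeight_pow_mono _ hN) (Real.exp_le_exp.2 ?_) (Real.exp_pos _).le
    (pow_nonneg h0 _)
  have : (N : ℝ) ≤ N' := by exact_mod_cast hN
  exact add_le_add (mul_le_mul_of_nonneg_right hδ (le_max_right _ _))
    (mul_le_mul_of_nonneg_right this (le_max_right _ _))

theorem frameRate_add (δ δ' : ℝ) (N N' : ℕ) (j : FrameIndex n m) :
    frameRate (δ + δ') (N + N') j = frameRate δ N j * frameRate δ' N' j := by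
  have : (δ + δ') * max (-j.center) 0 + ((N + N' : ℕ) : ℝ) * max j.center 0 =
      (δ * max (-j.center) 0 + N * max j.center 0) +
        (δ' * max (-j.center) 0 + N' * max j.center 0) := by push_cast; ring
  rw [frameRate, frameRate, frameRate, this, Real.exp_add, pow_add]
  ring

/-- Two geometric series: δ > 0 gives convergence towards t = 0 and N ≥ 1 towards t = ∞. A strictly
positive δ is indispensable, which is why part of the gap below ε is always spent on it. -/
theorem summable_exp_center {δ : ℝ} (hδ : 0 < δ) {N : ℕ} (hN : 1 ≤ N) : Summable fun k : ℤ =>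
    (Real.exp (δ * max (-((k : ℝ) / 4)) 0 + N * max ((k : ℝ) / 4) 0))⁻¹ := by
  have hgeo : ∀ c : ℝ, 0 < c → Summable fun k : ℕ => Real.exp (-(c * ((k : ℝ) / 4))) := by
    intro c hc
    have h1 : Summable fun k : ℕ => Real.exp (-(c / 4)) ^ k :=
      summable_geometric_of_lt_one (Real.exp_pos _).le 
        ((Real.exp_lt_exp.2 (by linarith : -(c / 4) < 0)).trans_eq Real.exp_zero)
    refine h1.congr fun k => ?_
    rw [← Real.exp_nat_mul]
    congr 1; ring
  have hN' : (0 : ℝ) < N := by exact_mod_cast hN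
  refine Summable.of_nat_of_neg ((hgeo N hN').congr fun k => ?_) ((hgeo δ hδ).congr fun k => ?_)
  · rw [← Real.exp_neg]
    have : (0 : ℝ) ≤ (k : ℝ) / 4 := by positivity
    rw [Int.cast_natCast, max_eq_left this, max_eq_right (by linarith)]
    congr 1; ring
  · rw [← Real.exp_neg]
    have : (0 : ℝ) ≤ (k : ℝ) / 4 := by positivity
    rw [Int.cast_neg, Int.cast_natCast, neg_div, neg_neg, max_eq_left this,
      max_eq_right (by linarith)]
    congr 1; ring

theorem summable_frameRate {δ : ℝ} (hδ : 0 < δ) :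
    Summable fun j : FrameIndex n m => (frameRate δ (2 * (n + 1)) j)⁻¹ := by
  have h1 : Summable fun i : Fin m × ℤ => (1 : ℝ) * (Real.exp (δ * max (-((i.2 : ℝ) / 4)) 0 +
      (2 * (n + 1) : ℕ) * max ((i.2 : ℝ) / 4) 0))⁻¹ :=
    Summable.mul_of_nonneg (f := fun _ : Fin m => (1 : ℝ)) (hasSum_fintype _).summable
      (summable_exp_center hδ (N := 2 * (n + 1)) (by omega)) (fun _ => zero_le_one)
      (fun _ => by simp only [Pi.zero_apply]; positivity)
  have h2 := Summable.mul_of_nonneg h1 (summable_freqWeight_inv n)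
    (fun _ => by simp only [Pi.zero_apply]; positivity) (fun k => by
      have := zero_lt_one.trans_le (one_le_freqWeight k)
      simp only [Pi.zero_apply]; positivity)
  refine h2.congr fun j => ?_
  rw [frameRate, mul_inv, FrameIndex.center, one_mul, mul_comm]

end Rates

/-! ### Size of the frame functions -/

section Elements

variable {n m : ℕ} {X : Type*} [TopologicalSpace X] [ChartedSpace (EuclideanSpace ℝ (Fin n)) X]
  [IsManifold (𝓡 n) ∞ X] [MeasurableSpace X] [BorelSpace X] {μ : Measure X}

/-- The frame functions. -/
def frameElem (P : Fin m → ChartPatch n μ) (γ : ℝ) (j : FrameIndex n m) : ℝ × X → ℂ :=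
  coneFn (fun r => ((frameScale n γ j.center)⁻¹ : ℝ) *
      osc (fun r => (radialBump r : ℂ)) j.2.1 (r - j.center))
    fun x => ((P j.1.1).η x : ℂ) * character j.2 0 ((P j.1.1).κ x)

/-- The dual frame functions. -/
def frameDual (P : Fin m → ChartPatch n μ) (γ : ℝ) (j : FrameIndex n m) : ℝ × X → ℂ :=
  fun z => if 0 < z.1 then (frameScale n γ j.center : ℂ) *
    (P j.1.1).test (fun r => (radialPart r : ℂ)) (fun x => ((P j.1.1).φ x : ℂ)) j.2
      (Real.log z.1 - j.center, z.2) / ((z.1 ^ (n + 1) : ℝ) : ℂ) else 0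

theorem contDiff_frameElem_radial (γ : ℝ) (j : FrameIndex n m) :
    ContDiff ℝ ∞ fun r => ((frameScale n γ j.center)⁻¹ : ℝ) *
      osc (fun r => (radialBump r : ℂ)) j.2.1 (r - j.center) :=
  contDiff_const.mul ((isCutoff_radialBump.osc _).contDiff.comp (contDiff_id.sub contDiff_const))

theorem smoothOnCone_frameElem (P : Fin m → ChartPatch n μ) (γ : ℝ) (j : FrameIndex n m) :
    SmoothOnCone n (frameElem P γ j) :=
  smoothOnCone_coneFn (contDiff_frameElem_radial γ j)
    ((P j.1.1).smooth_η.mul (isSmooth_character (P j.1.1).smooth_κ _))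

theorem coneOp_frameElem (P : Fin m → ChartPatch n μ) (γ : ℝ) (j : FrameIndex n m) (p : ℕ)
    {D : (X → ℂ) → (X → ℂ)} (hD : IsDiffOp n D) (q : ℝ × X) :
    coneOp p D (frameElem P γ j) (logCoord j.center q) = ((frameScale n γ j.center)⁻¹ : ℝ) *
      iteratedDeriv p (osc (fun r => (radialBump r : ℂ)) j.2.1) q.1 *
        D (fun x => ((P j.1.1).η x : ℂ) * character j.2 0 ((P j.1.1).κ x)) q.2 := by
  rw [frameElem, coneOp_coneFn (contDiff_frameElem_radial γ j)
    ((P j.1.1).smooth_η.mul (isSmooth_character (P j.1.1).smooth_κ _)) hD p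
    (logCoord_mem_cone _ _), coneFn_of_pos (Real.exp_pos _)]
  have e : Real.log (logCoord j.center q).1 = j.center + q.1 := Real.log_exp _
  rw [e, iteratedDeriv_const_mul_field, iteratedDeriv_comp_sub_const]
  simp only [add_sub_cancel_left]
  rfl

theorem coneOp_frameElem_eq_zero (P : Fin m → ChartPatch n μ) (γ : ℝ) (j : FrameIndex n m) (p : ℕ)
    {D : (X → ℂ) → (X → ℂ)} (hD : IsDiffOp n D) {q : ℝ × X} (hq : q ∉ slab X) :
    coneOp p D (frameElem P γ j) (logCoord j.center q) = 0 := by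
  rw [coneOp_frameElem P γ j p hD, iteratedDeriv_eq_zero_of_notMem isClosed_Icc
    (isCutoff_radialBump.osc _).eq_zero p fun h => hq ⟨h, trivial⟩, mul_zero, zero_mul]

variable [CompactSpace X]

theorem coneOp_frameElem_bound (P : Fin m → ChartPatch n μ) (p : ℕ)
    {D : (X → ℂ) → (X → ℂ)} (hD : IsDiffOp n D) : ∃ (C : ℝ) (N : ℕ), 0 ≤ C ∧
      ∀ γ (j : FrameIndex n m) (q : ℝ × X), ‖coneOp p D (frameElem P γ j) (logCoord j.center q)‖ ≤
        (frameScale n γ j.center)⁻¹ * (C * freqWeight j.2 ^ N) := by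
  obtain ⟨A, hA, h⟩ := iteratedDeriv_osc_bound p _ isCutoff_radialBump.contDiff
    isCutoff_radialBump.hasCompactSupport
  choose B N hB h' using fun i : Fin m => hD.bound_character (P i).smooth_κ (P i).smooth_η
  -- Sums over the finitely many patches serve as common majorants of the constants and exponents.
  refine ⟨A * ∑ i, B i, p + ∑ i, N i, mul_nonneg hA (Finset.sum_nonneg fun i _ => hB i),
    fun γ j q => ?_⟩
  have hS := frameScale_pos n γ j.center
  have h0 := zero_le_one.trans (one_le_freqWeight j.2)
  rw [coneOp_frameElem P γ j p hD, norm_mul, norm_mul, Complex.norm_real,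
    Real.norm_of_nonneg (inv_pos.2 hS).le, mul_assoc]
  refine mul_le_mul_of_nonneg_left ?_ (inv_pos.2 hS).le
  calc _ ≤ (A * freqWeight j.2 ^ p) * ((∑ i, B i) * freqWeight j.2 ^ (∑ i, N i)) := by
        refine mul_le_mul ((h _ _).trans (mul_le_mul_of_nonneg_left
          (pow_le_pow_left₀ (by positivity) ?_ _) hA)) ((h' j.1.1 _ _).trans ?_) (norm_nonneg _)
          (mul_nonneg hA (pow_nonneg h0 _))
        · have : 0 ≤ ∑ a, |(j.2.2 a : ℝ)| := Finset.sum_nonneg fun a _ => abs_nonneg _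
          unfold freqWeight
          linarith
        · exact le_mul_freqWeight_pow
            (Finset.single_le_sum (f := B) (fun i _ => hB i) (Finset.mem_univ _))
            (Finset.sum_nonneg fun i _ => hB i)
            (Finset.single_le_sum (f := N) (fun i _ => Nat.zero_le _) (Finset.mem_univ _)) _
    _ = _ := by rw [pow_add]; ring

theorem weightedDeriv_frameElem_bound (P : Fin m → ChartPatch n μ) (γ δ : ℝ) (k : ℤ) (p : ℕ)
    {D : (X → ℂ) → (X → ℂ)} (hD : IsDiffOp n D) : ∃ (C : ℝ) (N : ℕ), 0 ≤ C ∧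
      ∀ (j : FrameIndex n m) (q : ℝ × X),
        ‖weightedDeriv n γ δ k p D (frameElem P γ j) (logCoord j.center q)‖ ≤
          C * frameRate δ N j := by
  obtain ⟨A, N, hA, h⟩ := coneOp_frameElem_bound P p hD
  obtain ⟨B, N', hB, h'⟩ := weight_le n γ δ k
  -- `N` is the growth in the frequency and `N'` the growth at t = ∞; the rate has a single exponent
  -- for both, and their sum dominates each.
  refine ⟨B * A, N + N', by positivity, fun j q => ?_⟩
  have hr := frameRate_pos δ (N + N') j
  by_cases hq : q ∈ slab X
  · have hw := h' j.center q.1 ((mem_slab.1 hq).trans (by norm_num))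
    have hS := frameScale_pos n γ j.center
    have h0 := zero_le_one.trans (one_le_freqWeight j.2)
    have hpos : 0 ≤ (logCoord j.center q).1 ^ (((n : ℝ) + 1) / 2 - γ - δ) *
        √(1 + (logCoord j.center q).1 ^ 2) ^ k := by
      have : 0 < (logCoord j.center q).1 := Real.exp_pos _
      positivity
    rw [weightedDeriv, norm_mul, Complex.norm_real, Real.norm_of_nonneg hpos]
    calc _ ≤ ((logCoord j.center q).1 ^ (((n : ℝ) + 1) / 2 - γ - δ) *
          √(1 + (logCoord j.center q).1 ^ 2) ^ k) *
            ((frameScale n γ j.center)⁻¹ * (A * freqWeight j.2 ^ N)) :=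
          mul_le_mul_of_nonneg_left (h γ j q) hpos
      _ = (((logCoord j.center q).1 ^ (((n : ℝ) + 1) / 2 - γ - δ) *
          √(1 + (logCoord j.center q).1 ^ 2) ^ k) * (frameScale n γ j.center)⁻¹) *
            (A * freqWeight j.2 ^ N) := by ring
      _ ≤ (B * Real.exp (δ * max (-j.center) 0 + N' * max j.center 0)) *
            (A * freqWeight j.2 ^ N) :=
          mul_le_mul_of_nonneg_right hw (mul_nonneg hA (pow_nonneg h0 _))
      _ = B * A * (freqWeight j.2 ^ N *
            Real.exp (δ * max (-j.center) 0 + N' * max j.center 0)) := by ring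
      _ ≤ B * A * frameRate δ (N + N') j := by
          refine mul_le_mul_of_nonneg_left ?_ (by positivity)
          refine mul_le_mul (freqWeight_pow_mono _ (by omega)) (Real.exp_le_exp.2 ?_)
            (Real.exp_pos _).le (pow_nonneg h0 _)
          have : (N' : ℝ) ≤ (N + N' : ℕ) := by exact_mod_cast Nat.le_add_left _ _
          gcongr
  · rw [weightedDeriv, coneOp_frameElem_eq_zero P γ j p hD hq, mul_zero, norm_zero]
    positivity

/-- The weighted bound with δ = 0 and k = 0, divided by its power of t. The factor in t is
continuous on (0, ∞) and independent of the index, as termwise differentiation requires. -/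
theorem coneOp_frameElem_bound_rate (P : Fin m → ChartPatch n μ) (γ : ℝ) (p : ℕ)
    {D : (X → ℂ) → (X → ℂ)} (hD : IsDiffOp n D) : ∃ (W : ℝ → ℝ) (N : ℕ), ContinuousOn W (Ioi 0) ∧
      ∀ (j : FrameIndex n m), ∀ z ∈ cone X,
        ‖coneOp p D (frameElem P γ j) z‖ ≤ W z.1 * frameRate 0 N j := by
  obtain ⟨C, N, hC, h⟩ := weightedDeriv_frameElem_bound P γ 0 0 p hD
  refine ⟨fun t => (t ^ (((n : ℝ) + 1) / 2 - γ - 0))⁻¹ * C, N, ?_, fun j z hz => ?_⟩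
  · refine ContinuousOn.mul (ContinuousOn.inv₀ ?_ ?_) continuousOn_const
    · exact continuousOn_id.rpow_const fun t ht => Or.inl (ne_of_gt ht)
    · exact fun t ht => (Real.rpow_pos_of_pos ht _).ne'
  · have ht : 0 < z.1 := hz.1
    have e : logCoord j.center (Real.log z.1 - j.center, z.2) = z := by
      ext
      · simp [logCoord, Real.exp_log ht]
      · rfl
    have h1 := h j (Real.log z.1 - j.center, z.2)
    rw [e, weightedDeriv, zpow_zero, mul_one, norm_mul, Complex.norm_real,
      Real.norm_of_nonneg (by positivity)] at h1
    rw [mul_assoc, ← div_eq_inv_mul, le_div_iff₀ (by positivity), mul_comm]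
    exact h1

variable [IsFiniteMeasure μ]

theorem eLpNorm_frameElem_bound (P : Fin m → ChartPatch n μ) (γ δ : ℝ) (k : ℤ) (p : ℕ)
    {D : (X → ℂ) → (X → ℂ)} (hD : IsDiffOp n D) : ∃ (C : ℝ) (N : ℕ), 0 ≤ C ∧
      ∀ j : FrameIndex n m, eLpNorm (weightedDeriv n γ δ k p D (frameElem P γ j)) 2
        (mellinMeasure μ) ≤ ENNReal.ofReal (C * frameRate δ N j) := by
  obtain ⟨C, N, hC, h⟩ := weightedDeriv_frameElem_bound P γ δ k p hD
  refine ⟨C * √(μ.real univ), N, by positivity, fun j => ?_⟩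
  rw [eLpNorm_mellinMeasure μ j.center]
  have hr := frameRate_pos δ N j
  refine (eLpNorm_le_of_slab (B := C * frameRate δ N j) (by positivity) (fun q _ => h j q)
    fun q hq => ?_).trans (le_of_eq ?_)
  · rw [weightedDeriv, coneOp_frameElem_eq_zero P γ j p hD hq, mul_zero]
  · congr 1; ring

theorem SmoothOnCone.aestronglyMeasurable_mellin {u : ℝ × X → ℂ} (hu : SmoothOnCone n u) :
    AEStronglyMeasurable u (mellinMeasure μ) :=
  ((ContMDiffOn.continuousOn hu).aestronglyMeasurable measurableSet_cone).mono_ac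
    (mellinMeasure_ac μ)

theorem aestronglyMeasurable_weightedDeriv {u : ℝ × X → ℂ} (hu : SmoothOnCone n u) (γ δ : ℝ)
    (k : ℤ) (p : ℕ) {D : (X → ℂ) → (X → ℂ)} (hD : IsDiffOp n D) :
    AEStronglyMeasurable (weightedDeriv n γ δ k p D u) (mellinMeasure μ) := by
  have h1 : Measurable fun z : ℝ × X =>
      ((z.1 ^ (((n : ℝ) + 1) / 2 - γ - δ) * √(1 + z.1 ^ 2) ^ k : ℝ) : ℂ) := by fun_prop
  exact h1.aestronglyMeasurable.mul (coneOp_smooth hD p hu).aestronglyMeasurable_mellin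

theorem frameElem_mem (P : Fin m → ChartPatch n μ) (γ ε : ℝ) (j : FrameIndex n m) :
    frameElem P γ j ∈ coneSchwartzSubmodule n μ γ ε := by
  refine ⟨fun z hz => coneFn_of_notMem hz, smoothOnCone_frameElem P γ j,
    fun k p D hD δ _ _ => ⟨aestronglyMeasurable_weightedDeriv (smoothOnCone_frameElem P γ j)
      γ δ k p hD, ?_⟩⟩
  obtain ⟨C, N, -, h⟩ := eLpNorm_frameElem_bound P γ δ k p hD
  exact (h j).trans_lt ENNReal.ofReal_lt_top

theorem coneSeminorms_eq {γ ε : ℝ} (i : SchwartzIndex n X ε) (u : ConeSchwartz n μ γ ε) :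
    coneSeminorms n μ γ ε i u = (eLpNorm (weightedDeriv n γ i.2.2.2.1 i.1 i.2.1 i.2.2.1.1 u.toFun) 2
      (mellinMeasure μ)).toReal :=
  Lp.norm_toLp _ (u.2.2.2 i.1 i.2.1 i.2.2.1.1 i.2.2.1.2 i.2.2.2.1 i.2.2.2.2.1 i.2.2.2.2.2)

theorem frameElem_seminorm_bound (P : Fin m → ChartPatch n μ) (γ ε : ℝ) (i : SchwartzIndex n X ε) :
    ∃ (C : ℝ) (N : ℕ), ∀ j, coneSeminorms n μ γ ε i
      (ConeSchwartz.mk (frameElem P γ j) (frameElem_mem P γ ε j)) ≤ C * frameRate i.2.2.2.1 N j := by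
  obtain ⟨C, N, hC, h⟩ := eLpNorm_frameElem_bound P γ i.2.2.2.1 i.1 i.2.1 i.2.2.1.2
  refine ⟨C, N, fun j => ?_⟩
  rw [coneSeminorms_eq]
  have hr := frameRate_pos i.2.2.2.1 N j
  exact ENNReal.toReal_le_of_le_ofReal (by positivity) (h j)

end Elements

/-! ### Pointwise and L² sums -/

section LpSeries

/-- Absolute convergence provides some sum `v` in L². A sequence of its partial sums converges
almost everywhere to `v`, and by assumption also to `g`. -/
theorem hasSum_Lp_of_ae {α ι : Type*} [Countable ι] [MeasurableSpace α] {ν : Measure α}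
    {f : ι → Lp ℂ 2 ν} {g : Lp ℂ 2 ν} (hs : Summable fun j => ‖f j‖)
    (hae : ∀ᵐ z ∂ν, HasSum (fun j => f j z) (g z)) : HasSum f g := by
  have hv := hs.of_norm.hasSum
  set v := ∑' j, f j
  suffices h : g = v by rwa [h]
  have hm := tendstoInMeasure_of_tendsto_Lp hv
  obtain ⟨ns, hns, h⟩ := hm.exists_seq_tendsto_ae'
  have hsum : ∀ s : Finset ι, ∀ᵐ z ∂ν, (∑ j ∈ s, f j : Lp ℂ 2 ν) z = ∑ j ∈ s, f j z := by
    classical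
    intro s
    induction s using Finset.induction_on with
    | empty =>
      filter_upwards [Lp.coeFn_zero ℂ 2 ν] with z hz
      simpa using hz
    | insert j s hj ih =>
      rw [Finset.sum_insert hj]
      filter_upwards [Lp.coeFn_add (f j) (∑ j ∈ s, f j), ih] with z h1 h2
      rw [h1, Pi.add_apply, h2, Finset.sum_insert hj]
  refine Lp.ext ?_
  filter_upwards [hae, h, ae_all_iff.2 hsum] with z h1 h2 h3
  simp only [h3] at h2
  exact tendsto_nhds_unique (h1.comp hns) h2

end LpSeries

/-! ### Coefficient bounds by continuous seminorms -/

section Dominated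

variable {n : ℕ} {X : Type*} [TopologicalSpace X] [ChartedSpace (EuclideanSpace ℝ (Fin n)) X]
  [IsManifold (𝓡 n) ∞ X] [MeasurableSpace X] [BorelSpace X] {μ : Measure X} {γ ε : ℝ}

/-- Families of functions on `S^γ_ε` that are bounded by one continuous seminorm. -/
def Dominated {ι : Type*} (f : ι → ConeSchwartz n μ γ ε → ℝ) : Prop :=
  ∃ q : Seminorm ℂ (ConeSchwartz n μ γ ε), Continuous q ∧ ∀ i u, f i u ≤ q u

theorem Dominated.mono {ι : Type*} {f g : ι → ConeSchwartz n μ γ ε → ℝ} (hg : Dominated g)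
    (h : ∀ i u, f i u ≤ g i u) : Dominated f := by
  obtain ⟨q, hq, hq'⟩ := hg
  exact ⟨q, hq, fun i u => (h i u).trans (hq' i u)⟩

theorem Dominated.comp {ι κ : Type*} {f : ι → ConeSchwartz n μ γ ε → ℝ} (hf : Dominated f)
    (φ : κ → ι) : Dominated fun i => f (φ i) := by
  obtain ⟨q, hq, h⟩ := hf
  exact ⟨q, hq, fun i u => h _ u⟩

theorem dominated_zero {ι : Type*} :
    Dominated (fun (_ : ι) (_ : ConeSchwartz n μ γ ε) => (0 : ℝ)) :=
  ⟨0, continuous_const, fun _ _ => le_rfl⟩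

theorem Dominated.add {ι : Type*} {f g : ι → ConeSchwartz n μ γ ε → ℝ} (hf : Dominated f)
    (hg : Dominated g) : Dominated fun i u => f i u + g i u := by
  obtain ⟨q, hq, h⟩ := hf
  obtain ⟨q', hq', h'⟩ := hg
  exact ⟨q + q', hq.add hq', fun i u => add_le_add (h i u) (h' i u)⟩

theorem Dominated.const_mul {ι : Type*} {f : ι → ConeSchwartz n μ γ ε → ℝ} (hf : Dominated f)
    {C : ℝ} (hC : 0 ≤ C) : Dominated fun i u => C * f i u := by
  obtain ⟨q, hq, h⟩ := hf
  lift C to NNReal using hC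
  exact ⟨C • q, hq.const_smul C, fun i u => mul_le_mul_of_nonneg_left (h i u) C.2⟩

theorem Dominated.sum {ι κ : Type*} {f : κ → ι → ConeSchwartz n μ γ ε → ℝ} (s : Finset κ)
    (hf : ∀ l, Dominated (f l)) : Dominated fun i u => ∑ l ∈ s, f l i u := by
  classical
  induction s using Finset.induction_on with
  | empty => simpa using dominated_zero
  | insert l s hl ih =>
    simp only [Finset.sum_insert hl]
    exact (hf l).add ih

variable [CompactSpace X] [IsFiniteMeasure μ]

/-- `le_weight` inserts the weight of a defining seminorm and Cauchy–Schwarz on the slab replaces L¹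
by L². The point is that one seminorm serves all radial positions `M`. -/
theorem dominated_slab (p : ℕ) {D : (X → ℂ) → (X → ℂ)} (hD : IsDiffOp n D) {δ : ℝ} (h0 : 0 ≤ δ)
    (h1 : δ < ε) (N : ℕ) : Dominated fun (M : ℝ) (u : ConeSchwartz n μ γ ε) =>
      frameScale n γ M * Real.exp (δ * max (-M) 0 + N * max M 0) *
        ∫ q in slab X, ‖coneOp p D u.toFun (logCoord M q)‖ ∂volume.prod μ := by
  obtain ⟨C, k, hC, h⟩ := le_weight n γ δ N
  let i : SchwartzIndex n X ε := (k, p, ⟨D, hD⟩, ⟨δ, h0, h1⟩)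
  have hi : Dominated fun (_ : ℝ) u => coneSeminorms n μ γ ε i u :=
    ⟨_, coneSeminorms_withSeminorms.continuous_seminorm i, fun _ _ => le_rfl⟩
  refine (hi.const_mul (C := C * √(μ.real univ)) (by positivity)).mono fun M u => ?_
  have hu : SmoothOnCone n u.toFun := u.2.2.1
  set wd := fun q => weightedDeriv n γ δ k p D u.toFun (logCoord M q) with hwd
  have hwc : Continuous wd := by
    have h2 := (coneOp_smooth hD p hu).continuous_logCoord M
    refine Continuous.mul (Complex.continuous_ofReal.comp ?_) h2
    have h3 : Continuous fun q : ℝ × X => (logCoord M q).1 :=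
      continuous_fst.comp (ConeGreen.continuous_logCoord M)
    refine (h3.rpow_const fun q => Or.inl (Real.exp_pos _).ne').mul
      ((Continuous.zpow₀ (by fun_prop) k) fun q => Or.inl ?_)
    positivity
  have e1 : ∫ q in slab X, ‖wd q‖ ∂volume.prod μ ≤
      √(μ.real univ) * coneSeminorms n μ γ ε i u := by
    have h2 := setIntegral_slab_le (μ := μ) (F := wd) hwc.aestronglyMeasurable
    have h4 : eLpNorm (weightedDeriv n γ δ k p D u.toFun) 2 (mellinMeasure μ) ≠ (⊤ : ℝ≥0∞) :=
      (u.2.2.2 k p D hD δ h0 h1).eLpNorm_ne_top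
    have h3 : eLpNorm wd 2 (volume.prod μ) =
        ENNReal.ofReal (coneSeminorms n μ γ ε i u) := by
      rw [coneSeminorms_eq, hwd, ← eLpNorm_mellinMeasure μ M, ENNReal.ofReal_toReal h4]
    rw [h3, ← ENNReal.ofReal_mul (apply_nonneg _ _)] at h2
    rw [mul_comm]
    exact (ENNReal.ofReal_le_ofReal_iff (mul_nonneg (apply_nonneg _ _) (Real.sqrt_nonneg _))).1 h2
  rw [← integral_const_mul]
  have e2 : ∫ q in slab X, frameScale n γ M * Real.exp (δ * max (-M) 0 + N * max M 0) *
      ‖coneOp p D u.toFun (logCoord M q)‖ ∂volume.prod μ ≤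
      ∫ q in slab X, C * ‖wd q‖ ∂volume.prod μ := by
    refine setIntegral_mono_on ((integrableOn_slab
      ((coneOp_smooth hD p hu).continuous_logCoord M)).norm.const_mul _)
      ((integrableOn_slab hwc).norm.const_mul C) measurableSet_slab fun q hq => ?_
    have h5 := h M q.1 ((mem_slab.1 hq).trans (by norm_num))
    have hpos : 0 ≤ (logCoord M q).1 ^ (((n : ℝ) + 1) / 2 - γ - δ) *
        √(1 + (logCoord M q).1 ^ 2) ^ k := by
      have : 0 < (logCoord M q).1 := Real.exp_pos _
      positivity
    rw [hwd]
    simp only [weightedDeriv]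
    rw [norm_mul, Complex.norm_real, Real.norm_of_nonneg hpos, ← mul_assoc]
    exact mul_le_mul_of_nonneg_right h5 (norm_nonneg _)
  refine e2.trans ?_
  rw [integral_const_mul, mul_assoc]
  exact mul_le_mul_of_nonneg_left e1 hC.le

/-- The bounds for pure powers of single frequencies are combined by `mul_freqWeight_pow_le` into
one for the full weight, and the slab integrals on the right are dominated by `dominated_slab`. -/
theorem ChartPatch.dominated_fint (P : ChartPatch n μ) {χ : ℝ → ℂ} (hχ : IsCutoff χ) {φ : X → ℂ}
    (hφ : IsSmooth n φ) (h0 : ∀ x ∉ P.K, φ x = 0) {δ : ℝ} (hδ : 0 ≤ δ) (hδ' : δ < ε) (N : ℕ) :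
    Dominated fun (i : ℝ × (ℤ × (Fin n → ℤ))) (u : ConeSchwartz n μ γ ε) =>
      frameScale n γ i.1 * ‖P.fint i.1 χ φ i.2 u.toFun‖ *
        (freqWeight i.2 ^ N * Real.exp (δ * max (-i.1) 0 + N * max i.1 0)) := by
  obtain ⟨C₁, hC₁, h₁⟩ := P.norm_fint_le hχ hφ
  obtain ⟨C₂, hC₂, h₂⟩ := P.fint_radial_bound N hχ hφ
  choose C₃ hC₃ h₃ using fun a => P.fint_field_bound a N hχ hφ h0
  have d₁ := (dominated_slab (μ := μ) (γ := γ) 0 (isDiffOp_one (n := n) (X := X)) hδ hδ' N).const_mul hC₁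
  have d₂ := (Dominated.sum (Finset.range (N + 1)) fun l => dominated_slab (μ := μ) (γ := γ) l
    (isDiffOp_one (n := n) (X := X)) hδ hδ' N).const_mul hC₂
  have d₃ := Dominated.sum Finset.univ fun a => (Dominated.sum (Finset.range (N + 1)) fun l =>
    dominated_slab (μ := μ) (γ := γ) 0 (isDiffOp_iterate_lieD (P.smooth_V a) l) hδ hδ' N).const_mul
      (hC₃ a)
  refine ((((d₁.add d₂).add d₃).const_mul (C := ((n : ℝ) + 2) ^ N) (by positivity)).comp
    (fun i : ℝ × (ℤ × (Fin n → ℤ)) => i.1)).mono ?_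
  rintro ⟨M, k⟩ u
  have hu : SmoothOnCone n u.toFun := u.2.2.1
  have hone : sliceOp (fun (f : X → ℂ) x => (1 : ℂ) * f x) u.toFun = u.toFun := by
    ext z; simp [sliceOp]
  simp only [coneOp, hone]
  set E := frameScale n γ M * Real.exp (δ * max (-M) 0 + N * max M 0) with hE
  have hE0 : 0 < E := mul_pos (frameScale_pos n γ M) (Real.exp_pos _)
  have key : ∀ (b C c : ℝ) (I : ℕ → ℝ), c * b ≤ C * ∑ l ∈ Finset.range (N + 1), I l →
      c * (E * b) ≤ C * ∑ l ∈ Finset.range (N + 1), E * I l := by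
    intro b C c I h
    rw [← Finset.mul_sum]
    have := mul_le_mul_of_nonneg_left h hE0.le
    linarith
  set A₁ := C₁ * (E * ∫ q in slab X, ‖radialDeriv^[0] u.toFun (logCoord M q)‖ ∂volume.prod μ)
    with hA₁
  set A₂ := C₂ * ∑ l ∈ Finset.range (N + 1),
    E * ∫ q in slab X, ‖radialDeriv^[l] u.toFun (logCoord M q)‖ ∂volume.prod μ with hA₂
  set A₃ : Fin n → ℝ := fun a => C₃ a * ∑ l ∈ Finset.range (N + 1),
    E * ∫ q in slab X, ‖radialDeriv^[0] (sliceOp ((lieD (P.V a))^[l]) u.toFun) (logCoord M q)‖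
      ∂volume.prod μ with hA₃
  set b := ‖P.fint M χ φ k u.toFun‖ with hb
  have a₁ : E * b ≤ A₁ := by
    have := mul_le_mul_of_nonneg_left (h₁ M k u.toFun hu) hE0.le
    rw [hA₁]
    simp only [Function.iterate_zero, id]
    linarith
  have a₂ : |(k.1 : ℝ)| ^ N * (E * b) ≤ A₂ := key _ _ _ _ (h₂ M k u.toFun hu)
  have a₃ : ∀ a, |(k.2 a : ℝ)| ^ N * (E * b) ≤ A₃ a := fun a => key _ _ _ _ (h₃ a M k u.toFun hu)
  have hb0 : 0 ≤ E * b := mul_nonneg hE0.le (norm_nonneg _)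
  have p₁ : 0 ≤ A₁ := hb0.trans a₁
  have p₂ : 0 ≤ A₂ := (by positivity : (0 : ℝ) ≤ |(k.1 : ℝ)| ^ N * (E * b)).trans a₂
  have p₃ : ∀ a, 0 ≤ A₃ a := fun a =>
    (by positivity : (0 : ℝ) ≤ |(k.2 a : ℝ)| ^ N * (E * b)).trans (a₃ a)
  have s₃ : 0 ≤ ∑ a, A₃ a := Finset.sum_nonneg fun a _ => p₃ a
  have hfin := mul_freqWeight_pow_le N k (b := E * b) (C := A₁ + A₂ + ∑ a, A₃ a) hb0
    (by linarith) (by linarith) fun a => by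
      have := Finset.single_le_sum (f := A₃) (fun a _ => p₃ a) (Finset.mem_univ a)
      linarith [a₃ a]
  refine le_trans (le_of_eq ?_) hfin
  rw [hE]
  ring

end Dominated

/-! ### The dual functions and the coefficients -/

section DualFunctions

variable {n m : ℕ} {X : Type*} [TopologicalSpace X] [ChartedSpace (EuclideanSpace ℝ (Fin n)) X]
  [IsManifold (𝓡 n) ∞ X] [MeasurableSpace X] [BorelSpace X] {μ : Measure X}

theorem osc_neg (ψ : ℝ → ℝ) (k : ℤ) (r : ℝ) :
    osc (fun r => (ψ r : ℂ)) (-k) r = conj (osc (fun r => (ψ r : ℂ)) k r) := by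
  rw [osc, osc, map_mul, Complex.conj_ofReal, ← Complex.exp_conj]
  simp [Complex.conj_ofReal, Complex.conj_ofNat]

/-- The reflection of the frequencies. -/
def frameNeg (n m : ℕ) : Equiv.Perm (FrameIndex n m) := (Equiv.refl _).prodCongr (Equiv.neg _)

theorem frameElem_neg (P : Fin m → ChartPatch n μ) (γ : ℝ) (j : FrameIndex n m) (z : ℝ × X) :
    frameElem P γ (frameNeg n m j) z = conj (frameElem P γ j z) := by
  by_cases hz : 0 < z.1
  · rw [frameElem, frameElem, coneFn_of_pos hz, coneFn_of_pos hz]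
    simp only [map_mul, Complex.conj_ofReal, ← character_neg, ← osc_neg]
    rfl
  · rw [frameElem, frameElem, coneFn, coneFn, if_neg hz, if_neg hz, map_zero]

theorem frameDual_neg (P : Fin m → ChartPatch n μ) (γ : ℝ) (j : FrameIndex n m) (z : ℝ × X) :
    frameDual P γ (frameNeg n m j) z = conj (frameDual P γ j z) := by
  by_cases hz : 0 < z.1
  · simp only [frameDual, if_pos hz, ChartPatch.test, map_mul, map_div₀, Complex.conj_ofReal,
      ← character_neg, ← osc_neg]
    rfl
  · rw [frameDual, frameDual, if_neg hz, if_neg hz, map_zero]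

theorem frameDual_logCoord (P : Fin m → ChartPatch n μ) (γ : ℝ) (j : FrameIndex n m) (q : ℝ × X) :
    frameDual P γ j (logCoord j.center q) = (frameScale n γ j.center : ℂ) *
      (P j.1.1).test (fun r => (radialPart r : ℂ)) (fun x => ((P j.1.1).φ x : ℂ)) j.2 q /
        (((logCoord j.center q).1 ^ (n + 1) : ℝ) : ℂ) := by
  have h : 0 < (logCoord j.center q).1 := Real.exp_pos _
  have e : Real.log (logCoord j.center q).1 - j.center = q.1 := by
    rw [logCoord, Real.log_exp]; ring
  rw [frameDual, if_pos h, e]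
  rfl

variable [CompactSpace X] [IsFiniteMeasure μ]

theorem measurable_frameDual (P : Fin m → ChartPatch n μ) (γ : ℝ) (j : FrameIndex n m) :
    Measurable (frameDual P γ j) := by
  refine Measurable.ite (measurableSet_Ioi.preimage measurable_fst) ?_ measurable_const
  refine (measurable_const.mul (((P j.1.1).measurable_test isCutoff_radialPart
    (P j.1.1).smooth_φ j.2).comp ?_)).div ?_
  · exact ((Real.measurable_log.comp measurable_fst).sub_const _).prodMk measurable_snd
  · exact Complex.measurable_ofReal.comp (measurable_fst.pow_const _)

theorem eLpNorm_coneMeasure_eq (γ : ℝ) (f : ℝ × X → ℂ) :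
    eLpNorm f 2 (coneMeasure n μ γ) = eLpNorm (fun z =>
      ((√(min z.1 1 ^ (-2 * γ) * z.1 ^ (n + 1)) : ℝ) : ℂ) * f z) 2 (mellinMeasure μ) := by
  rw [eLpNorm_eq_lintegral_rpow_enorm_toReal (by simp) (by simp),
    eLpNorm_eq_lintegral_rpow_enorm_toReal (by simp) (by simp), coneMeasure_eq_mellin,
    lintegral_withDensity_eq_lintegral_mul_non_measurable _ (by fun_prop) (by simp)]
  congr 1
  refine lintegral_congr_ae ?_
  filter_upwards [(mellinMeasure_ac μ).ae_le (ae_mem_cone μ)] with z hz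
  have ht : (0 : ℝ) < z.1 := hz.1
  have hm : 0 < min z.1 1 := lt_min ht one_pos
  have hd : 0 ≤ min z.1 1 ^ (-2 * γ) * z.1 ^ (n + 1) := by positivity
  rw [Pi.mul_apply, enorm_mul, ENNReal.mul_rpow_of_nonneg _ _ (by simp), ENNReal.toReal_ofNat]
  congr 1
  rw [← ofReal_norm, Complex.norm_real, Real.norm_of_nonneg (Real.sqrt_nonneg _),
    ENNReal.ofReal_rpow_of_nonneg (Real.sqrt_nonneg _) (by norm_num), Real.rpow_ofNat,
    Real.sq_sqrt hd]

theorem eLpNorm_frameDual_bound (P : Fin m → ChartPatch n μ) (γ : ℝ) : ∃ C : ℝ, 0 ≤ C ∧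
    ∀ j, eLpNorm (frameDual P γ j) 2 (coneMeasure n μ (-γ)) ≤ ENNReal.ofReal C := by
  obtain ⟨A, hA, h⟩ := dual_weight_le n γ
  choose B hB h' using fun i : Fin m => (P i).exists_bound_test isCutoff_radialPart (P i).smooth_φ
  have hBs : 0 ≤ ∑ i, B i := Finset.sum_nonneg fun i _ => hB i
  refine ⟨√A * (∑ i, B i) * √(μ.real univ), by positivity, fun j => ?_⟩
  rw [eLpNorm_coneMeasure_eq, eLpNorm_mellinMeasure μ j.center]
  refine eLpNorm_le_of_slab (by positivity) (fun q hq => ?_) fun q hq => ?_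
  · rw [frameDual_logCoord]
    have ht : 0 < (logCoord j.center q).1 := Real.exp_pos _
    have hS := frameScale_pos n γ j.center
    have hw := h j.center q.1 ((mem_slab.1 hq).trans (by norm_num))
    change frameScale n γ j.center ^ 2 * (min (logCoord j.center q).1 1 ^ (-2 * -γ) *
      (logCoord j.center q).1 ^ (n + 1)) ≤ A * ((logCoord j.center q).1 ^ (n + 1)) ^ 2 at hw
    set t := (logCoord j.center q).1
    set S := frameScale n γ j.center
    have hd : 0 ≤ min t 1 ^ (-2 * -γ) * t ^ (n + 1) := by
      have : 0 < min t 1 := lt_min ht one_pos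
      positivity
    have h1 : √(min t 1 ^ (-2 * -γ) * t ^ (n + 1)) * S ≤ √A * t ^ (n + 1) := by
      have h2 := Real.sqrt_le_sqrt hw
      rw [Real.sqrt_mul (by positivity), Real.sqrt_sq hS.le, Real.sqrt_mul hA.le,
        Real.sqrt_sq (by positivity)] at h2
      linarith
    rw [norm_mul, norm_div, norm_mul, Complex.norm_real, Complex.norm_real, Complex.norm_real,
      Real.norm_of_nonneg (Real.sqrt_nonneg _), Real.norm_of_nonneg hS.le,
      Real.norm_of_nonneg (by positivity : 0 ≤ t ^ (n + 1)), ← mul_div_assoc,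
      div_le_iff₀ (by positivity)]
    have h3 : ‖(P j.1.1).test (fun r => (radialPart r : ℂ)) (fun x => ((P j.1.1).φ x : ℂ)) j.2 q‖ ≤
        ∑ i, B i := (h' _ _ _).trans
      (Finset.single_le_sum (f := B) (fun i _ => hB i) (Finset.mem_univ _))
    calc _ = (√(min t 1 ^ (-2 * -γ) * t ^ (n + 1)) * S) * ‖(P j.1.1).test
          (fun r => (radialPart r : ℂ)) (fun x => ((P j.1.1).φ x : ℂ)) j.2 q‖ := by ring
      _ ≤ (√A * t ^ (n + 1)) * ∑ i, B i := mul_le_mul h1 h3 (norm_nonneg _) (by positivity)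
      _ = _ := by ring
  · rw [frameDual_logCoord, (P j.1.1).test_eq_zero isCutoff_radialPart j.2 hq]
    simp

/-- The denominator t^(n+1) of the dual function cancels t^n dt = t^(n+1) dt/t, so the pairing is a
plain integral over the cylinder. -/
theorem integral_frameDual (P : Fin m → ChartPatch n μ) (γ : ℝ) (j : FrameIndex n m)
    (u : ℝ × X → ℂ) : ∫ z, u z * frameDual P γ j z ∂coneMeasure n μ 0 =
      (frameScale n γ j.center : ℂ) * (P j.1.1).fint j.center (fun r => (radialPart r : ℂ))
        (fun x => ((P j.1.1).φ x : ℂ)) j.2 u := by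
  rw [integral_coneMeasure_zero, integral_mellinMeasure μ j.center, ChartPatch.fint,
    ← integral_const_mul]
  refine integral_congr_ae (ae_of_all _ fun q => ?_)
  simp only [frameDual_logCoord]
  have ht : 0 < (logCoord j.center q).1 := Real.exp_pos _
  have : (((logCoord j.center q).1 ^ (n + 1) : ℝ) : ℂ) ≠ 0 := by
    exact_mod_cast (pow_pos ht _).ne'
  field_simp

theorem frame_coef_bound (P : Fin m → ChartPatch n μ) (γ ε δ : ℝ) (N : ℕ) (hδ : 0 ≤ δ)
    (hδ' : δ < ε) : Dominated fun (j : FrameIndex n m) (u : ConeSchwartz n μ γ ε) =>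
      ‖∫ z, u.toFun z * frameDual P γ j z ∂coneMeasure n μ 0‖ * frameRate δ N j := by
  have h := Dominated.sum Finset.univ fun i : Fin m => ((P i).dominated_fint (γ := γ)
    isCutoff_radialPart (P i).smooth_φ (fun x hx => by rw [(P i).φ_eq_zero x hx, Complex.ofReal_zero])
    hδ hδ' N).comp fun j : FrameIndex n m => (j.center, j.2)
  refine h.mono fun j u => ?_
  have hnn : ∀ i ∈ Finset.univ, 0 ≤ frameScale n γ j.center * ‖(P i).fint j.center
      (fun r => (radialPart r : ℂ)) (fun x => ((P i).φ x : ℂ)) j.2 u.toFun‖ *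
        (freqWeight j.2 ^ N * Real.exp (δ * max (-j.center) 0 + N * max j.center 0)) := fun i _ =>
    mul_nonneg (mul_nonneg (frameScale_pos _ _ _).le (norm_nonneg _)) (frameRate_pos δ N j).le
  refine le_trans (le_of_eq ?_) (Finset.single_le_sum hnn (Finset.mem_univ j.1.1))
  rw [integral_frameDual, norm_mul, Complex.norm_real,
    Real.norm_of_nonneg (frameScale_pos _ _ _).le, frameRate]

/-- The coefficient bound is used at δ + (ε - δ)/2, which is still below ε; the surplus is a rate
with summable inverse. -/
theorem summable_coef_mul_rate (P : Fin m → ChartPatch n μ) {γ ε : ℝ} (u : ConeSchwartz n μ γ ε)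
    {δ : ℝ} (hδ : 0 ≤ δ) (hδ' : δ < ε) (N : ℕ) : Summable fun j : FrameIndex n m =>
      ‖∫ z, u.toFun z * frameDual P γ j z ∂coneMeasure n μ 0‖ * frameRate δ N j := by
  obtain ⟨q, -, hq⟩ := frame_coef_bound P γ ε (δ + (ε - δ) / 2) (N + 2 * (n + 1)) (by linarith)
    (by linarith)
  have hs := (summable_frameRate (n := n) (m := m) (δ := (ε - δ) / 2) (by linarith)).mul_left (q u)
  refine Summable.of_nonneg_of_le
    (fun j => mul_nonneg (norm_nonneg _) (frameRate_pos δ N j).le) (fun j => ?_) hs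
  have h1 := hq j u
  beta_reduce at h1
  rw [frameRate_add, ← mul_assoc] at h1
  rw [← div_eq_mul_inv, le_div_iff₀ (frameRate_pos _ _ _)]
  exact h1

end DualFunctions

/-! ### The frame expansion -/

section Expansion

variable {n m : ℕ} {X : Type*} [TopologicalSpace X] [ChartedSpace (EuclideanSpace ℝ (Fin n)) X]
  [IsManifold (𝓡 n) ∞ X] [MeasurableSpace X] [BorelSpace X] {μ : Measure X}
  [CompactSpace X] [IsFiniteMeasure μ]

theorem character_split (k : ℤ × (Fin n → ℤ)) (r : ℝ) (y : EuclideanSpace ℝ (Fin n)) :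
    character k r y = Complex.exp (2 * Real.pi * Complex.I * k.1 * r) * character k 0 y := by
  rw [character, character, ← Complex.exp_add, phase, phase]
  congr 1
  push_cast
  ring

/-- The coefficients are Fourier coefficients of a function on Euclidean space. -/
theorem ChartPatch.fint_eq_fourier (P : ChartPatch n μ) (M : ℝ) {u : ℝ × X → ℂ}
    (hu : SmoothOnCone n u) : ∃ G : ℝ × EuclideanSpace ℝ (Fin n) → ℂ, Continuous G ∧
      (∀ q, G q ≠ 0 → |q.1| ≤ 3 / 8 ∧ ∀ a, |q.2 a| ≤ 3 / 8) ∧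
      (∀ r x, (P.η x : ℂ) * G (r, P.κ x) =
        u (logCoord M (r, x)) * ((radialPart r : ℂ) * (P.φ x : ℂ))∨ P.η x = 0) ∧
      ∀ k, P.fint M (fun r => (radialPart r : ℂ)) (fun x => (P.φ x : ℂ)) k u =
        ∫ q, G q * character (-k) q.1 q.2 := by
  have hcr := isCutoff_radialPart.contDiff.continuous
  set F : ℝ × X → ℂ := fun q => u (logCoord M q) * ((radialPart q.1 : ℂ) * (P.φ q.2 : ℂ)) with hF
  have hFc : Continuous F := (hu.continuous_logCoord M).mul
    ((hcr.comp continuous_fst).mul ((ContMDiff.continuous P.smooth_φ).comp continuous_snd))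
  have hF0 : ∀ q : ℝ × X, q.2 ∉ P.K → F q = 0 := fun q hq => by
    simp only [hF, P.φ_eq_zero _ hq, Complex.ofReal_zero, mul_zero]
  obtain ⟨G, hG, hGK, hG0, hGi⟩ := P.extend F hFc hF0
  have hsupp : ∀ q, G q ≠ 0 → |q.1| ≤ 1 / 4 ∧ ∃ x ∈ P.K, P.κ x = q.2 := by
    rintro ⟨r, y⟩ hq
    obtain ⟨x, hx, rfl⟩ := hG0 r y hq
    refine ⟨abs_le_of_radialPart_ne_zero fun h => hq ?_, x, hx, rfl⟩
    rw [hGK r x hx]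
    simp [hF, h]
  refine ⟨G, hG, fun q hq => ?_, fun r x => ?_, fun k => ?_⟩
  · obtain ⟨h1, x, hx, h2⟩ := hsupp q hq
    refine ⟨h1.trans (by norm_num), fun a => ?_⟩
    rw [← h2]
    exact P.κ_le x hx a
  · by_cases hη : P.η x = 0
    · exact Or.inr hη
    · refine Or.inl ?_
      by_cases hx : x ∈ P.K
      -- The cut-off coordinates are injective only relative to η: if η x ≠ 0 and x ∉ K, then κ x is
      -- not in the image of `K`, so `G` vanishes there just as φ does. Where η = 0 nothing is
      -- claimed.
      · rw [P.η_eq_one x hx, Complex.ofReal_one, one_mul, hGK r x hx]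
      · have : G (r, P.κ x) = 0 := by
          by_contra h
          obtain ⟨x', hx', h'⟩ := hG0 _ _ h
          exact hx (P.κ_inj x' hx' x hη h'.symm ▸ hx')
        rw [this, P.φ_eq_zero x hx, Complex.ofReal_zero, mul_zero, mul_zero, mul_zero]
  · have hc : HasCompactSupport fun q => G q * character (-k) q.1 q.2 := by
      refine HasCompactSupport.intro (K := Icc (-(1 / 4)) (1 / 4) ×ˢ (P.κ '' P.K))
        (isCompact_Icc.prod (P.isClosed_K.isCompact.image (ContMDiff.continuous P.smooth_κ)))
        fun q hq => ?_
      by_contra h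
      obtain ⟨h1, h2⟩ := hsupp q fun h' => h (by rw [h', zero_mul])
      exact hq ⟨abs_le.1 h1, h2⟩
    have hint : Integrable (fun q => G q * character (-k) q.1 q.2)
        ((volume : Measure ℝ).prod (volume : Measure (EuclideanSpace ℝ (Fin n)))) :=
      (hG.mul (continuous_character (-k))).integrable_of_hasCompactSupport hc
    have h1 := integral_prod _ (P.integrable_fint isCutoff_radialPart P.smooth_φ k
      (hu.continuous_logCoord M))
    rw [ChartPatch.fint, h1]
    refine Eq.trans ?_ (integral_prod _ hint).symm
    refine integral_congr_ae (ae_of_all _ fun r => ?_)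
    have h2 := hGi r (fun y => character (-k) r y)
      ((continuous_character (-k)).comp (continuous_const.prodMk continuous_id))
    refine Eq.trans ?_ h2
    refine integral_congr_ae (ae_of_all _ fun x => ?_)
    simp only [hF, ChartPatch.test, osc]
    rw [character_split (-k) r]
    simp only [Prod.fst_neg]
    ring

/-- For a fixed patch and radial position the terms form the Fourier series of the localised
function, multiplied by the bump and η. These equal 1 on the support of the localisation, so they
remove the periodic copies and change nothing else; the scales of elements and duals cancel. -/
theorem hasSum_patch (P : Fin m → ChartPatch n μ) {γ ε : ℝ} (hε : 0 < ε)
    (u : ConeSchwartz n μ γ ε) (i : Fin m × ℤ) {z : ℝ × X} (hz : z ∈ cone X) :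
    HasSum (fun k => (∫ z, u.toFun z * frameDual P γ (i, k) z ∂coneMeasure n μ 0) *
        frameElem P γ (i, k) z)
      (u.toFun z * ((radialPart (Real.log z.1 - i.2 / 4) : ℂ) * ((P i.1).φ z.2 : ℂ))) := by
  have ht : 0 < z.1 := hz.1
  have hu : SmoothOnCone n u.toFun := u.2.2.1
  set M : ℝ := (i.2 : ℝ) / 4 with hM
  set r := Real.log z.1 - M with hr
  have hS := frameScale_pos n γ M
  have hS' : (frameScale n γ M : ℂ) ≠ 0 := by exact_mod_cast hS.ne'
  have hzr : logCoord M (r, z.2) = z := by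
    ext
    · simp [logCoord, hr, Real.exp_log ht]
    · rfl
  obtain ⟨G, hG, hG0, hGe, hGf⟩ := (P i.1).fint_eq_fourier M hu
  have e : ∀ k, (∫ z, u.toFun z * frameDual P γ (i, k) z ∂coneMeasure n μ 0) *
        frameElem P γ (i, k) z = (∫ q, G q * character (-k) q.1 q.2) *
          character k r ((P i.1).κ z.2) * ((radialBump r : ℂ) * ((P i.1).η z.2 : ℂ)) := by
    intro k
    rw [integral_frameDual, frameElem, coneFn_of_pos ht, character_split k r, ← hGf]
    have : FrameIndex.center ((i, k) : FrameIndex n m) = M := rfl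
    simp only [this, osc, ← hr]
    push_cast
    field_simp
  simp only [e]
  by_cases h0 : (radialBump r : ℂ) * ((P i.1).η z.2 : ℂ) = 0
  · have : u.toFun z * ((radialPart r : ℂ) * ((P i.1).φ z.2 : ℂ)) = 0 := by
      rcases mul_eq_zero.1 h0 with h | h
      · have h1 := radialBump_mul_radialPart r
        rw [Complex.ofReal_eq_zero.1 h, zero_mul] at h1
        rw [← h1]; simp
      · have hx : z.2 ∉ (P i.1).K := fun hx => by
          rw [(P i.1).η_eq_one _ hx] at h; simp at h
        rw [(P i.1).φ_eq_zero _ hx]; simp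
    rw [this, h0]
    simp only [mul_zero]
    exact hasSum_zero
  · obtain ⟨hb, hη⟩ := mul_ne_zero_iff.1 h0
    have hr2 := abs_lt_of_radialBump_ne_zero fun h => hb (by rw [h, Complex.ofReal_zero])
    have hη' : (P i.1).η z.2 ≠ 0 := fun h => hη (by rw [h, Complex.ofReal_zero])
    -- Absolute summability of the Fourier coefficients, from the coefficient bound with δ = 0 and N
    -- = 0, where the rate is 1.
    have hs : Summable fun k => ∫ q, G q * character (-k) q.1 q.2 := by
      have h1 := (summable_coef_mul_rate P u le_rfl hε 0).comp_injective
        (Prod.mk_right_injective i)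
      have h2 : Summable fun k => ‖(P i.1).fint M (fun r => (radialPart r : ℂ))
          (fun x => ((P i.1).φ x : ℂ)) k u.toFun‖ := by
        refine (h1.mul_left (frameScale n γ M)⁻¹).congr fun k => ?_
        have : FrameIndex.center ((i, k) : FrameIndex n m) = M := rfl
        simp only [Function.comp, frameRate, integral_frameDual, this, pow_zero, zero_mul,
          Nat.cast_zero, add_zero, Real.exp_zero, mul_one, norm_mul, Complex.norm_real,
          Real.norm_of_nonneg hS.le]
        field_simp
      refine h2.of_norm.congr fun k => hGf k
    have h3 := (hasSum_fourier_box hG hG0 hs (r := r) (y := (P i.1).κ z.2)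
      (hr2.trans (by norm_num)) ((P i.1).κ_lt _ hη')).mul_right
        ((radialBump r : ℂ) * ((P i.1).η z.2 : ℂ))
    refine (congrArg (HasSum _) ?_).mp h3
    have h4 := (hGe r z.2).resolve_right hη'
    rw [hzr] at h4
    have h5 : ((radialBump r : ℂ)) * (radialPart r : ℂ) = radialPart r := by
      exact_mod_cast radialBump_mul_radialPart r
    calc _ = (radialBump r : ℂ) * (((P i.1).η z.2 : ℂ) * G (r, (P i.1).κ z.2)) := by ring
      _ = u.toFun z * (((radialBump r : ℂ) * (radialPart r : ℂ)) * ((P i.1).φ z.2 : ℂ)) := by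
        rw [h4]; ring
      _ = _ := by rw [h5]

theorem summable_coef_mul_elem (P : Fin m → ChartPatch n μ) {γ ε : ℝ} (hε : 0 < ε)
    (u : ConeSchwartz n μ γ ε) (p : ℕ) {D : (X → ℂ) → (X → ℂ)} (hD : IsDiffOp n D) :
    ∃ (W : ℝ → ℝ) (b : FrameIndex n m → ℝ), ContinuousOn W (Ioi 0) ∧ Summable b ∧
      ∀ j, ∀ z ∈ cone X, ‖coneOp p D ((∫ z, u.toFun z * frameDual P γ j z ∂coneMeasure n μ 0) •
        frameElem P γ j) z‖ ≤ W z.1 * b j := by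
  obtain ⟨W, N, hW, h⟩ := coneOp_frameElem_bound_rate P γ p hD
  refine ⟨W, _, hW, summable_coef_mul_rate P u le_rfl hε N, fun j z hz => ?_⟩
  rw [coneOp_smul hD p _ (smoothOnCone_frameElem P γ j) hz, Pi.smul_apply, norm_smul]
  calc _ ≤ ‖∫ z, u.toFun z * frameDual P γ j z ∂coneMeasure n μ 0‖ *
        (W z.1 * frameRate 0 N j) := mul_le_mul_of_nonneg_left (h j z hz) (norm_nonneg _)
    _ = _ := by ring

/-- Absolute convergence permits summing the frequencies first, which gives `u` times a member of
the product partition of unity; those members add up to 1. -/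
theorem hasSum_pointwise (P : Fin m → ChartPatch n μ) (hP : ∀ x, ∑ i, (P i).φ x = 1) {γ ε : ℝ}
    (hε : 0 < ε) (u : ConeSchwartz n μ γ ε) {z : ℝ × X} (hz : z ∈ cone X) :
    HasSum (fun j => ((∫ z, u.toFun z * frameDual P γ j z ∂coneMeasure n μ 0) •
      frameElem P γ j) z) (u.toFun z) := by
  obtain ⟨W, b, -, hb, h⟩ := summable_coef_mul_elem P hε u 0 (isDiffOp_one (n := n) (X := X))
  have hs : Summable fun j => ((∫ z, u.toFun z * frameDual P γ j z ∂coneMeasure n μ 0) •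
      frameElem P γ j) z := by
    refine Summable.of_norm_bounded (hb.mul_left (W z.1)) fun j => ?_
    refine le_trans (le_of_eq ?_) (h j z hz)
    simp [coneOp, sliceOp]
  have h1 := hs.hasSum.prod_fiberwise fun i => hasSum_patch P hε u i hz
  have h2 : HasSum (fun i : Fin m × ℤ =>
      u.toFun z * ((radialPart (Real.log z.1 - i.2 / 4) : ℂ) * ((P i.1).φ z.2 : ℂ)))
      (u.toFun z) := by
    have h3 : HasSum (fun k : ℤ => (radialPart (Real.log z.1 - k / 4) : ℂ)) 1 := by
      have := Complex.hasSum_ofReal.2 (hasSum_radialPart (Real.log z.1))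
      rwa [Complex.ofReal_one] at this
    have h4 : HasSum (fun i : Fin m => ((P i).φ z.2 : ℂ)) 1 := by
      have := hasSum_fintype fun i : Fin m => ((P i).φ z.2 : ℂ)
      rwa [← Complex.ofReal_sum, hP, Complex.ofReal_one] at this
    have h5 : Summable fun i : Fin m × ℤ =>
        ((P i.1).φ z.2 : ℂ) * (radialPart (Real.log z.1 - i.2 / 4) : ℂ) :=
      summable_mul_of_summable_norm (f := fun i : Fin m => ((P i).φ z.2 : ℂ))
        (g := fun k : ℤ => (radialPart (Real.log z.1 - k / 4) : ℂ)) h4.summable.norm h3.summable.norm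
    have h6 := (h4.mul h3 h5).mul_left (u.toFun z)
    rw [mul_one, mul_one] at h6
    refine (congrArg (HasSum · _) (funext fun i => ?_)).mp h6
    ring
  have h3 := h1.unique h2
  rw [← h3]
  exact hs.hasSum

theorem coeFn_weightedDerivLp {γ ε : ℝ} (i : SchwartzIndex n X ε) (u : ConeSchwartz n μ γ ε) :
    weightedDerivLp i u =ᵐ[mellinMeasure μ]
      weightedDeriv n γ i.2.2.2.1 i.1 i.2.1 i.2.2.1.1 u.toFun :=
  MemLp.coeFn_toLp
    (u.2.2.2 i.1 i.2.1 i.2.2.1.1 i.2.2.1.2 i.2.2.2.1 i.2.2.2.2.1 i.2.2.2.2.2)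

/-- Each weighted derivative is treated separately: its series converges absolutely in L², and its
pointwise sum is the right one by termwise differentiation, so the L² sum is too. -/
theorem hasSum_frame (P : Fin m → ChartPatch n μ) (hP : ∀ x, ∑ i, (P i).φ x = 1) {γ ε : ℝ}
    (hε : 0 < ε) (u : ConeSchwartz n μ γ ε) :
    HasSum (fun j => (∫ z, u.toFun z * frameDual P γ j z ∂coneMeasure n μ 0) •
      ConeSchwartz.mk (frameElem P γ j) (frameElem_mem P γ ε j)) u := by
  set c := fun j => ∫ z, u.toFun z * frameDual P γ j z ∂coneMeasure n μ 0 with hc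
  set e := fun j => ConeSchwartz.mk (frameElem P γ j) (frameElem_mem P γ ε j) with he
  have key : ∀ i : SchwartzIndex n X ε,
      HasSum (fun j => weightedDerivLp i (c j • e j)) (weightedDerivLp i u) := by
    intro i
    obtain ⟨C, N, h⟩ := frameElem_seminorm_bound P γ ε i
    refine hasSum_Lp_of_ae ?_ ?_
    · refine Summable.of_nonneg_of_le (fun j => norm_nonneg _) (fun j => ?_)
        ((summable_coef_mul_rate P u i.2.2.2.2.1 i.2.2.2.2.2 N).mul_left C)
      rw [map_smul, norm_smul]
      calc _ ≤ ‖c j‖ * (C * frameRate i.2.2.2.1 N j) :=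
            mul_le_mul_of_nonneg_left (h j) (norm_nonneg _)
        _ = _ := by ring
    · have h1 : ∀ j, weightedDerivLp i (c j • e j) =ᵐ[mellinMeasure μ]
          weightedDeriv n γ i.2.2.2.1 i.1 i.2.1 i.2.2.1.1 (c j • frameElem P γ j) := fun j =>
        coeFn_weightedDerivLp i (c j • e j)
      have h2 : weightedDerivLp i u =ᵐ[mellinMeasure μ]
          weightedDeriv n γ i.2.2.2.1 i.1 i.2.1 i.2.2.1.1 u.toFun := coeFn_weightedDerivLp i u
      filter_upwards [ae_all_iff.2 h1, h2, (mellinMeasure_ac μ).ae_le (ae_mem_cone μ)]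
        with z h1 h2 hz
      simp only [h1, h2, weightedDeriv]
      exact (hasSum_coneOp (fun j => (smoothOnCone_frameElem P γ j).smul (c j)) u.2.2.1
        (fun z hz => hasSum_pointwise P hP hε u hz)
        (fun p D hD => summable_coef_mul_elem P hε u p hD) i.2.1 i.2.2.1.2 z hz).mul_left _
  change Tendsto _ _ _
  rw [coneSeminorms_withSeminorms.tendsto_nhds]
  intro i r hr
  have h1 : Tendsto (fun s : Finset (FrameIndex n m) => ∑ j ∈ s, weightedDerivLp i (c j • e j))
    (SummationFilter.unconditional _).filter (𝓝 (weightedDerivLp i u)) := key i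
  filter_upwards [Metric.tendsto_nhds.1 h1 r hr] with s hs
  rw [dist_eq_norm, ← map_sum, ← map_sub] at hs
  exact hs

/-- The frame attached to a finite atlas of patches. -/
def coneFrame (P : Fin m → ChartPatch n μ) (hP : ∀ x, ∑ i, (P i).φ x = 1) : ConeFrame n μ where
  J := FrameIndex n m
  neg := frameNeg n m
  rate := frameRate
  elem := frameElem P
  dual := frameDual P
  rate_pos := frameRate_pos
  rate_mono := frameRate_mono
  rate_add := frameRate_add
  rate_neg δ N j := by
    change freqWeight (-j.2) ^ N * _ = _
    rw [freqWeight_neg]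
    rfl
  summable_rate := ⟨2 * (n + 1), fun δ hδ => summable_frameRate hδ⟩
  elem_mem := frameElem_mem P
  elem_bound := frameElem_seminorm_bound P
  elem_neg := frameElem_neg P
  dual_memLp γ j := by
    obtain ⟨C, -, h⟩ := eLpNorm_frameDual_bound P γ
    exact ⟨(measurable_frameDual P γ j).aestronglyMeasurable, (h j).trans_lt ENNReal.ofReal_lt_top⟩
  dual_bound γ := by
    obtain ⟨C, hC, h⟩ := eLpNorm_frameDual_bound P γ
    exact ⟨C, fun j => ENNReal.toReal_le_of_le_ofReal hC (h j)⟩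
  dual_neg := frameDual_neg P
  coef_bound γ ε δ N hδ hδ' := by
    obtain ⟨q, hq, h⟩ := frame_coef_bound P γ ε δ N hδ hδ'
    exact ⟨q, hq, fun u j => h j u⟩
  hasSum _ _ hε u := hasSum_frame P hP hε u

end Expansion

/-! ### Calculus in a chart -/

section ChartCalculus

variable {n : ℕ} {X : Type*} [TopologicalSpace X] [ChartedSpace (EuclideanSpace ℝ (Fin n)) X]
  [IsManifold (𝓡 n) ∞ X]

theorem IsSmooth.contDiffOn_chart {F : X → ℂ} (hF : IsSmooth n F) (x₀ : X) :
    ContDiffOn ℝ ∞ (fun y => F ((chartAt (EuclideanSpace ℝ (Fin n)) x₀).symm y))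
      (chartAt (EuclideanSpace ℝ (Fin n)) x₀).target := by
  rw [← contMDiffOn_iff_contDiffOn]
  exact ContMDiff.comp_contMDiffOn hF (contMDiffOn_chart_symm (I := 𝓡 n) (n := ∞) (x := x₀))

/-- The coordinate vector fields of a chart, extended by zero. -/
def chartField (x₀ : X) (a : Fin n) (x : X) : TangentSpace (𝓡 n) x :=
  (trivializationAt (EuclideanSpace ℝ (Fin n)) (TangentSpace (𝓡 n)) x₀).localFrame
    (EuclideanSpace.basisFun (Fin n) ℝ).toBasis a x

theorem contMDiffOn_chartField (x₀ : X) (a : Fin n) :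
    ContMDiffOn (𝓡 n) (𝓡 n).tangent ∞
      (fun x => (⟨x, chartField x₀ a x⟩ : TangentBundle (𝓡 n) X))
      (chartAt (EuclideanSpace ℝ (Fin n)) x₀).source :=
  (trivializationAt (EuclideanSpace ℝ (Fin n)) (TangentSpace (𝓡 n) : X → Type _)
    x₀).contMDiffOn_localFrame_baseSet (I := 𝓡 n) (n := ∞)
      (EuclideanSpace.basisFun (Fin n) ℝ).toBasis a

theorem mfderiv_chart_chartField (x₀ : X) (a : Fin n) {x : X}
    (hx : x ∈ (chartAt (EuclideanSpace ℝ (Fin n)) x₀).source) :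
    mfderiv (𝓡 n) 𝓘(ℝ, EuclideanSpace ℝ (Fin n)) (extChartAt (𝓡 n) x₀) x (chartField x₀ a x) =
      EuclideanSpace.single a (1 : ℝ) := by
  rw [← TangentBundle.continuousLinearMapAt_trivializationAt hx, chartField]
  have hb : x ∈ (trivializationAt (EuclideanSpace ℝ (Fin n)) (TangentSpace (𝓡 n)) x₀).baseSet := hx
  rw [Bundle.Trivialization.localFrame_apply_of_mem_baseSet _ _ hb]
  simp only [Bundle.Trivialization.basisAt, Module.Basis.map_apply, OrthonormalBasis.coe_toBasis,
    EuclideanSpace.basisFun_apply]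
  have h := Bundle.Trivialization.continuousLinearMapAt_symmL (R := ℝ)
    (trivializationAt (EuclideanSpace ℝ (Fin n)) (TangentSpace (𝓡 n)) x₀) hb
    (EuclideanSpace.single a (1 : ℝ))
  rw [Bundle.Trivialization.symmL_apply _ hb] at h
  exact h

theorem lieD_chart {V : ∀ x : X, TangentSpace (𝓡 n) x} {x₀ x : X} {a : Fin n}
    (hx : x ∈ (chartAt (EuclideanSpace ℝ (Fin n)) x₀).source) (hV : V x = chartField x₀ a x)
    {F : X → ℂ} (hF : IsSmooth n F) :
    lieD V F x = fderiv ℝ (fun y => F ((chartAt (EuclideanSpace ℝ (Fin n)) x₀).symm y))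
      (chartAt (EuclideanSpace ℝ (Fin n)) x₀ x) (EuclideanSpace.single a 1) := by
  set e := chartAt (EuclideanSpace ℝ (Fin n)) x₀ with he
  have h1 : F =ᶠ[𝓝 x] (fun y => F (e.symm y)) ∘ extChartAt (𝓡 n) x₀ := by
    filter_upwards [e.open_source.mem_nhds hx] with y hy
    exact congrArg F (e.left_inv hy).symm
  have h2 : MDifferentiableAt (𝓡 n) 𝓘(ℝ, EuclideanSpace ℝ (Fin n)) (extChartAt (𝓡 n) x₀) x :=
    mdifferentiableAt_extChartAt hx
  have h3 : DifferentiableAt ℝ (fun y => F (e.symm y)) (e x) :=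
    ((hF.contDiffOn_chart x₀).contDiffAt (e.open_target.mem_nhds (e.map_source hx))).differentiableAt
      (by simp)
  have h4 : MDifferentiableAt 𝓘(ℝ, EuclideanSpace ℝ (Fin n)) 𝓘(ℝ, ℂ) (fun y => F (e.symm y))
      (extChartAt (𝓡 n) x₀ x) := h3.mdifferentiableAt
  rw [lieD, h1.mfderiv_eq, mfderiv_comp x h4 h2, hV]
  have h5 := mfderiv_chart_chartField x₀ a hx
  refine (congrArg (mfderiv 𝓘(ℝ, EuclideanSpace ℝ (Fin n)) 𝓘(ℝ, ℂ) (fun y => F (e.symm y))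
    (extChartAt (𝓡 n) x₀ x)) h5).trans ?_
  rw [mfderiv_eq_fderiv]
  rfl

theorem integral_fderiv_eq_zero {f : EuclideanSpace ℝ (Fin n) → ℂ} (hf : ContDiff ℝ ∞ f)
    (hc : HasCompactSupport f) (v : EuclideanSpace ℝ (Fin n)) : ∫ y, fderiv ℝ f y v = 0 := by
  have hi : Integrable fun y => fderiv ℝ f y v :=
    ((hf.continuous_fderiv (by simp)).clm_apply continuous_const).integrable_of_hasCompactSupport
      (hc.fderiv_apply (𝕜 := ℝ) v)
  have hi' : Integrable f := hf.continuous.integrable_of_hasCompactSupport hc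
  have h := integral_mul_fderiv_eq_neg_fderiv_mul_of_integrable (𝕜 := ℂ) (f := fun _ => (1 : ℂ))
    (g := f) (v := v) (μ := volume) (by simp) (by simpa using hi) (by simpa using hi')
    (fun x _ => differentiableAt_const _) (fun x _ => hf.differentiable (by simp) x)
  simpa using h

/-- A function on a chart domain, transported to Euclidean space and extended by zero. -/
def chartPush (x₀ : X) (F : X → ℂ) : EuclideanSpace ℝ (Fin n) → ℂ :=
  (chartAt (EuclideanSpace ℝ (Fin n)) x₀).target.indicator fun y =>
    F ((chartAt (EuclideanSpace ℝ (Fin n)) x₀).symm y)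

theorem chartPush_apply {x₀ x : X} (hx : x ∈ (chartAt (EuclideanSpace ℝ (Fin n)) x₀).source)
    (F : X → ℂ) : chartPush x₀ F (chartAt (EuclideanSpace ℝ (Fin n)) x₀ x) = F x := by
  rw [chartPush, indicator_of_mem (OpenPartialHomeomorph.map_source _ hx),
    OpenPartialHomeomorph.left_inv _ hx]

theorem chartPush_eq_zero {x₀ : X} {K : Set X}
    {F : X → ℂ} (hF : ∀ x ∉ K, F x = 0) {y : EuclideanSpace ℝ (Fin n)}
    (hy : y ∉ chartAt (EuclideanSpace ℝ (Fin n)) x₀ '' K) : chartPush x₀ F y = 0 := by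
  by_cases h : y ∈ (chartAt (EuclideanSpace ℝ (Fin n)) x₀).target
  · rw [chartPush, indicator_of_mem h]
    exact hF _ fun h' => hy ⟨_, h', OpenPartialHomeomorph.right_inv _ h⟩
  · rw [chartPush, indicator_of_notMem h]

theorem isCompact_image_chart {x₀ : X} {K : Set X} (hK : IsCompact K)
    (hKs : K ⊆ (chartAt (EuclideanSpace ℝ (Fin n)) x₀).source) :
    IsCompact (chartAt (EuclideanSpace ℝ (Fin n)) x₀ '' K) :=
  hK.image_of_continuousOn ((OpenPartialHomeomorph.continuousOn _).mono hKs)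

theorem contDiff_chartPush {x₀ : X} {K : Set X} (hK : IsCompact K)
    (hKs : K ⊆ (chartAt (EuclideanSpace ℝ (Fin n)) x₀).source) {F : X → ℂ} (hF : IsSmooth n F)
    (h0 : ∀ x ∉ K, F x = 0) : ContDiff ℝ ∞ (chartPush (n := n) x₀ F) := by
  rw [contDiff_iff_contDiffAt]
  intro y
  by_cases h : y ∈ (chartAt (EuclideanSpace ℝ (Fin n)) x₀).target
  · have ho := (chartAt (EuclideanSpace ℝ (Fin n)) x₀).open_target.mem_nhds h
    refine ((hF.contDiffOn_chart x₀).contDiffAt ho).congr_of_eventuallyEq ?_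
    filter_upwards [ho] with y' hy'
    exact indicator_of_mem hy' _
  · have hy : y ∉ chartAt (EuclideanSpace ℝ (Fin n)) x₀ '' K := by
      rintro ⟨x, hx, rfl⟩
      exact h (OpenPartialHomeomorph.map_source _ (hKs hx))
    refine (contDiffAt_const (c := (0 : ℂ))).congr_of_eventuallyEq ?_
    filter_upwards [(isCompact_image_chart hK hKs).isClosed.isOpen_compl.mem_nhds hy] with y' hy'
    exact chartPush_eq_zero h0 hy'

/-- A field that agrees with the coordinate field on `K` becomes the partial derivative in Euclidean
space; away from the compact image of `K` both sides vanish. -/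
theorem fderiv_chartPush {V : ∀ x : X, TangentSpace (𝓡 n) x} {x₀ : X} {a : Fin n} {K : Set X}
    (hK : IsCompact K) (hKc : IsClosed K)
    (hKs : K ⊆ (chartAt (EuclideanSpace ℝ (Fin n)) x₀).source)
    (hV : ∀ x ∈ K, V x = chartField x₀ a x) {F : X → ℂ} (hF : IsSmooth n F)
    (h0 : ∀ x ∉ K, F x = 0) (y : EuclideanSpace ℝ (Fin n)) :
    fderiv ℝ (chartPush x₀ F) y (EuclideanSpace.single a 1) = chartPush x₀ (lieD V F) y := by
  by_cases hy : y ∈ chartAt (EuclideanSpace ℝ (Fin n)) x₀ '' K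
  · obtain ⟨x, hx, rfl⟩ := hy
    rw [chartPush_apply (hKs hx), lieD_chart (hKs hx) (hV x hx) hF]
    have h : chartPush x₀ F =ᶠ[𝓝 (chartAt (EuclideanSpace ℝ (Fin n)) x₀ x)]
        fun y => F ((chartAt (EuclideanSpace ℝ (Fin n)) x₀).symm y) := by
      filter_upwards [(chartAt (EuclideanSpace ℝ (Fin n)) x₀).open_target.mem_nhds
        (OpenPartialHomeomorph.map_source _ (hKs hx))] with y' hy'
      exact indicator_of_mem hy' _
    rw [h.fderiv_eq]
  · rw [chartPush_eq_zero (fun x hx => lieD_eq_zero hKc h0 hx) hy]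
    have h : chartPush x₀ F =ᶠ[𝓝 y] fun _ => 0 := by
      filter_upwards [(isCompact_image_chart hK hKs).isClosed.isOpen_compl.mem_nhds hy] with y' hy'
      exact chartPush_eq_zero h0 hy'
    rw [h.fderiv_eq]
    simp

end ChartCalculus

/-! ### The density in a chart -/

section ChartIntegral

variable {n : ℕ} {X : Type*} [TopologicalSpace X] [ChartedSpace (EuclideanSpace ℝ (Fin n)) X]
  [IsManifold (𝓡 n) ∞ X] [MeasurableSpace X] [BorelSpace X] {μ : Measure X}

theorem map_chart_eq {e : OpenPartialHomeomorph X (EuclideanSpace ℝ (Fin n))}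
    {ρ : EuclideanSpace ℝ (Fin n) → ℝ}
    (hρ : ∀ s ⊆ e.target, MeasurableSet s →
      μ (e.source ∩ e ⁻¹' s) = ∫⁻ y in s, ENNReal.ofReal (ρ y)) :
    (μ.restrict e.source).map e =
      (volume.restrict e.target).withDensity fun y => ENNReal.ofReal (ρ y) := by
  have hm : AEMeasurable e (μ.restrict e.source) :=
    e.continuousOn.aemeasurable e.open_source.measurableSet
  ext s hs
  have hst : MeasurableSet (s ∩ e.target) := hs.inter e.open_target.measurableSet
  rw [Measure.map_apply_of_aemeasurable hm hs, withDensity_apply _ hs, Measure.restrict_restrict hs,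
    ← hρ _ inter_subset_right hst, Measure.restrict_apply' e.open_source.measurableSet]
  congr 1
  ext x
  constructor
  · rintro ⟨h1, h2⟩
    exact ⟨h2, h1, e.map_source h2⟩
  · rintro ⟨h1, h2, -⟩
    exact ⟨h2, h1⟩

/-- The density that turns `μ` into Lebesgue measure in a chart. -/
def chartDensity (e : OpenPartialHomeomorph X (EuclideanSpace ℝ (Fin n)))
    (ρ : EuclideanSpace ℝ (Fin n) → ℝ) (K : Set X) : X → ℝ :=
  K.indicator fun x => (ρ (e x))⁻¹

/-- The chart carries μ to ρ dy, and the factor 1/ρ on `K` cancels ρ, so ordinary Fourier analysis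
and integration by parts apply. -/
theorem integral_chartDensity {x₀ : X} {ρ : EuclideanSpace ℝ (Fin n) → ℝ}
    (hρc : ContinuousOn ρ (chartAt (EuclideanSpace ℝ (Fin n)) x₀).target)
    (hρ0 : ∀ y ∈ (chartAt (EuclideanSpace ℝ (Fin n)) x₀).target, 0 < ρ y)
    (hρ : ∀ s ⊆ (chartAt (EuclideanSpace ℝ (Fin n)) x₀).target, MeasurableSet s →
      μ ((chartAt (EuclideanSpace ℝ (Fin n)) x₀).source ∩
        chartAt (EuclideanSpace ℝ (Fin n)) x₀ ⁻¹' s) = ∫⁻ y in s, ENNReal.ofReal (ρ y))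
    {K : Set X} (hKs : K ⊆ (chartAt (EuclideanSpace ℝ (Fin n)) x₀).source) {H : X → ℂ}
    (hH : Continuous H) (h0 : ∀ x ∉ K, H x = 0) :
    ∫ x, H x * (chartDensity (chartAt (EuclideanSpace ℝ (Fin n)) x₀) ρ K x : ℂ) ∂μ =
      ∫ y, chartPush (n := n) x₀ H y := by
  set e := chartAt (EuclideanSpace ℝ (Fin n)) x₀ with he
  have hm : AEMeasurable e (μ.restrict e.source) :=
    e.continuousOn.aemeasurable e.open_source.measurableSet
  have hmap := map_chart_eq hρ
  have hc : ContinuousOn (fun y => H (e.symm y) * ((ρ y)⁻¹ : ℝ)) e.target := by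
    refine (hH.comp_continuousOn e.continuousOn_symm).mul ?_
    exact Complex.continuous_ofReal.comp_continuousOn (hρc.inv₀ fun y hy => (hρ0 y hy).ne')
  have hρm : AEMeasurable (fun y => ENNReal.ofReal (ρ y)) (volume.restrict e.target) :=
    (hρc.aemeasurable e.open_target.measurableSet).ennreal_ofReal
  have e1 : ∫ x, H x * (chartDensity e ρ K x : ℂ) ∂μ =
      ∫ x in e.source, H (e.symm (e x)) * ((ρ (e x))⁻¹ : ℝ) ∂μ := by
    rw [← setIntegral_eq_integral_of_forall_compl_eq_zero (s := e.source)
      fun x hx => by rw [h0 x fun h => hx (hKs h), zero_mul]]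
    refine setIntegral_congr_fun e.open_source.measurableSet fun x hx => ?_
    rw [e.left_inv hx]
    by_cases hxK : x ∈ K
    · rw [chartDensity, indicator_of_mem hxK]
    · rw [h0 x hxK, zero_mul, zero_mul]
  rw [e1, ← integral_map (f := fun y => H (e.symm y) * ((ρ y)⁻¹ : ℝ)) hm (by
      rw [hmap]
      exact (hc.aestronglyMeasurable e.open_target.measurableSet).mono_ac
        (withDensity_absolutelyContinuous _ _)), hmap,
    integral_withDensity_eq_integral_toReal_smul₀ hρm (by simp), chartPush,
    integral_indicator e.open_target.measurableSet]
  refine setIntegral_congr_fun e.open_target.measurableSet fun y hy => ?_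
  have := hρ0 y hy
  have h' : (ρ y : ℂ) ≠ 0 := by exact_mod_cast this.ne'
  rw [ENNReal.toReal_ofReal this.le, Complex.real_smul]
  push_cast
  field_simp
  rfl

end ChartIntegral

/-! ### Cut-off coordinates and coordinate fields -/

section PatchConstruction

variable {n : ℕ} {X : Type*} [TopologicalSpace X] [ChartedSpace (EuclideanSpace ℝ (Fin n)) X]
  [IsManifold (𝓡 n) ∞ X]

theorem isSmooth_ofReal {φ : X → ℝ} (hφ : ContMDiff (𝓡 n) 𝓘(ℝ, ℝ) ∞ φ) :
    IsSmooth n fun x => (φ x : ℂ) := by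
  have h : ContMDiff 𝓘(ℝ, ℝ) 𝓘(ℝ, ℂ) ∞ Complex.ofRealCLM := Complex.ofRealCLM.contMDiff
  exact h.comp hφ

theorem exists_smooth_cutoff (n : ℕ) {X : Type*} [TopologicalSpace X]
    [ChartedSpace (EuclideanSpace ℝ (Fin n)) X] [IsManifold (𝓡 n) ∞ X] [T2Space X] [CompactSpace X]
    {K U : Set X} (hK : IsClosed K) (hU : IsOpen U) (hKU : K ⊆ U) :
    ∃ η : X → ℝ, ContMDiff (𝓡 n) 𝓘(ℝ, ℝ) ∞ η ∧ (∀ x ∈ K, ∀ᶠ y in 𝓝 x, η y = 1) ∧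
      tsupport η ⊆ U := by
  obtain ⟨V, hV, hKV, hVU⟩ := normal_exists_closure_subset hK hU hKU
  obtain ⟨f, h1, h0, -⟩ := exists_contMDiffMap_one_nhds_of_subset_interior (𝓡 n) (n := ⊤) hK
    (by rwa [hV.interior_eq])
  refine ⟨f, f.contMDiff, fun x hx => ?_, (closure_mono ?_).trans hVU⟩
  · exact h1.filter_mono (nhds_le_nhdsSet hx)
  · intro x hx
    by_contra h
    exact hx (h0 x h)

/-- The chart at `x₀`, centred at `x₀` and cut off by `θ`. -/
def cutChart (x₀ : X) (θ : X → ℝ) (x : X) : EuclideanSpace ℝ (Fin n) :=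
  θ x • (chartAt (EuclideanSpace ℝ (Fin n)) x₀ x - chartAt (EuclideanSpace ℝ (Fin n)) x₀ x₀)

theorem cutChart_eq {x₀ : X} {θ : X → ℝ} {x : X} (hx : θ x = 1) :
    cutChart (n := n) x₀ θ x =
      chartAt (EuclideanSpace ℝ (Fin n)) x₀ x - chartAt (EuclideanSpace ℝ (Fin n)) x₀ x₀ := by
  rw [cutChart, hx, one_smul]

theorem contMDiff_cutChart {x₀ : X} {θ : X → ℝ} (hθ : ContMDiff (𝓡 n) 𝓘(ℝ, ℝ) ∞ θ)
    (hs : tsupport θ ⊆ (chartAt (EuclideanSpace ℝ (Fin n)) x₀).source) :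
    ContMDiff (𝓡 n) 𝓘(ℝ, EuclideanSpace ℝ (Fin n)) ∞ (cutChart (n := n) x₀ θ) := by
  refine contMDiff_of_tsupport fun x hx => ?_
  have hsub : Function.support (cutChart (n := n) x₀ θ) ⊆ Function.support θ :=
    Function.support_subset_iff.2 fun y hy h => hy (by rw [cutChart, h, zero_smul])
  have hx' : x ∈ (chartAt (EuclideanSpace ℝ (Fin n)) x₀).source := hs (closure_mono hsub hx)
  have h1 : ContMDiffAt (𝓡 n) 𝓘(ℝ, EuclideanSpace ℝ (Fin n)) ∞ (extChartAt (𝓡 n) x₀) x :=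
    contMDiffAt_extChartAt' hx'
  exact (hθ x).smul (h1.sub contMDiffAt_const)

/-- The coordinate fields of the chart at `x₀`, cut off by `θ`. -/
def cutField (x₀ : X) (θ : X → ℝ) (a : Fin n) (x : X) : TangentSpace (𝓡 n) x :=
  θ x • chartField x₀ a x

theorem isSmoothField_cutField {x₀ : X} {θ : X → ℝ} (hθ : ContMDiff (𝓡 n) 𝓘(ℝ, ℝ) ∞ θ)
    (hs : tsupport θ ⊆ (chartAt (EuclideanSpace ℝ (Fin n)) x₀).source) (a : Fin n) :
    IsSmoothField (cutField x₀ θ a) :=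
  ContMDiffOn.smul_section_of_tsupport hθ.contMDiffOn
    (chartAt (EuclideanSpace ℝ (Fin n)) x₀).open_source hs (contMDiffOn_chartField x₀ a)

theorem cutField_eq {x₀ : X} {θ : X → ℝ} {a : Fin n} {x : X} (hx : θ x = 1) :
    cutField x₀ θ a x = chartField x₀ a x := by
  rw [cutField, hx, one_smul]

theorem lieD_cutChart {x₀ : X} {θ : X → ℝ} (hθ : ContMDiff (𝓡 n) 𝓘(ℝ, ℝ) ∞ θ)
    (hs : tsupport θ ⊆ (chartAt (EuclideanSpace ℝ (Fin n)) x₀).source) {x : X}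
    (hx : x ∈ (chartAt (EuclideanSpace ℝ (Fin n)) x₀).source) (h1 : ∀ᶠ y in 𝓝 x, θ y = 1)
    (a b : Fin n) :
    lieD (cutField x₀ θ a) (fun x => ((cutChart (n := n) x₀ θ x b : ℝ) : ℂ)) x =
      if a = b then 1 else 0 := by
  set e := chartAt (EuclideanSpace ℝ (Fin n)) x₀ with he
  rw [lieD_chart hx (cutField_eq h1.self_of_nhds) (isSmooth_coord (contMDiff_cutChart hθ hs) b)]
  have h2 : (fun y => ((cutChart (n := n) x₀ θ (e.symm y) b : ℝ) : ℂ)) =ᶠ[𝓝 (e x)]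
      fun y => ((EuclideanSpace.proj b y - e x₀ b : ℝ) : ℂ) := by
    have h3 : Tendsto e.symm (𝓝 (e x)) (𝓝 x) := by
      have := (e.continuousAt_symm (e.map_source hx)).tendsto
      rwa [e.left_inv hx] at this
    filter_upwards [h3.eventually h1, e.open_target.mem_nhds (e.map_source hx)] with y hy hy'
    rw [cutChart_eq hy, ← he, e.right_inv hy']
    rfl
  rw [h2.fderiv_eq]
  have h4 : HasFDerivAt (fun y : EuclideanSpace ℝ (Fin n) =>
      ((EuclideanSpace.proj b y - e x₀ b : ℝ) : ℂ))
      (Complex.ofRealCLM.comp (EuclideanSpace.proj b : EuclideanSpace ℝ (Fin n) →L[ℝ] ℝ)) (e x) :=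
    Complex.ofRealCLM.hasFDerivAt.comp (e x)
      ((EuclideanSpace.proj b : EuclideanSpace ℝ (Fin n) →L[ℝ] ℝ).hasFDerivAt.sub_const _)
  rw [h4.fderiv]
  by_cases hab : a = b
  · simp [hab]
  · simp [hab, Ne.symm hab]

theorem continuous_chartPush_prod {x₀ : X} {K : Set X} (hK : IsCompact K)
    (hKs : K ⊆ (chartAt (EuclideanSpace ℝ (Fin n)) x₀).source) {F : ℝ × X → ℂ} (hF : Continuous F)
    (h0 : ∀ q : ℝ × X, q.2 ∉ K → F q = 0) :
    Continuous fun p : ℝ × EuclideanSpace ℝ (Fin n) => chartPush x₀ (fun x => F (p.1, x)) p.2 := by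
  set e := chartAt (EuclideanSpace ℝ (Fin n)) x₀ with he
  rw [continuous_iff_continuousAt]
  rintro ⟨r, y⟩
  by_cases h : y ∈ e.target
  · have ho : ∀ᶠ p : ℝ × EuclideanSpace ℝ (Fin n) in 𝓝 (r, y), p.2 ∈ e.target :=
      continuousAt_snd.eventually (e.open_target.mem_nhds h)
    have hc : ContinuousAt (fun p : ℝ × EuclideanSpace ℝ (Fin n) => F (p.1, e.symm p.2)) (r, y) :=
      hF.continuousAt.comp (continuousAt_fst.prodMk
        (ContinuousAt.comp (f := Prod.snd) (e.continuousAt_symm h) continuousAt_snd))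
    refine hc.congr ?_
    filter_upwards [ho] with p hp
    rw [chartPush, indicator_of_mem hp]
  · have hy : y ∉ e '' K := by
      rintro ⟨x, hx, rfl⟩
      exact h (e.map_source (hKs hx))
    refine (continuousAt_const (y := (0 : ℂ))).congr ?_
    filter_upwards [continuousAt_snd.eventually
      ((isCompact_image_chart hK hKs).isClosed.isOpen_compl.mem_nhds hy)] with p hp
    exact (chartPush_eq_zero (fun x hx => h0 (p.1, x) hx) hp).symm

end PatchConstruction

/-! ### Existence of the patches -/

section PatchExistence

variable {n : ℕ} {X : Type*} [TopologicalSpace X] [ChartedSpace (EuclideanSpace ℝ (Fin n)) X]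
  [IsManifold (𝓡 n) ∞ X] [T2Space X] [CompactSpace X] [MeasurableSpace X] [BorelSpace X]
  {μ : Measure X}

theorem measurable_chartDensity {e : OpenPartialHomeomorph X (EuclideanSpace ℝ (Fin n))}
    {ρ : EuclideanSpace ℝ (Fin n) → ℝ} (hρ : ContinuousOn ρ e.target) (h0 : ∀ y ∈ e.target, 0 < ρ y)
    {K : Set X} (hK : IsClosed K) (hKs : K ⊆ e.source) : Measurable (chartDensity e ρ K) := by
  classical
  have hc : ContinuousOn (fun x => (ρ (e x))⁻¹) K :=
    ((hρ.comp e.continuousOn e.mapsTo).inv₀ fun x hx => (h0 _ (e.map_source hx)).ne').mono hKs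
  rw [chartDensity, ← piecewise_eq_indicator]
  exact hc.measurable_piecewise continuousOn_const hK.measurableSet

theorem exists_bound_chartDensity {e : OpenPartialHomeomorph X (EuclideanSpace ℝ (Fin n))}
    {ρ : EuclideanSpace ℝ (Fin n) → ℝ} (hρ : ContinuousOn ρ e.target) (h0 : ∀ y ∈ e.target, 0 < ρ y)
    {K : Set X} (hK : IsClosed K) (hKs : K ⊆ e.source) : ∃ C : ℝ, ∀ x, |chartDensity e ρ K x| ≤ C := by
  have hc : ContinuousOn (fun x => (ρ (e x))⁻¹) K :=
    ((hρ.comp e.continuousOn e.mapsTo).inv₀ fun x hx => (h0 _ (e.map_source hx)).ne').mono hKs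
  obtain ⟨C, hC⟩ := hK.isCompact.exists_bound_of_continuousOn hc
  refine ⟨max C 0, fun x => ?_⟩
  by_cases hx : x ∈ K
  · rw [chartDensity, indicator_of_mem hx]
    exact (hC x hx).trans (le_max_left _ _)
  · rw [chartDensity, indicator_of_notMem hx, abs_zero]
    exact le_max_right _ _

/-- The part of the chart domain at `x₀` on which the centred coordinates have norm less
than `3/8`. -/
def smallChart (n : ℕ) {X : Type*} [TopologicalSpace X] [ChartedSpace (EuclideanSpace ℝ (Fin n)) X]
    (x₀ : X) : Set X :=
  (chartAt (EuclideanSpace ℝ (Fin n)) x₀).source ∩ chartAt (EuclideanSpace ℝ (Fin n)) x₀ ⁻¹'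
    Metric.ball (chartAt (EuclideanSpace ℝ (Fin n)) x₀ x₀) (3 / 8)

theorem isOpen_smallChart (x₀ : X) : IsOpen (smallChart n x₀) :=
  OpenPartialHomeomorph.isOpen_inter_preimage _ Metric.isOpen_ball

/-- Two nested cut-offs: η is 1 near the support of φ, and θ is 1 near the support of η. Coordinates
and fields are cut off by θ, hence globally smooth, yet they are the true ones wherever η ≠ 0. -/
theorem exists_patch (hμ : IsSmoothDensity n μ) (x₀ : X) {φ : X → ℝ}
    (hφ : ContMDiff (𝓡 n) 𝓘(ℝ, ℝ) ∞ φ) (hsupp : tsupport φ ⊆ smallChart n x₀) :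
    ∃ P : ChartPatch n μ, P.φ = φ := by
  set e := chartAt (EuclideanSpace ℝ (Fin n)) x₀ with he
  set K := tsupport φ with hKdef
  have hK : IsClosed K := isClosed_tsupport φ
  have hUs : smallChart n x₀ ⊆ e.source := inter_subset_left
  have hKs : K ⊆ e.source := hsupp.trans hUs
  obtain ⟨η, hη, hη1, hηs⟩ := exists_smooth_cutoff n hK (isOpen_smallChart x₀) hsupp
  obtain ⟨θ, hθ, hθ1, hθs⟩ :=
    exists_smooth_cutoff n (isClosed_tsupport η) (isOpen_smallChart x₀) hηs
  obtain ⟨ρ, hρs, hρ0, hρ⟩ := hμ e (chart_mem_atlas _ x₀)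
  have hηθ : ∀ x, η x ≠ 0 → θ x = 1 := fun x hx => (hθ1 x (subset_tsupport η hx)).self_of_nhds
  have hKη : ∀ x ∈ K, η x = 1 := fun x hx => (hη1 x hx).self_of_nhds
  have hKη' : ∀ x ∈ K, η x ≠ 0 := fun x hx => by simp [hKη x hx]
  have hsrc : ∀ x, η x ≠ 0 → x ∈ e.source := fun x hx => hUs (hηs (subset_tsupport η hx))
  -- The radius 3/8 of the small chart leaves a margin inside the unit cube, which the Fourier
  -- expansion needs.
  have hκ : ∀ x, η x ≠ 0 → ∀ a, |cutChart (n := n) x₀ θ x a| < 3 / 8 := by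
    intro x hx a
    rw [cutChart_eq (hηθ x hx)]
    refine lt_of_le_of_lt (PiLp.norm_apply_le (p := 2) (e x - e x₀) a) ?_
    rw [← dist_eq_norm]
    exact (hηs (subset_tsupport η hx)).2
  have hθs' := hθs.trans hUs
  refine ⟨{
    K := K, φ := φ, η := η, w := chartDensity e ρ K, κ := cutChart x₀ θ, V := cutField x₀ θ
    isClosed_K := hK
    smooth_φ := isSmooth_ofReal hφ
    smooth_η := isSmooth_ofReal hη
    smooth_κ := contMDiff_cutChart hθ hθs'
    smooth_V := isSmoothField_cutField hθ hθs'
    measurable_w := measurable_chartDensity hρs.continuousOn hρ0 hK hKs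
    bound_w := exists_bound_chartDensity hρs.continuousOn hρ0 hK hKs
    φ_eq_zero := fun x hx => image_eq_zero_of_notMem_tsupport hx
    η_eq_one := hKη
    κ_lt := fun x hx a => (hκ x hx a).trans (by norm_num)
    κ_le := fun x hx a => (hκ x (hKη' x hx) a).le
    κ_inj := ?_
    lieD_κ := fun x hx a b => lieD_cutChart hθ hθs' (hKs hx)
      (hθ1 x (subset_tsupport η (hKη' x hx))) a b
    integral_lieD := ?_
    extend := ?_ }, rfl⟩
  · intro x hx x' hx' h
    rw [cutChart_eq (hηθ x' hx'), cutChart_eq (hηθ x (hKη' x hx))] at h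
    exact e.injOn (hsrc x' hx') (hKs hx) (sub_left_injective h)
  · intro a F hF hF0
    have hV : ∀ x ∈ K, cutField x₀ θ a x = chartField x₀ a x := fun x hx =>
      cutField_eq (hηθ x (hKη' x hx))
    have hsm := hF.lieD (isSmoothField_cutField hθ hθs' a)
    rw [integral_chartDensity hρs.continuousOn hρ0 hρ hKs (ContMDiff.continuous hsm)
      fun x hx => lieD_eq_zero hK hF0 hx]
    rw [← integral_congr_ae (ae_of_all _ (fderiv_chartPush hK.isCompact hK hKs hV hF hF0))]
    refine integral_fderiv_eq_zero (contDiff_chartPush hK.isCompact hKs hF hF0) ?_ _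
    exact HasCompactSupport.intro (isCompact_image_chart hK.isCompact hKs)
      fun y hy => chartPush_eq_zero hF0 hy
  · intro F hF hF0
    have hF0' : ∀ r, ∀ x ∉ K, F (r, x) = 0 := fun r x hx => hF0 (r, x) hx
    refine ⟨fun p => chartPush x₀ (fun x => F (p.1, x)) (p.2 + e x₀), ?_, ?_, ?_, ?_⟩
    · exact (continuous_chartPush_prod hK.isCompact hKs hF hF0).comp
        (continuous_fst.prodMk (continuous_snd.add continuous_const))
    · intro r x hx
      rw [cutChart_eq (hηθ x (hKη' x hx))]
      simp only [sub_add_cancel, ← he]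
      exact chartPush_apply (hKs hx) _
    · intro r y hy
      have : y + e x₀ ∈ e '' K := by
        by_contra h
        exact hy (chartPush_eq_zero (hF0' r) h)
      obtain ⟨x, hx, hxy⟩ := this
      refine ⟨x, hx, ?_⟩
      rw [cutChart_eq (hηθ x (hKη' x hx)), ← he, hxy, add_sub_cancel_right]
    · intro r g hg
      have hc : Continuous fun x => F (r, x) * g (cutChart (n := n) x₀ θ x) :=
        (hF.comp (Continuous.prodMk_right r)).mul
          (hg.comp (contMDiff_cutChart hθ hθs').continuous)
      rw [integral_chartDensity hρs.continuousOn hρ0 hρ hKs hc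
        fun x hx => by rw [hF0' r x hx, zero_mul]]
      rw [← integral_add_right_eq_self _ (e x₀)]
      refine integral_congr_ae (ae_of_all _ fun y => ?_)
      by_cases hy : y + e x₀ ∈ e '' K
      · obtain ⟨x, hx, hxy⟩ := hy
        have hxy' : y = e x - e x₀ := by rw [hxy, add_sub_cancel_right]
        beta_reduce
        rw [← hxy, chartPush_apply (hKs hx), chartPush_apply (hKs hx),
          cutChart_eq (hηθ x (hKη' x hx)), hxy']
      · beta_reduce
        rw [chartPush_eq_zero (K := K) (fun x hx => by rw [hF0' r x hx, zero_mul]) hy,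
          chartPush_eq_zero (hF0' r) hy, zero_mul]

theorem exists_patches (hμ : IsSmoothDensity n μ) :
    ∃ (m : ℕ) (P : Fin m → ChartPatch n μ), ∀ x, ∑ i, (P i).φ x = 1 := by
  obtain ⟨t, ht⟩ := isCompact_univ.elim_finite_subcover (fun x : X => smallChart n x)
    isOpen_smallChart fun x _ => mem_iUnion.2 ⟨x, mem_chart_source _ x, by simp⟩
  obtain ⟨f, hf⟩ := SmoothPartitionOfUnity.exists_isSubordinate (𝓡 n) isClosed_univ
    (fun i : Fin t.card => smallChart n ((t.equivFin.symm i : t) : X))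
    (fun i => isOpen_smallChart _) fun x _ => by
      obtain ⟨y, hy, hxy⟩ := mem_iUnion₂.1 (ht (mem_univ x))
      exact mem_iUnion.2 ⟨t.equivFin ⟨y, hy⟩, by simpa using hxy⟩
  choose P hP using fun i => exists_patch hμ _ (f i).contMDiff (hf i)
  refine ⟨t.card, P, fun x => ?_⟩
  rw [← f.sum_eq_one (mem_univ x), finsum_eq_sum_of_fintype]
  exact Finset.sum_congr rfl fun i _ => by rw [hP i]

end PatchExistence

end ConeGreen

end

/-- The equivalence packs existence and uniqueness into one formula: `Φ A` is a kernel of `A`, and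
any other kernel in the space equals it. -/
theorem mainTheorem9 {n : ℕ} {X : Type*} [TopologicalSpace X]
    [ChartedSpace (EuclideanSpace ℝ (Fin n)) X] [IsManifold (𝓡 n) ∞ X] [T2Space X] [CompactSpace X]
    [MeasurableSpace X] [BorelSpace X] (μ : Measure X) [IsFiniteMeasure μ]
    (hμ : ConeGreen.IsSmoothDensity n μ) (γ γ' ε : ℝ) (hε : 0 < ε) :
    ∃ Φ : ConeGreen.GreenOp n μ γ γ' ε →ₗ[ℂ] ConeGreen.ConeKernelSpace n μ γ' (-γ) (ε / 2),
      Continuous Φ ∧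
      ∀ (A : ConeGreen.GreenOp n μ γ γ' ε) (k : ConeGreen.ConeKernelSpace n μ γ' (-γ) (ε / 2)),
        ConeGreen.IsIntegralOperator A.op (ConeGreen.kernelFun (half_pos hε) k) ↔ k = Φ A := by
  obtain ⟨m, P, hP⟩ := ConeGreen.exists_patches hμ
  exact ⟨(ConeGreen.coneFrame P hP).kernelMap hε, (ConeGreen.coneFrame P hP).continuous_kernelMap hε,
    fun A k => (ConeGreen.coneFrame P hP).isIntegralOperator_iff_eq_kernelMap hε A k⟩
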